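/- Let $n\ge 2$, let $g=g_{ij}(x)\,dx^i dx^j$ be a smooth ($C^\infty$) pseudo-Riemannian metric of arbitrary signature on $\mathbb{R}^n$, and let $D\subset\mathbb{R}^n$ be an open disc (an open set homeomorphic to the open unit ball) that is geodesically convex for $g$: any two points of $D$ are joined by a unique geodesic segment lying in $D$ (parametrised affinely by $[0,1]$), and its initial velocity depends continuously on the two points. Let $H(x,p)=\frac12 g^{ij}(x)p_ip_j$ be the Hamiltonian of the geodesic flow, with the canonical Poisson bracket $\{\cdot,\cdot\}$ on $T^*D=D\times\mathbb{R}^n$. An integral is a function $F\in C^\infty(T^*D)$ with $\{F,H\}=0$ on $T^*D$. Functions on $T^*D$ are called functionally independent if their differentials are linearly independent at almost every point of $T^*D$. Then the geodesic flow of $g|_D$ is Liouville-integrable with smooth integrals: there exist $n$ functionally independent integrals $F_1,\dots,F_n$ with $\{F_i,F_j\}=0$ on $T^*D$ for all $i,j$. Moreover, it is superintegrable: there exist $2n-1$ functionally independent integrals such that some $n$ of them pairwise Poisson-commute on $T^*D$. -/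

import Mathlib

namespace GeodesicFlow

open Set MeasureTheory
open scoped ContDiff

/-- Coordinate space `ℝⁿ`. -/
abbrev Coord (n : ℕ) : Type := Fin n → ℝ

/-- The cotangent bundle `T*ℝⁿ` in the canonical coordinates `(x, p)`. -/
abbrev Phase (n : ℕ) : Type := Coord n × Coord n

/-- A smooth pseudo-Riemannian metric `g = g_ij(x) dxⁱ dxʲ` on `ℝⁿ`. The signature is arbitrary. -/
structure MetricTensor (n : ℕ) where
  /-- the Gram matrix `g_ij(x)` -/
  gram : Coord n → Matrix (Fin n) (Fin n) ℝ
  smooth : ∀ i j, ContDiff ℝ ∞ (fun x => gram x i j)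
  symm : ∀ x, (gram x).IsSymm
  nondegenerate : ∀ x, (gram x).det ≠ 0

/-- The Hamiltonian `H(x, p) = ½ gⁱʲ(x) pᵢ pⱼ` of the geodesic flow. -/
noncomputable def MetricTensor.hamiltonian {n : ℕ} (g : MetricTensor n) (z : Phase n) : ℝ :=
  (1 / 2) * ∑ i, ∑ j, (g.gram z.1)⁻¹ i j * z.2 i * z.2 j

/-- The partial derivative `∂F/∂xⁱ` at `z`. -/
noncomputable def partialX {n : ℕ} (F : Phase n → ℝ) (i : Fin n) (z : Phase n) : ℝ :=
  fderiv ℝ F z (Pi.single i 1, 0)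

/-- The partial derivative `∂F/∂pᵢ` at `z`. -/
noncomputable def partialP {n : ℕ} (F : Phase n → ℝ) (i : Fin n) (z : Phase n) : ℝ :=
  fderiv ℝ F z (0, Pi.single i 1)

/-- The canonical Poisson bracket `{F, G} = ∑ᵢ (∂G/∂xⁱ ∂F/∂pᵢ - ∂F/∂xⁱ ∂G/∂pᵢ)`. -/
noncomputable def poissonBracket {n : ℕ} (F G : Phase n → ℝ) (z : Phase n) : ℝ :=
  ∑ i, (partialX G i z * partialP F i z - partialX F i z * partialP G i z)

/-- `T*D`, as a subset of `T*ℝⁿ`. -/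
def cotangent {n : ℕ} (D : Set (Coord n)) : Set (Phase n) := D ×ˢ univ

/-- `γ|[0,1]` is an affinely parametrised geodesic segment of `g` lying in `D`: the projection to
`D` of an orbit segment `(γ, p)` of the Hamiltonian system
`dxⁱ/dt = ∂H/∂pᵢ`, `dpᵢ/dt = - ∂H/∂xⁱ`. (Derivatives at the end points are one-sided.) -/
def MetricTensor.IsGeodesicSegment {n : ℕ} (g : MetricTensor n) (D : Set (Coord n)) (γ : ℝ → Coord n) : Prop :=
  (∀ t ∈ Icc (0 : ℝ) 1, γ t ∈ D) ∧
  ∃ p : ℝ → Coord n, ∀ t ∈ Icc (0 : ℝ) 1, ∀ i,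
    HasDerivWithinAt (fun s => γ s i) (partialP g.hamiltonian i (γ t, p t)) (Icc 0 1) t ∧
    HasDerivWithinAt (fun s => p s i) (-partialX g.hamiltonian i (γ t, p t)) (Icc 0 1) t

/-- `D` is geodesically convex: any two points `x, y` of `D` are joined by a unique geodesic
segment lying in `D`, and this segment (that is, its initial velocity `V x y`) depends
continuously on its end points. -/
def MetricTensor.IsGeodesicallyConvex {n : ℕ} (g : MetricTensor n) (D : Set (Coord n)) : Prop :=
  ∃ V : Coord n → Coord n → Coord n,
    ContinuousOn (fun q : Coord n × Coord n => V q.1 q.2) (D ×ˢ D) ∧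
    ∀ x ∈ D, ∀ y ∈ D, ∃ γ : ℝ → Coord n,
      g.IsGeodesicSegment D γ ∧ γ 0 = x ∧ γ 1 = y ∧
      HasDerivWithinAt γ (V x y) (Icc 0 1) 0 ∧
      ∀ γ' : ℝ → Coord n, g.IsGeodesicSegment D γ' → γ' 0 = x → γ' 1 = y →
        EqOn γ' γ (Icc 0 1)

/-- An open disc in `ℝⁿ`: an open subset homeomorphic to the open Euclidean unit ball.
Round open balls are examples. -/
def IsOpenDisc {n : ℕ} (D : Set (Coord n)) : Prop :=
  IsOpen D ∧ Nonempty (D ≃ₜ Metric.ball (0 : EuclideanSpace ℝ (Fin n)) 1)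

/-- `F` is a smooth integral on `T*D` of the geodesic flow of `g|_D`. -/
def MetricTensor.IsSmoothIntegral {n : ℕ} (g : MetricTensor n) (D : Set (Coord n)) (F : Phase n → ℝ) : Prop :=
  ContDiffOn ℝ ∞ F (cotangent D) ∧ ∀ z ∈ cotangent D, poissonBracket F g.hamiltonian z = 0

/-- The functions `F k` are functionally independent almost everywhere on `T*D`: at Lebesgue almost
every point of `T*D` their differentials are linearly independent. -/
def FunctionallyIndependent {n : ℕ} {ι : Type*} (D : Set (Coord n)) (F : ι → Phase n → ℝ) : Prop :=
  ∀ᵐ z : Phase n, z ∈ cotangent D → LinearIndependent ℝ (fun k => fderiv ℝ (F k) z)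

/-- The geodesic flow of `g|_D` is Liouville integrable with smooth integrals. -/
def MetricTensor.IsLiouvilleIntegrable {n : ℕ} (g : MetricTensor n) (D : Set (Coord n)) : Prop :=
  ∃ F : Fin n → Phase n → ℝ,
    (∀ k, g.IsSmoothIntegral D (F k)) ∧
    FunctionallyIndependent D F ∧
    ∀ k l, ∀ z ∈ cotangent D, poissonBracket (F k) (F l) z = 0

/-- The geodesic flow of `g|_D` is superintegrable with smooth integrals: there are `2n - 1`
functionally independent ones, of which some `n` are in involution. -/
def MetricTensor.IsSuperintegrable {n : ℕ} (g : MetricTensor n) (D : Set (Coord n)) : Prop :=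
  ∃ F : Fin (2 * n - 1) → Phase n → ℝ,
    (∀ k, g.IsSmoothIntegral D (F k)) ∧
    FunctionallyIndependent D F ∧
    ∃ s : Finset (Fin (2 * n - 1)), s.card = n ∧
      ∀ k ∈ s, ∀ l ∈ s, ∀ z ∈ cotangent D, poissonBracket (F k) (F l) z = 0

end GeodesicFlow

/-! Off the zero section the orbits form a Hausdorff manifold of dimension `2n - 1`. A smooth
function with compact support in a chart of this orbit space, lifted to `T*D` and extended by zero,
is a smooth integral; so integrals abound.

The Hausdorff property comes from convexity. If the flow carries `(x, p)` to `(x', p')` in time `t`,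
homogeneity and uniqueness of geodesics give that `V x x'` is `t` times the velocity of `(x, p)`.
Hence `t` depends continuously on the end points, limits of orbit segments are orbit segments
(`tendsto_time`), orbits do not return (`eventually_abs_time_lt`), and the orbits through a compact
set of coordinates fill a closed subset of `T*D` (`mem_saturation_of_mem_closure`). Charts come from
hypersurfaces `xⁱ = c` transverse to the flow: the other positions `q` and momenta `p` are kept and
the energy `E` replaces `pᵢ` (`exists_orbitChart`).

Let `b` be a bump function on `[-1, 1]`. On a cube of a chart, in centred and rescaled coordinates,
put `F_j = b(E) ∏ₖ (b(qₖ) b(pₖ))^(1 + δ_jk)` and `G_j = b(E) ∏ₖ b(qₖ)^(1 + δ_jk) b(pₖ)` for the `n -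
1` indices `j`. The `F_j` depend only on `E` and the products `b(qₖ) b(pₖ)`, so they commute
(`poissonForm_coord_eq_zero`). Together with `H`, the `F_j` and `G_j` are `2n - 1` functions,
independent off the hyperplanes `qₖ = 0`, `pₖ = 0` (`linearIndependent_cubeFamily`).

To globalise, disjoint cubes fill the orbit space up to a null set (`exists_disjoint_cells`), and
small weights make the sums over all cubes smooth (`exists_pos_contDiffOn_tsum`). Inside a cell,
involution is checked on the section and carried along orbits, because a bracket of integrals is an
integral. Outside all cells the sums attain their minimum `0`, so their differentials vanish however
the cells accumulate (`fderiv_globalIntegral_eq_zero`).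

Smoothness of flows is obtained from the implicit function theorem on a space of curves
(`contDiff_flow`). -/

open Set Filter Topology MeasureTheory
open scoped ContDiff

/-! ### Calculus on the Banach space of continuous curves -/

namespace SmoothFlow

section Superposition

variable {K : Type*} [TopologicalSpace K] [CompactSpace K]
  {E F : Type} [NormedAddCommGroup E] [NormedSpace ℝ E] [NormedAddCommGroup F] [NormedSpace ℝ F]

/-- Pointwise application of a continuous family of operators to a continuous family of vectors. -/
noncomputable def pointwiseApply (K : Type*) [TopologicalSpace K] [CompactSpace K]
    (E F : Type) [NormedAddCommGroup E] [NormedSpace ℝ E] [NormedAddCommGroup F]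
    [NormedSpace ℝ F] : C(K, E →L[ℝ] F) →L[ℝ] C(K, E) →L[ℝ] C(K, F) :=
  LinearMap.mkContinuous₂
    (LinearMap.mk₂ ℝ (fun (A : C(K, E →L[ℝ] F)) (h : C(K, E)) => (⟨fun s => A s (h s), by fun_prop⟩ : C(K, F)))
      (fun _ _ _ => by ext; simp) (fun _ _ _ => by ext; simp)
      (fun _ _ _ => by ext; simp) (fun _ _ _ => by ext; simp)) 1
    (fun A h => by
      rw [ContinuousMap.norm_le _ (by positivity)]
      intro s
      simp only [one_mul, LinearMap.mk₂_apply, ContinuousMap.coe_mk]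
      exact (A s).le_of_opNorm_le_of_le (A.norm_coe_le_norm s) (h.norm_coe_le_norm s))

/-- The superposition operator `γ ↦ v ∘ γ` is differentiable if `v` is continuously
differentiable. -/
theorem hasFDerivAt_superposition (v : C(E, F)) (v' : C(E, E →L[ℝ] F))
    (hv : ∀ x, HasFDerivAt v (v' x) x) (γ : C(K, E)) :
    HasFDerivAt (fun γ : C(K, E) => v.comp γ) (pointwiseApply K E F (v'.comp γ)) γ := by
  rw [hasFDerivAt_iff_isLittleO_nhds_zero, Asymptotics.isLittleO_iff]
  intro ε hε
  have hc : ContinuousAt (fun γ : C(K, E) => v'.comp γ) γ :=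
    (ContinuousMap.continuous_postcomp v').continuousAt
  obtain ⟨δ, hδ, h⟩ := (Metric.continuousAt_iff (f := fun γ : C(K, E) => v'.comp γ)
    (a := γ)).1 hc ε hε
  filter_upwards [Metric.ball_mem_nhds (0 : C(K, E)) hδ] with η hη
  rw [mem_ball_zero_iff] at hη
  rw [ContinuousMap.norm_le _ (by positivity)]
  intro s
  have hb : ∀ x ∈ segment ℝ (γ s) (γ s + η s), ‖v' x - v' (γ s)‖ ≤ ε := by
    intro x hx
    rw [segment_eq_image'] at hx
    obtain ⟨θ, hθ, rfl⟩ := hx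
    have h1 : dist (γ + θ • η) γ < δ := by
      rw [dist_eq_norm, add_sub_cancel_left, norm_smul, Real.norm_of_nonneg hθ.1]
      nlinarith [norm_nonneg η, hθ.2]
    have h2 := (ContinuousMap.dist_lt_iff hε).1 (h h1) s
    rw [dist_eq_norm] at h2
    simpa using h2.le
  have := (convex_segment (γ s) (γ s + η s)).norm_image_sub_le_of_norm_hasFDerivWithin_le'
    (fun x _ => (hv x).hasFDerivWithinAt) hb (left_mem_segment ℝ _ _) (right_mem_segment ℝ _ _)
  simp only [add_sub_cancel_left] at this
  exact this.trans (by gcongr; exact η.norm_coe_le_norm s)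

/-- The derivative is the superposition operator of `fderiv ℝ v` followed by the linear map
`pointwiseApply`, so smoothness bootstraps. The target `F` stays free in the induction because
`fderiv ℝ v` takes values in `E →L[ℝ] F`. -/
theorem contDiff_superposition_nat (n : ℕ) : ∀ {F : Type} [NormedAddCommGroup F] [NormedSpace ℝ F]
    (v : C(E, F)), ContDiff ℝ ∞ v → ContDiff ℝ n (fun γ : C(K, E) => v.comp γ) := by
  induction n with
  | zero =>
    intro F _ _ v _
    exact contDiff_zero.2 (ContinuousMap.continuous_postcomp v)
  | succ n ih =>
    intro F _ _ v hv
    have hd : ContDiff ℝ ∞ (fderiv ℝ v) := hv.fderiv_right (by simp)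
    let v' : C(E, E →L[ℝ] F) := ⟨fderiv ℝ v, hd.continuous⟩
    have h := hasFDerivAt_superposition (K := K) v v'
      (fun x => (hv.differentiable (by simp) x).hasFDerivAt)
    rw [Nat.cast_add, Nat.cast_one, contDiff_succ_iff_fderiv]
    refine ⟨fun γ => (h γ).differentiableAt, by simp, ?_⟩
    have : fderiv ℝ (fun γ : C(K, E) => v.comp γ) =
        fun γ => pointwiseApply K E F (v'.comp γ) := funext fun γ => (h γ).fderiv
    rw [this]
    exact (pointwiseApply K E F).contDiff.comp (ih v' hd)

/-- The superposition operator of a smooth map is smooth. -/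
theorem contDiff_superposition (v : C(E, F)) (hv : ContDiff ℝ ∞ v) :
    ContDiff ℝ ∞ (fun γ : C(K, E) => v.comp γ) :=
  contDiff_infty.2 fun n => contDiff_superposition_nat n v hv

end Superposition

section Primitive

variable (E : Type) [NormedAddCommGroup E] [NormedSpace ℝ E]

theorem norm_integral_extend_le {E : Type} [NormedAddCommGroup E] [NormedSpace ℝ E]
    (γ : C(Icc (0 : ℝ) 1, E)) {s : ℝ} (hs : s ∈ Icc (0 : ℝ) 1) :
    ‖∫ r in (0 : ℝ)..s, IccExtend zero_le_one γ r‖ ≤ ‖γ‖ := by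
  have := intervalIntegral.norm_integral_le_of_norm_le_const (a := 0) (b := s)
    (f := IccExtend zero_le_one γ) (C := ‖γ‖) (fun x _ => γ.norm_coe_le_norm _)
  refine this.trans ?_
  rw [sub_zero, abs_of_nonneg hs.1]
  nlinarith [norm_nonneg γ, hs.2]

/-- The primitive vanishing at `0` of a continuous curve on `[0, 1]`. -/
noncomputable def primitive : C(Icc (0 : ℝ) 1, E) →L[ℝ] C(Icc (0 : ℝ) 1, E) :=
  LinearMap.mkContinuous
    { toFun := fun γ => ⟨fun s => ∫ r in (0 : ℝ)..s, IccExtend zero_le_one γ r,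
        (intervalIntegral.continuous_primitive
          (fun _ _ => (γ.continuous.Icc_extend' ).intervalIntegrable _ _) 0).comp
            continuous_subtype_val⟩
      map_add' := fun γ η => by
        ext s
        exact intervalIntegral.integral_add ((γ.continuous.Icc_extend').intervalIntegrable _ _)
          ((η.continuous.Icc_extend').intervalIntegrable _ _)
      map_smul' := fun c γ => by
        ext s
        exact intervalIntegral.integral_smul c _ } 1
    (fun γ => by
      rw [ContinuousMap.norm_le _ (by positivity), one_mul]
      exact fun s => norm_integral_extend_le γ s.2)

variable {E}

theorem norm_primitive_le (γ : C(Icc (0 : ℝ) 1, E)) : ‖primitive E γ‖ ≤ ‖γ‖ := by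
  simpa using (primitive E).le_of_opNorm_le (LinearMap.mkContinuous_norm_le _ zero_le_one _) γ

end Primitive

end SmoothFlow

/-! ### Smooth dependence of flows on time and initial point -/

namespace SmoothFlow

variable {E : Type} [NormedAddCommGroup E] [NormedSpace ℝ E]

/-- The constant curves. -/
noncomputable def constantCurve (E : Type) [NormedAddCommGroup E] [NormedSpace ℝ E] :
    E →L[ℝ] C(Icc (0 : ℝ) 1, E) :=
  LinearMap.mkContinuous
    { toFun := fun z => ContinuousMap.const _ z
      map_add' := fun _ _ => rfl
      map_smul' := fun _ _ => rfl } 1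
    (fun z => by
      rw [ContinuousMap.norm_le _ (by positivity), one_mul]
      exact fun _ => le_rfl)

/-- The defect in the integral equation `γ(s) = z + T ∫₀ˢ v(γ(r)) dr`. -/
noncomputable def picardDefect (v : C(E, E)) (q : (E × ℝ) × C(Icc (0 : ℝ) 1, E)) :
    C(Icc (0 : ℝ) 1, E) :=
  q.2 - constantCurve E q.1.1 - q.1.2 • primitive E (v.comp q.2)

theorem contDiff_picardDefect (v : C(E, E)) (hv : ContDiff ℝ ∞ v) :
    ContDiff ℝ ∞ (picardDefect v) := by
  have h1 : ContDiff ℝ ∞ (fun q : (E × ℝ) × C(Icc (0 : ℝ) 1, E) => primitive E (v.comp q.2)) :=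
    (primitive E).contDiff.comp ((contDiff_superposition v hv).comp contDiff_snd)
  have h2 : ContDiff ℝ ∞ (fun q : (E × ℝ) × C(Icc (0 : ℝ) 1, E) => constantCurve E q.1.1) :=
    (constantCurve E).contDiff.comp (contDiff_fst.comp contDiff_fst)
  exact (contDiff_snd.sub h2).sub ((contDiff_snd.comp contDiff_fst).smul h1)

theorem fderiv_picardDefect_inr (v : C(E, E)) (hv : ContDiff ℝ ∞ v)
    (q : (E × ℝ) × C(Icc (0 : ℝ) 1, E)) (v' : C(E, E →L[ℝ] E))
    (hv' : ∀ x, HasFDerivAt v (v' x) x) :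
    fderiv ℝ (picardDefect v) q ∘L .inr ℝ (E × ℝ) C(Icc (0 : ℝ) 1, E) =
      1 - q.1.2 • (primitive E ∘L pointwiseApply _ E E (v'.comp q.2)) := by
  have h1 := (((contDiff_picardDefect v hv).differentiable (by simp) q).hasFDerivAt)
  have h2 : HasFDerivAt (fun γ : C(Icc (0 : ℝ) 1, E) => (q.1, γ))
      (.inr ℝ (E × ℝ) C(Icc (0 : ℝ) 1, E)) q.2 := hasFDerivAt_prodMk_right _ _
  have h3 : HasFDerivAt (fun γ => picardDefect v (q.1, γ)) _ q.2 :=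
    HasFDerivAt.comp (g := picardDefect v) (f := fun γ => (q.1, γ)) q.2 h1 h2
  have h4 : HasFDerivAt (fun γ => picardDefect v (q.1, γ))
      (1 - q.1.2 • (primitive E ∘L pointwiseApply _ E E (v'.comp q.2))) q.2 := by
    have h5 : HasFDerivAt (fun γ : C(Icc (0 : ℝ) 1, E) => γ - constantCurve E q.1.1)
      (1 : C(Icc (0 : ℝ) 1, E) →L[ℝ] C(Icc (0 : ℝ) 1, E)) q.2 := (hasFDerivAt_id q.2).sub_const _
    refine h5.sub ?_
    have h6 : HasFDerivAt (fun γ : C(Icc (0 : ℝ) 1, E) => primitive E (v.comp γ))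
        (primitive E ∘L pointwiseApply _ E E (v'.comp q.2)) q.2 :=
      (primitive E).hasFDerivAt.comp q.2 (hasFDerivAt_superposition v v' hv' q.2)
    exact h6.const_smul q.1.2
  exact h3.unique h4

theorem isInvertible_one_sub_of_norm_lt {X : Type} [NormedAddCommGroup X] [NormedSpace ℝ X]
    [CompleteSpace X] (A : X →L[ℝ] X) (hA : ‖A‖ < 1) : (1 - A).IsInvertible :=
  ⟨ContinuousLinearEquiv.ofUnit (Units.oneSub A hA), rfl⟩

/-- For short times the partial derivative in the curve is the identity minus an operator of norm
less than `1`, inverted by a Neumann series. This is the hypothesis of the implicit function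
theorem. -/
theorem isInvertible_fderiv_picardDefect [CompleteSpace E] (v : C(E, E)) (hv : ContDiff ℝ ∞ v)
    {L : NNReal} (hL : LipschitzWith L v) (q : (E × ℝ) × C(Icc (0 : ℝ) 1, E))
    (hq : |q.1.2| * L < 1) :
    (fderiv ℝ (picardDefect v) q ∘L .inr ℝ (E × ℝ) C(Icc (0 : ℝ) 1, E)).IsInvertible := by
  let v' : C(E, E →L[ℝ] E) := ⟨fderiv ℝ v, (hv.continuous_fderiv (by simp))⟩
  rw [fderiv_picardDefect_inr v hv q v' fun x => (hv.differentiable (by simp) x).hasFDerivAt]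
  apply isInvertible_one_sub_of_norm_lt
  refine lt_of_le_of_lt (ContinuousLinearMap.opNorm_le_bound _ (by positivity) fun γ => ?_) hq
  rw [smul_apply, norm_smul, mul_assoc, Real.norm_eq_abs]
  gcongr
  refine (norm_primitive_le _).trans ?_
  rw [ContinuousMap.norm_le _ (by positivity)]
  intro s
  exact (v' (q.2 s)).le_of_opNorm_le_of_le (norm_fderiv_le_of_lipschitz ℝ hL)
    (γ.norm_coe_le_norm s)

/-- The Picard map is a contraction for short times. This identifies the implicit function with the
actual flow lines. -/
theorem picardDefect_zero_unique (v : C(E, E)) {L : NNReal} (hL : LipschitzWith L v) (y : E × ℝ)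
    (hy : |y.2| * L < 1) {γ η : C(Icc (0 : ℝ) 1, E)} (hγ : picardDefect v (y, γ) = 0)
    (hη : picardDefect v (y, η) = 0) : γ = η := by
  have h : γ - η = y.2 • primitive E (v.comp γ - v.comp η) := by
    have : picardDefect v (y, γ) - picardDefect v (y, η) = 0 := by rw [hγ, hη, sub_zero]
    simp only [picardDefect] at this
    rw [map_sub, smul_sub]
    rw [← sub_eq_zero, ← this]
    abel
  have h1 : ‖v.comp γ - v.comp η‖ ≤ L * ‖γ - η‖ := by
    rw [ContinuousMap.norm_le _ (by positivity)]
    intro s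
    refine (hL.norm_sub_le (γ s) (η s)).trans ?_
    gcongr
    exact (γ - η).norm_coe_le_norm s
  have h2 : ‖γ - η‖ ≤ |y.2| * (L * ‖γ - η‖) := by
    conv_lhs => rw [h]
    rw [norm_smul, Real.norm_eq_abs]
    gcongr
    exact (norm_primitive_le _).trans h1
  rw [← sub_eq_zero, ← norm_eq_zero]
  nlinarith [norm_nonneg (γ - η)]

section GlobalFlow

variable {v : E → E}

/-- A curve of speed at most `C` stays in the unit ball about its start for time `1 / (C + 1)`. This
existence time is the same for all starting points, so local solutions extend to all times. -/
theorem exists_integralCurve_of_bounded [CompleteSpace E] (hv : ContDiff ℝ ∞ v) {L : NNReal}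
    (hL : LipschitzWith L v) {C : ℝ} (hC : ∀ x, ‖v x‖ ≤ C) (x : E) :
    ∃ γ : ℝ → E, γ 0 = x ∧ ∀ t, HasDerivAt γ (v (γ t)) t := by
  have hC0 : 0 ≤ C := (norm_nonneg _).trans (hC x)
  have hε : (0 : ℝ) < 1 / (C + 1) := by positivity
  obtain ⟨γ, h0, hγ⟩ := exists_isMIntegralCurve_of_isMIntegralCurveOn (M := E)
    (I := modelWithCornersSelf ℝ E) (v := v)
    (contMDiffOn_univ.1 (contMDiffOn_vectorSpace_iff_contDiffOn.2
      (contDiffOn_univ.2 (hv.of_le (by simp))))) hε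
    (fun y => by
      have hm : (0 : ℝ) ∈ Icc (-(1 / (C + 1))) (1 / (C + 1)) := ⟨by linarith, hε.le⟩
      have hp : IsPicardLindelof (fun _ => v) ⟨0, hm⟩ y 1 0 ⟨C, hC0⟩ L :=
        IsPicardLindelof.of_time_independent (fun x _ => hC x) hL.lipschitzOnWith (by
          simp only [sub_zero, zero_sub, neg_neg, max_self, NNReal.coe_one,
            NNReal.coe_zero]
          rw [mul_one_div, div_le_one (by positivity)]
          change C ≤ C + 1
          linarith)
      obtain ⟨γ, h0, hγ⟩ := hp.exists_eq_forall_mem_Icc_hasDerivWithinAt₀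
      refine ⟨γ, h0, fun t ht => ?_⟩
      have hd : HasFDerivWithinAt γ ((1 : ℝ →L[ℝ] ℝ).smulRight (v (γ t)) : ℝ →L[ℝ] E)
          (Ioo (-(1 / (C + 1))) (1 / (C + 1))) t := by
        have hs : ((1 : ℝ →L[ℝ] ℝ).smulRight (v (γ t)) : ℝ →L[ℝ] E) =
            ContinuousLinearMap.toSpanSingleton ℝ (v (γ t)) := by ext; simp
        rw [hs]
        exact ((hγ t (Ioo_subset_Icc_self ht)).mono Ioo_subset_Icc_self).hasFDerivWithinAt
      exact hd.hasMFDerivWithinAt) x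
  refine ⟨γ, h0, fun t => ?_⟩
  have hd : HasFDerivAt γ ((1 : ℝ →L[ℝ] ℝ).smulRight (v (γ t)) : ℝ →L[ℝ] E) t :=
    (hγ t).hasFDerivAt
  simpa using hd.hasDerivAt

theorem integralCurve_unique {L : NNReal} (hL : LipschitzWith L v) {γ η : ℝ → E}
    (hγ : ∀ t, HasDerivAt γ (v (γ t)) t) (hη : ∀ t, HasDerivAt η (v (η t)) t) (h0 : γ 0 = η 0) :
    γ = η :=
  ODE_solution_unique_univ (v := fun _ => v) (s := fun _ => univ) (t₀ := 0)
    (fun _ => hL.lipschitzOnWith) (fun t => ⟨hγ t, mem_univ _⟩) (fun t => ⟨hη t, mem_univ _⟩) h0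

theorem flow_add {L : NNReal} (hL : LipschitzWith L v) {φ : ℝ → E → E} (h0 : ∀ z, φ 0 z = z)
    (hφ : ∀ z t, HasDerivAt (fun s => φ s z) (v (φ t z)) t) (s t : ℝ) (z : E) :
    φ (s + t) z = φ s (φ t z) := by
  refine congrFun (integralCurve_unique hL (γ := fun s => φ (s + t) z)
    (η := fun s => φ s (φ t z)) (fun s => ?_) (fun s => hφ _ s) (by simp [h0])) s
  simpa using (hφ z (s + t)).comp_add_const s t

/-- Flow lines reparametrised to `[0, 1]` are the zeros of `picardDefect`, with time as a mere
parameter. Hence they coincide with its smooth implicit function, and evaluation at `1` gives the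
flow. -/
theorem contDiffAt_flow_short [CompleteSpace E] (hv : ContDiff ℝ ∞ v) {L : NNReal} (hL : LipschitzWith L v)
    {φ : ℝ → E → E} (h0 : ∀ z, φ 0 z = z)
    (hφ : ∀ z t, HasDerivAt (fun s => φ s z) (v (φ t z)) t) (y : E × ℝ) (hy : |y.2| * L < 1) :
    ContDiffAt ℝ ∞ (fun y : E × ℝ => φ y.2 y.1) y := by
  have hcont : ∀ z, Continuous fun s => φ s z :=
    fun z => continuous_iff_continuousAt.2 fun t => (hφ z t).continuousAt
  let w : C(E, E) := ⟨v, hv.continuous⟩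
  let S : E × ℝ → C(Icc (0 : ℝ) 1, E) := fun y =>
    ⟨fun s => φ (y.2 * s) y.1, (hcont y.1).comp (by fun_prop)⟩
  have hS : ∀ y, picardDefect w (y, S y) = 0 := by
    intro y
    ext s
    have hd : ∀ r ∈ uIcc (0 : ℝ) s, HasDerivAt (fun r => φ (y.2 * r) y.1)
        (y.2 • v (φ (y.2 * r) y.1)) r := by
      intro r _
      have := (hφ y.1 (y.2 * r)).scomp r ((hasDerivAt_id r).const_mul y.2)
      simpa [Function.comp_def] using this
    have hi := intervalIntegral.integral_eq_sub_of_hasDerivAt hd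
      (((hv.continuous.comp ((hcont y.1).comp (by fun_prop))).const_smul y.2).intervalIntegrable
        _ _)
    have he : ∫ r in (0 : ℝ)..s, IccExtend zero_le_one (w.comp (S y)) r =
        ∫ r in (0 : ℝ)..s, v (φ (y.2 * r) y.1) := by
      refine intervalIntegral.integral_congr fun r hr => ?_
      rw [uIcc_of_le s.2.1] at hr
      simp only [IccExtend_of_mem zero_le_one _ ⟨hr.1, hr.2.trans s.2.2⟩]
      rfl
    have hs : picardDefect w (y, S y) s =
        φ (y.2 * s) y.1 - y.1 - y.2 • ∫ r in (0 : ℝ)..s, IccExtend zero_le_one (w.comp (S y)) r :=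
      rfl
    rw [hs, he, ← intervalIntegral.integral_smul, hi]
    simp [h0]
  have hc : ContDiffAt ℝ ∞ (picardDefect w) (y, S y) := (contDiff_picardDefect w hv).contDiffAt
  have hinv := isInvertible_fderiv_picardDefect w hv hL (y, S y) hy
  have hev := hc.eventually_apply_implicitFunction (by simp) hinv
  have hsm := hc.contDiffAt_implicitFunction (by simp) hinv
  have hsmall : ∀ᶠ x : E × ℝ in 𝓝 y, |x.2| * L < 1 :=
    (by fun_prop : Continuous fun x : E × ℝ => |x.2| * L).continuousAt.eventually_lt
      continuousAt_const hy
  have heq : S =ᶠ[𝓝 y] hc.implicitFunction (by simp) hinv := by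
    filter_upwards [hev, hsmall] with x hx hx'
    rw [hS] at hx
    exact picardDefect_zero_unique w hL x hx' (hS x) hx
  have hfin : ContDiffAt ℝ ∞ S y := hsm.congr_of_eventuallyEq heq
  have := (ContinuousMap.evalCLM ℝ (⟨1, by simp⟩ : Icc (0 : ℝ) 1)).contDiff.contDiffAt.comp y hfin
  refine this.congr_of_eventuallyEq (Eventually.of_forall fun x => ?_)
  simp [S]

theorem contDiff_flow [CompleteSpace E] (hv : ContDiff ℝ ∞ v) {L : NNReal} (hL : LipschitzWith L v)
    {φ : ℝ → E → E} (h0 : ∀ z, φ 0 z = z)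
    (hφ : ∀ z t, HasDerivAt (fun s => φ s z) (v (φ t z)) t) :
    ContDiff ℝ ∞ (fun y : ℝ × E => φ y.1 y.2) := by
  suffices h : ContDiff ℝ ∞ (fun y : E × ℝ => φ y.2 y.1) from
    h.comp (contDiff_snd.prodMk contDiff_fst)
  rw [contDiff_iff_contDiffAt]
  intro y
  -- The time is cut into `N` steps short enough for the previous lemma, and the smooth short-time
  -- flows are composed.
  obtain ⟨N, hN⟩ := exists_nat_gt (|y.2| * L)
  have hN0 : (0 : ℝ) < N := lt_of_le_of_lt (by positivity) hN
  have hsmall : |y.2 / N| * L < 1 := by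
    rw [abs_div, Nat.abs_cast, div_mul_eq_mul_div, div_lt_one hN0]
    exact hN
  have key : ∀ k : ℕ, ContDiffAt ℝ ∞ (fun y : E × ℝ => φ (k * (y.2 / N)) y.1) y := by
    intro k
    induction k with
    | zero => simpa [h0] using contDiffAt_fst
    | succ k ih =>
      have he : (fun y : E × ℝ => φ ((k + 1 : ℕ) * (y.2 / N)) y.1) =
          (fun y : E × ℝ => φ y.2 y.1) ∘ fun y : E × ℝ => (φ (k * (y.2 / N)) y.1, y.2 / N) := by
        funext x
        simp only [Function.comp]
        rw [← flow_add hL h0 hφ]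
        push_cast
        ring_nf
      rw [he]
      exact ContDiffAt.comp y (contDiffAt_flow_short hv hL h0 hφ _ hsmall)
        (ih.prodMk (contDiffAt_snd.div_const _))
  have := key N
  simpa only [mul_div_cancel₀ _ hN0.ne'] using this

/-- A smooth compactly supported vector field has a smooth complete flow. -/
theorem exists_contDiff_flow [CompleteSpace E] (hv : ContDiff ℝ ∞ v) (hc : HasCompactSupport v) :
    ∃ φ : ℝ → E → E, ContDiff ℝ ∞ (fun y : ℝ × E => φ y.1 y.2) ∧ (∀ z, φ 0 z = z) ∧
      ∀ z t, HasDerivAt (fun s => φ s z) (v (φ t z)) t := by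
  obtain ⟨L, hL⟩ := hv.lipschitzWith_of_hasCompactSupport hc (by simp)
  obtain ⟨C, hC⟩ := hc.exists_bound_of_continuous hv.continuous
  choose φ h0 hφ using exists_integralCurve_of_bounded hv hL hC
  exact ⟨fun t z => φ z t, contDiff_flow hv hL h0 hφ, h0, hφ⟩

end GlobalFlow

end SmoothFlow

/-! ### Orbit segments of possibly incomplete vector fields -/

namespace SmoothFlow

/-- Writing `s = r * t` with `r ∈ [0, 1]` replaces the varying time interval by a fixed compact one,
to which the tube lemma applies. -/
theorem eventually_forall_uIcc {E : Type} [TopologicalSpace E] {t : ℝ} {z : E}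
    {φ : ℝ → E → E} (hφ : Continuous fun y : ℝ × E => φ y.1 y.2)
    {U : Set E} (hU : IsOpen U) (h : ∀ s ∈ uIcc 0 t, φ s z ∈ U) :
    ∀ᶠ y : ℝ × E in 𝓝 (t, z), ∀ s ∈ uIcc 0 y.1, φ s y.2 ∈ U := by
  have h1 : ∀ r ∈ Icc (0 : ℝ) 1, ∀ᶠ q : (ℝ × E) × ℝ in 𝓝 ((t, z), r),
      φ (q.2 * q.1.1) q.1.2 ∈ U := by
    intro r hr
    have hc : Continuous fun q : (ℝ × E) × ℝ => φ (q.2 * q.1.1) q.1.2 :=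
      hφ.comp (f := fun q : (ℝ × E) × ℝ => (q.2 * q.1.1, q.1.2)) (by fun_prop)
    refine hc.continuousAt.eventually_mem (hU.mem_nhds (h _ ?_))
    simp only [mem_uIcc]
    rcases le_total 0 t with ht | ht
    · left; constructor <;> nlinarith [hr.1, hr.2]
    · right; constructor <;> nlinarith [hr.1, hr.2]
  have h2 := (isCompact_Icc (a := (0 : ℝ)) (b := 1)).eventually_forall_of_forall_eventually
    (P := fun (y : ℝ × E) r => φ (r * y.1) y.2 ∈ U) h1
  filter_upwards [h2] with y hy s hs
  obtain ⟨r, hr, rfl⟩ : ∃ r ∈ Icc (0 : ℝ) 1, r * y.1 = s := by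
    rcases eq_or_ne y.1 0 with h0 | h0
    · rw [h0, uIcc_self, mem_singleton_iff] at hs
      exact ⟨0, by simp, by simp [hs]⟩
    · refine ⟨s / y.1, ?_, div_mul_cancel₀ _ h0⟩
      rw [mem_uIcc] at hs
      rcases hs with hs | hs
      · exact ⟨div_nonneg hs.1 (hs.1.trans hs.2), div_le_one_of_le₀ hs.2 (hs.1.trans hs.2)⟩
      · refine ⟨div_nonneg_of_nonpos hs.2 (hs.1.trans hs.2), ?_⟩
        rw [div_le_one_of_neg (lt_of_le_of_ne (hs.1.trans hs.2) h0)]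
        exact hs.1
  exact hy r hr

variable {E : Type} [NormedAddCommGroup E] [NormedSpace ℝ E] {v : E → E}

theorem eqOn_flow_of_integralCurve {L : NNReal} (hL : LipschitzWith L v) {φ : ℝ → E → E}
    (h0 : ∀ z, φ 0 z = z) (hφ : ∀ z t, HasDerivAt (fun s => φ s z) (v (φ t z)) t) {c : ℝ → E}
    {t : ℝ} (hc : ∀ s ∈ uIcc 0 t, HasDerivWithinAt c (v (c s)) (uIcc 0 t) s) :
    ∀ s ∈ uIcc 0 t, c s = φ s (c 0) := by
  have hcont : Continuous fun s => φ s (c 0) :=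
    continuous_iff_continuousAt.2 fun s => (hφ (c 0) s).continuousAt
  have hcc : ContinuousOn c (uIcc 0 t) := fun s hs => (hc s hs).continuousWithinAt
  rcases le_total 0 t with h | h
  · rw [uIcc_of_le h] at hc hcc ⊢
    exact ODE_solution_unique (v := fun _ => v) (fun _ => hL) hcc
      (fun s hs => (hc s (Ico_subset_Icc_self hs)).mono_of_mem_nhdsWithin
        (Icc_mem_nhdsGE_of_mem hs))
      hcont.continuousOn (fun s _ => (hφ (c 0) s).hasDerivWithinAt) (h0 _).symm
  · rw [uIcc_of_ge h] at hc hcc ⊢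
    exact ODE_solution_unique_of_mem_Icc_left (v := fun _ => v) (s := fun _ => univ)
      (fun _ _ => hL.lipschitzOnWith) hcc
      (fun s hs => (hc s (Ioc_subset_Icc_self hs)).mono_of_mem_nhdsWithin
        (Icc_mem_nhdsLE_of_mem hs)) (fun _ _ => mem_univ _)
      hcont.continuousOn (fun s _ => (hφ (c 0) s).hasDerivWithinAt) (fun _ _ => mem_univ _)
      (h0 _).symm

/-- A smooth complete flow which agrees with the flow of `v` inside a large ball. -/
theorem exists_flow_in_ball [FiniteDimensional ℝ E] (hv : ContDiff ℝ ∞ v) (R : ℝ) :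
    ∃ φ : ℝ → E → E, ContDiff ℝ ∞ (fun y : ℝ × E => φ y.1 y.2) ∧ (∀ z, φ 0 z = z) ∧
      (∀ s t z, φ (s + t) z = φ s (φ t z)) ∧
      (∀ z t, φ t z ∈ Metric.ball 0 R → HasDerivAt (fun s => φ s z) (v (φ t z)) t) ∧
      ∀ (c : ℝ → E) (t : ℝ), (∀ s ∈ uIcc 0 t, c s ∈ Metric.ball 0 R ∧
        HasDerivWithinAt c (v (c s)) (uIcc 0 t) s) → ∀ s ∈ uIcc 0 t, c s = φ s (c 0) := by
  have : CompleteSpace E := FiniteDimensional.complete ℝ E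
  let χ : ContDiffBump (0 : E) := ⟨|R| + 1, |R| + 2, by positivity, by linarith⟩
  let w : E → E := fun x => χ x • v x
  have hw : ContDiff ℝ ∞ w := χ.contDiff.smul hv
  have hwc : HasCompactSupport w := χ.hasCompactSupport.smul_right
  have hwv : ∀ x ∈ Metric.ball 0 R, w x = v x := by
    intro x hx
    have : χ x = 1 := χ.one_of_mem_closedBall (by
      rw [Metric.mem_closedBall]
      rw [Metric.mem_ball] at hx
      change dist x 0 ≤ |R| + 1
      linarith [le_abs_self R])
    simp [w, this]
  obtain ⟨L, hL⟩ := hw.lipschitzWith_of_hasCompactSupport hwc (by simp)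
  obtain ⟨φ, hs, h0, hφ⟩ := exists_contDiff_flow hw hwc
  refine ⟨φ, hs, h0, flow_add hL h0 hφ, fun z t h => by rw [← hwv _ h]; exact hφ z t,
    fun c t hc => ?_⟩
  refine eqOn_flow_of_integralCurve hL h0 hφ fun s hs => ?_
  rw [hwv _ (hc s hs).1]
  exact (hc s hs).2

/-- `z'` is reached from `z` in time `t` along an integral curve of `v` which stays in `Ω`. -/
def FlowsTo (v : E → E) (Ω : Set E) (t : ℝ) (z z' : E) : Prop :=
  ∃ c : ℝ → E, c 0 = z ∧ c t = z' ∧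
    ∀ s ∈ uIcc 0 t, c s ∈ Ω ∧ HasDerivWithinAt c (v (c s)) (uIcc 0 t) s

variable {Ω : Set E} {s t : ℝ} {z z' z'' : E}

theorem FlowsTo.left_mem (h : FlowsTo v Ω t z z') : z ∈ Ω := by
  obtain ⟨c, rfl, -, hc⟩ := h
  exact (hc 0 left_mem_uIcc).1

theorem FlowsTo.right_mem (h : FlowsTo v Ω t z z') : z' ∈ Ω := by
  obtain ⟨c, -, rfl, hc⟩ := h
  exact (hc t right_mem_uIcc).1

theorem FlowsTo.refl (h : z ∈ Ω) : FlowsTo v Ω 0 z z :=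
  ⟨fun _ => z, rfl, rfl, fun s hs => ⟨h, by
    rw [uIcc_self] at hs ⊢
    rw [mem_singleton_iff.1 hs]
    exact HasFDerivWithinAt.of_subsingleton subsingleton_singleton⟩⟩

theorem FlowsTo.mono {Ω' : Set E} (h : FlowsTo v Ω t z z') (hΩ : Ω ⊆ Ω') :
    FlowsTo v Ω' t z z' := by
  obtain ⟨c, h0, ht, hc⟩ := h
  exact ⟨c, h0, ht, fun r hr => ⟨hΩ (hc r hr).1, (hc r hr).2⟩⟩

theorem FlowsTo.exists_radius (h : FlowsTo v Ω t z z') :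
    ∃ R : ℝ, ∀ R' ≥ R, FlowsTo v (Ω ∩ Metric.ball 0 R') t z z' := by
  obtain ⟨c, h0, ht, hc⟩ := h
  have hcc : ContinuousOn c (uIcc 0 t) := fun s hs => (hc s hs).2.continuousWithinAt
  obtain ⟨C, hC⟩ := isCompact_uIcc.exists_bound_of_continuousOn hcc
  refine ⟨C + 1, fun R' hR' => ⟨c, h0, ht, fun s hs => ⟨⟨(hc s hs).1, ?_⟩, (hc s hs).2⟩⟩⟩
  rw [mem_ball_zero_iff]
  linarith [hC s hs]

/-- Orbit segments in a ball are orbit segments of the complete flow. -/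
theorem flowsTo_ball_iff {R : ℝ} {φ : ℝ → E → E} (h0 : ∀ z, φ 0 z = z)
    (hφ : ∀ z t, φ t z ∈ Metric.ball 0 R → HasDerivAt (fun s => φ s z) (v (φ t z)) t)
    (hu : ∀ (c : ℝ → E) (t : ℝ), (∀ s ∈ uIcc 0 t, c s ∈ Metric.ball 0 R ∧
        HasDerivWithinAt c (v (c s)) (uIcc 0 t) s) → ∀ s ∈ uIcc 0 t, c s = φ s (c 0)) :
    FlowsTo v (Ω ∩ Metric.ball 0 R) t z z' ↔
      φ t z = z' ∧ ∀ s ∈ uIcc 0 t, φ s z ∈ Ω ∩ Metric.ball 0 R := by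
  constructor
  · rintro ⟨c, rfl, rfl, hc⟩
    have h := hu c t fun s hs => ⟨(hc s hs).1.2, (hc s hs).2⟩
    exact ⟨(h t right_mem_uIcc).symm, fun s hs => h s hs ▸ (hc s hs).1⟩
  · rintro ⟨rfl, h⟩
    exact ⟨fun s => φ s z, h0 z, rfl, fun s hs => ⟨h s hs, (hφ z s (h s hs).2).hasDerivWithinAt⟩⟩

variable [FiniteDimensional ℝ E]

/-- Both segments lie in a common ball, where they follow one complete cut-off flow; its group law
does the rest. The times may have opposite signs, so the composite may retrace part of the first
segment. -/
theorem FlowsTo.trans (hv : ContDiff ℝ ∞ v) (h : FlowsTo v Ω s z z') (h' : FlowsTo v Ω t z' z'') :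
    FlowsTo v Ω (s + t) z z'' := by
  obtain ⟨R₁, h₁⟩ := h.exists_radius
  obtain ⟨R₂, h₂⟩ := h'.exists_radius
  obtain ⟨φ, -, h0, hadd, hφ, hu⟩ := exists_flow_in_ball hv (max R₁ R₂)
  have k₁ := (flowsTo_ball_iff h0 hφ hu).1 (h₁ _ (le_max_left _ _))
  have k₂ := (flowsTo_ball_iff h0 hφ hu).1 (h₂ _ (le_max_right _ _))
  refine FlowsTo.mono ((flowsTo_ball_iff h0 hφ hu).2 ⟨?_, fun r hr => ?_⟩)
    (inter_subset_left (t := Metric.ball 0 (max R₁ R₂)))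
  · rw [add_comm, hadd, k₁.1, k₂.1]
  · have : r ∈ uIcc 0 s ∨ r - s ∈ uIcc 0 t := by
      simp only [mem_uIcc] at hr ⊢
      grind
    rcases this with hr | hr
    · exact k₁.2 r hr
    · have := k₂.2 _ hr
      rwa [← k₁.1, ← hadd, sub_add_cancel] at this

theorem FlowsTo.symm (hv : ContDiff ℝ ∞ v) (h : FlowsTo v Ω t z z') : FlowsTo v Ω (-t) z' z := by
  obtain ⟨R, h₁⟩ := h.exists_radius
  obtain ⟨φ, -, h0, hadd, hφ, hu⟩ := exists_flow_in_ball hv R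
  have k₁ := (flowsTo_ball_iff h0 hφ hu).1 (h₁ _ le_rfl)
  refine FlowsTo.mono ((flowsTo_ball_iff h0 hφ hu).2 ⟨?_, fun r hr => ?_⟩)
    (inter_subset_left (t := Metric.ball 0 R))
  · rw [← k₁.1, ← hadd, neg_add_cancel, h0]
  · rw [← k₁.1, ← hadd]
    refine k₁.2 _ ?_
    simp only [mem_uIcc] at hr ⊢
    grind

theorem FlowsTo.unique (hv : ContDiff ℝ ∞ v) (h : FlowsTo v Ω t z z') (h' : FlowsTo v Ω t z z'') :
    z' = z'' := by
  obtain ⟨R₁, h₁⟩ := h.exists_radius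
  obtain ⟨R₂, h₂⟩ := h'.exists_radius
  obtain ⟨φ, -, h0, hadd, hφ, hu⟩ := exists_flow_in_ball hv (max R₁ R₂)
  have k₁ := (flowsTo_ball_iff h0 hφ hu).1 (h₁ _ (le_max_left _ _))
  have k₂ := (flowsTo_ball_iff h0 hφ hu).1 (h₂ _ (le_max_right _ _))
  exact k₁.1.symm.trans k₂.1

/-- Near an orbit segment the flow is defined and smooth. -/
theorem FlowsTo.exists_contDiff (hv : ContDiff ℝ ∞ v) (hΩ : IsOpen Ω) (h : FlowsTo v Ω t z z') :
    ∃ φ : ℝ → E → E, ContDiff ℝ ∞ (fun y : ℝ × E => φ y.1 y.2) ∧ (∀ y, φ 0 y = y) ∧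
      (∀ r s y, φ (r + s) y = φ r (φ s y)) ∧
      ∀ᶠ y : ℝ × E in 𝓝 (t, z), FlowsTo v Ω y.1 y.2 (φ y.1 y.2) ∧
        HasDerivAt (fun s => φ s y.2) (v (φ y.1 y.2)) y.1 := by
  obtain ⟨R, h₁⟩ := h.exists_radius
  obtain ⟨φ, hs, h0, hadd, hφ, hu⟩ := exists_flow_in_ball hv R
  have k₁ := (flowsTo_ball_iff h0 hφ hu).1 (h₁ _ le_rfl)
  refine ⟨φ, hs, h0, hadd, ?_⟩
  filter_upwards [eventually_forall_uIcc hs.continuous (hΩ.inter Metric.isOpen_ball) k₁.2]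
    with y hy
  exact ⟨((flowsTo_ball_iff h0 hφ hu).2 ⟨rfl, hy⟩).mono inter_subset_left,
    hφ _ _ (hy _ right_mem_uIcc).2⟩

end SmoothFlow

/-! ### The geodesic field, and properness of the flow from convexity -/

namespace GeodesicFlow

open SmoothFlow

variable {n : ℕ} (g : MetricTensor n)

theorem contDiff_det_of_entries {m : ℕ} {X : Type} [NormedAddCommGroup X] [NormedSpace ℝ X]
    {A : X → Matrix (Fin m) (Fin m) ℝ} (hA : ∀ i j, ContDiff ℝ ∞ fun x => A x i j) :
    ContDiff ℝ ∞ fun x => (A x).det := by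
  simp only [Matrix.det_apply']
  exact ContDiff.sum fun σ _ => contDiff_const.mul (contDiff_prod fun i _ => hA _ _)

theorem MetricTensor.contDiff_inverse (i j : Fin n) :
    ContDiff ℝ ∞ fun x => (g.gram x)⁻¹ i j := by
  have h : (fun x => (g.gram x)⁻¹ i j) =
      fun x => ((g.gram x).det)⁻¹ * ((g.gram x).updateRow j (Pi.single i 1)).det := by
    funext x
    rw [Matrix.inv_def, Ring.inverse_eq_inv', Matrix.smul_apply, Matrix.adjugate_apply,
      smul_eq_mul]
  rw [h]
  refine ((contDiff_det_of_entries g.smooth).inv g.nondegenerate).mul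
    (contDiff_det_of_entries fun a b => ?_)
  simp only [Matrix.updateRow_apply]
  split_ifs
  · exact contDiff_const
  · exact g.smooth a b

theorem MetricTensor.contDiff_hamiltonian : ContDiff ℝ ∞ g.hamiltonian := by
  unfold MetricTensor.hamiltonian
  refine contDiff_const.mul (ContDiff.sum fun i _ => ContDiff.sum fun j _ => ?_)
  have h1 : ContDiff ℝ ∞ fun z : Phase n => z.2 i := by fun_prop
  have h2 : ContDiff ℝ ∞ fun z : Phase n => z.2 j := by fun_prop
  exact (((g.contDiff_inverse i j).comp contDiff_fst).mul h1).mul h2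

theorem MetricTensor.inverse_symm (x : Coord n) (i j : Fin n) :
    (g.gram x)⁻¹ i j = (g.gram x)⁻¹ j i := by
  have h : ((g.gram x)⁻¹).IsSymm := (g.symm x).inv
  exact h.apply j i

/-- The velocity `gⁱʲ(x) pⱼ`. -/
theorem MetricTensor.partialP_hamiltonian (z : Phase n) (i : Fin n) :
    partialP g.hamiltonian i z = ((g.gram z.1)⁻¹).mulVec z.2 i := by
  have h1 : HasDerivAt (fun s : ℝ => g.hamiltonian (z + s • (0, Pi.single i 1)))
      (partialP g.hamiltonian i z) 0 := by
    have hd : HasFDerivAt g.hamiltonian (fderiv ℝ g.hamiltonian z)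
        (z + (0 : ℝ) • ((0, Pi.single i 1) : Phase n)) := by
      rw [zero_smul, add_zero]
      exact (g.contDiff_hamiltonian.differentiable (by simp) z).hasFDerivAt
    have hl : HasDerivAt (fun s : ℝ => z + s • ((0, Pi.single i 1) : Phase n))
        (0, Pi.single i 1) 0 := by
      simpa using ((hasDerivAt_id (0 : ℝ)).smul_const ((0, Pi.single i 1) : Phase n)).const_add z
    exact hd.comp_hasDerivAt 0 hl
  have h2 : HasDerivAt (fun s : ℝ => g.hamiltonian (z + s • (0, Pi.single i 1)))
      ((1 / 2) * ∑ a, ∑ b, ((g.gram z.1)⁻¹ a b * (Pi.single i 1 : Coord n) a * z.2 b +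
        (g.gram z.1)⁻¹ a b * z.2 a * (Pi.single i 1 : Coord n) b)) 0 := by
    unfold MetricTensor.hamiltonian
    refine HasDerivAt.const_mul _ (HasDerivAt.fun_sum fun a _ => HasDerivAt.fun_sum fun b _ => ?_)
    have hc : ∀ a, HasDerivAt (fun s : ℝ => (z + s • ((0, Pi.single i 1) : Phase n)).2 a)
        ((Pi.single i 1 : Coord n) a) 0 := by
      intro a
      simpa using ((hasDerivAt_id (0 : ℝ)).mul_const ((Pi.single i 1 : Coord n) a)).const_add
        (z.2 a)
    simpa using ((hc a).const_mul ((g.gram z.1)⁻¹ a b)).fun_mul (hc b)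
  rw [h1.unique h2]
  simp only [Finset.sum_add_distrib, Pi.single_apply, mul_ite, mul_one, mul_zero, ite_mul,
    zero_mul, Finset.sum_ite_eq', Finset.mem_univ, if_true, Matrix.mulVec, dotProduct]
  rw [Finset.sum_comm]
  simp only [Finset.sum_ite_eq', Finset.mem_univ, if_true]
  rw [← Finset.sum_add_distrib, Finset.mul_sum]
  refine Finset.sum_congr rfl fun a _ => ?_
  rw [g.inverse_symm z.1 a i]
  ring

theorem MetricTensor.hamiltonian_smul (x p : Coord n) (c : ℝ) :
    g.hamiltonian (x, c • p) = c ^ 2 * g.hamiltonian (x, p) := by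
  simp only [MetricTensor.hamiltonian, Pi.smul_apply, smul_eq_mul, Finset.mul_sum]
  refine Finset.sum_congr rfl fun i _ => Finset.sum_congr rfl fun j _ => ?_
  ring

theorem MetricTensor.partialP_hamiltonian_smul (x p : Coord n) (c : ℝ) (i : Fin n) :
    partialP g.hamiltonian i (x, c • p) = c * partialP g.hamiltonian i (x, p) := by
  simp [g.partialP_hamiltonian, Matrix.mulVec_smul]

theorem MetricTensor.partialX_hamiltonian_smul (x p : Coord n) (c : ℝ) (i : Fin n) :
    partialX g.hamiltonian i (x, c • p) = c ^ 2 * partialX g.hamiltonian i (x, p) := by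
  have key : ∀ q : Coord n, HasFDerivAt (fun y => g.hamiltonian (y, q))
      ((fderiv ℝ g.hamiltonian (x, q)).comp (.inl ℝ (Coord n) (Coord n))) x := fun q =>
    HasFDerivAt.comp (g := g.hamiltonian) (f := fun y => (y, q)) x
      (g.contDiff_hamiltonian.differentiable (by simp) (x, q)).hasFDerivAt
      (hasFDerivAt_prodMk_left x q)
  have h1 := key (c • p)
  simp only [g.hamiltonian_smul] at h1
  have h2 := h1.unique ((key p).const_mul (c ^ 2))
  simpa [partialX] using congrArg (fun L => L (Pi.single i 1)) h2

theorem MetricTensor.velocity_injective {x p q : Coord n}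
    (h : ∀ i, partialP g.hamiltonian i (x, p) = partialP g.hamiltonian i (x, q)) : p = q := by
  simp only [g.partialP_hamiltonian] at h
  have hu : IsUnit ((g.gram x)⁻¹) := by
    rw [Matrix.isUnit_nonsing_inv_iff, Matrix.isUnit_iff_isUnit_det]
    exact isUnit_iff_ne_zero.2 (g.nondegenerate x)
  exact (Matrix.mulVec_injective_of_isUnit hu) (funext h)

theorem MetricTensor.exists_velocity_ne_zero {x p : Coord n} (hp : p ≠ 0) :
    ∃ i, partialP g.hamiltonian i (x, p) ≠ 0 := by
  by_contra! h
  refine hp (g.velocity_injective (x := x) fun i => ?_)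
  rw [h i, g.partialP_hamiltonian]
  simp

/-- The Hamiltonian vector field of `H`. -/
noncomputable def MetricTensor.field (z : Phase n) : Phase n :=
  (fun i => partialP g.hamiltonian i z, fun i => -partialX g.hamiltonian i z)

theorem MetricTensor.contDiff_field : ContDiff ℝ ∞ g.field := by
  have h : ContDiff ℝ ∞ (fderiv ℝ g.hamiltonian) := g.contDiff_hamiltonian.fderiv_right (by simp)
  unfold MetricTensor.field partialP partialX
  refine ContDiff.prodMk (contDiff_pi.2 fun i => ?_) (contDiff_pi.2 fun i => ?_)
  · exact h.clm_apply contDiff_const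
  · exact (h.clm_apply contDiff_const).neg

theorem clm_phase_apply (L : Phase n →L[ℝ] ℝ) (w : Phase n) :
    L w = ∑ i, (w.1 i * L (Pi.single i 1, 0) + w.2 i * L (0, Pi.single i 1)) := by
  have h : w = ∑ i, (w.1 i • ((Pi.single i 1, 0) : Phase n) +
      w.2 i • ((0, Pi.single i 1) : Phase n)) := by
    ext k <;> simp [Prod.fst_sum, Prod.snd_sum, Finset.sum_apply, Pi.single_apply]
  conv_lhs => rw [h]
  simp only [map_sum, map_add, map_smul, smul_eq_mul]

theorem MetricTensor.poissonBracket_hamiltonian (F : Phase n → ℝ) (z : Phase n) :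
    poissonBracket F g.hamiltonian z = -fderiv ℝ F z (g.field z) := by
  rw [clm_phase_apply, ← Finset.sum_neg_distrib]
  refine Finset.sum_congr rfl fun i _ => ?_
  simp only [MetricTensor.field, partialX, partialP]
  ring

variable {g} {D : Set (Coord n)}

theorem isOpen_cotangent (hD : IsOpen D) : IsOpen (cotangent D) := hD.prod isOpen_univ

theorem mem_cotangent {z : Phase n} : z ∈ cotangent D ↔ z.1 ∈ D := by simp [cotangent]

theorem hasDerivWithinAt_field_iff {c : ℝ → Phase n} {S : Set ℝ} {s : ℝ} {z : Phase n} :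
    HasDerivWithinAt c (g.field z) S s ↔ ∀ i,
      HasDerivWithinAt (fun s => (c s).1 i) (partialP g.hamiltonian i z) S s ∧
      HasDerivWithinAt (fun s => (c s).2 i) (-partialX g.hamiltonian i z) S s := by
  constructor
  · intro h i
    exact ⟨(hasDerivWithinAt_pi.1 h.fst) i, (hasDerivWithinAt_pi.1 h.snd) i⟩
  · intro h
    exact (hasDerivWithinAt_pi.2 fun i => (h i).1).prodMk (hasDerivWithinAt_pi.2 fun i => (h i).2)

/-- The Hamiltonian is quadratic in the momenta, so running a geodesic `l` times as fast multiplies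
its momentum by `l`. Zero and negative `l` are allowed. -/
theorem flowsTo_rescale {l τ : ℝ} {x p x' p' : Coord n}
    (h : FlowsTo g.field (cotangent D) (l * τ) (x, p) (x', p')) :
    FlowsTo g.field (cotangent D) τ (x, l • p) (x', l • p') := by
  obtain ⟨c, h0, h1, hc⟩ := h
  refine ⟨fun s => ((c (l * s)).1, l • (c (l * s)).2), by simp [h0], by simp [h1], ?_⟩
  have hm : MapsTo (fun s => l * s) (uIcc 0 τ) (uIcc 0 (l * τ)) := by
    intro s hs
    simp only [mem_uIcc] at hs ⊢
    rcases le_total 0 l with hl | hl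
    · rcases hs with hs | hs
      · left; constructor <;> nlinarith
      · right; constructor <;> nlinarith
    · rcases hs with hs | hs
      · right; constructor <;> nlinarith
      · left; constructor <;> nlinarith
  intro s hs
  refine ⟨mem_cotangent.2 (mem_cotangent.1 (hc _ (hm hs)).1), ?_⟩
  have hd : HasDerivWithinAt (fun s => c (l * s)) (l • g.field (c (l * s))) (uIcc 0 τ) s := by
    have := (hc _ (hm hs)).2.scomp s (((hasDerivAt_id s).const_mul l).hasDerivWithinAt) hm
    simpa [Function.comp_def] using this
  refine hasDerivWithinAt_field_iff.2 fun i => ?_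
  have h1 : HasDerivWithinAt (fun s => (c (l * s)).1 i) ((l • g.field (c (l * s))).1 i)
    (uIcc 0 τ) s := hasDerivWithinAt_pi.1 hd.fst i
  have h2 : HasDerivWithinAt (fun s => (c (l * s)).2 i) ((l • g.field (c (l * s))).2 i)
    (uIcc 0 τ) s := hasDerivWithinAt_pi.1 hd.snd i
  rw [g.partialP_hamiltonian_smul, g.partialX_hamiltonian_smul]
  refine ⟨h1, ?_⟩
  have h3 := h2.const_mul l
  have he : l * (l • g.field (c (l * s))).2 i =
      -(l ^ 2 * partialX g.hamiltonian i ((c (l * s)).1, (c (l * s)).2)) := by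
    change l * (l * -partialX _ _ _) = _
    ring
  rw [he] at h3
  exact h3

theorem MetricTensor.IsGeodesicSegment.exists_flowsTo {γ : ℝ → Coord n}
    (h : g.IsGeodesicSegment D γ) :
    ∃ p : ℝ → Coord n, FlowsTo g.field (cotangent D) 1 (γ 0, p 0) (γ 1, p 1) ∧
      HasDerivWithinAt γ (fun i => partialP g.hamiltonian i (γ 0, p 0)) (Icc 0 1) 0 := by
  obtain ⟨hD, p, hp⟩ := h
  have key : ∀ s ∈ Icc (0 : ℝ) 1, HasDerivWithinAt (fun s => (γ s, p s)) (g.field (γ s, p s))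
    (Icc 0 1) s := fun s hs => hasDerivWithinAt_field_iff.2 (hp s hs)
  refine ⟨p, ⟨fun s => (γ s, p s), rfl, rfl, ?_⟩, (key 0 (by simp)).fst⟩
  rw [uIcc_of_le zero_le_one]
  exact fun s hs => ⟨mem_cotangent.2 (hD s hs), key s hs⟩

theorem exists_geodesicSegment_of_flowsTo {x p x' p' : Coord n}
    (h : FlowsTo g.field (cotangent D) 1 (x, p) (x', p')) :
    ∃ γ : ℝ → Coord n, g.IsGeodesicSegment D γ ∧ γ 0 = x ∧ γ 1 = x' ∧
      HasDerivWithinAt γ (fun i => partialP g.hamiltonian i (x, p)) (Icc 0 1) 0 := by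
  obtain ⟨c, h0, h1, hc⟩ := h
  rw [uIcc_of_le zero_le_one] at hc
  refine ⟨fun s => (c s).1, ⟨fun s hs => mem_cotangent.1 (hc s hs).1, fun s => (c s).2,
    fun s hs => hasDerivWithinAt_field_iff.1 (hc s hs).2⟩, by simp [h0], by simp [h1], ?_⟩
  have := (hc 0 (by simp)).2.fst
  rwa [h0] at this

/-- The data provided by geodesic convexity, in terms of orbit segments. -/
theorem MetricTensor.IsGeodesicallyConvex.exists_velocity (h : g.IsGeodesicallyConvex D) :
    ∃ V : Coord n → Coord n → Coord n,
      ContinuousOn (fun q : Coord n × Coord n => V q.1 q.2) (D ×ˢ D) ∧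
      (∀ t z z', FlowsTo g.field (cotangent D) t z z' →
        V z.1 z'.1 = t • fun i => partialP g.hamiltonian i z) ∧
      ∀ x ∈ D, ∀ y ∈ D, ∃ p p', FlowsTo g.field (cotangent D) 1 (x, p) (y, p') ∧
        V x y = fun i => partialP g.hamiltonian i (x, p) := by
  obtain ⟨V, hV, h⟩ := h
  have hu : UniqueDiffWithinAt ℝ (Icc (0 : ℝ) 1) 0 :=
    uniqueDiffOn_Icc zero_lt_one 0 (by simp)
  refine ⟨V, hV, ?_, ?_⟩
  · rintro t ⟨x, p⟩ ⟨x', p'⟩ hf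
    obtain ⟨γ, -, h0, h1, hd, huniq⟩ :=
      h x (mem_cotangent.1 hf.left_mem) x' (mem_cotangent.1 hf.right_mem)
    -- Rescaled to unit time, the orbit projects to a geodesic segment with initial velocity `t`
    -- times the given one. By uniqueness this is the segment that defines `V`.
    rw [← mul_one t] at hf
    obtain ⟨γ', hγ', h0', h1', hd'⟩ := exists_geodesicSegment_of_flowsTo (flowsTo_rescale hf)
    have he := huniq γ' hγ' h0' h1'
    have := hu.eq_deriv _ hd (hd'.congr he.symm (he (by simp)).symm)
    rw [this]
    funext i
    simp [g.partialP_hamiltonian_smul]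
  · intro x hx y hy
    obtain ⟨γ, hγ, h0, h1, hd, -⟩ := h x hx y hy
    obtain ⟨p, hf, hd'⟩ := hγ.exists_flowsTo
    rw [h0, h1] at hf
    rw [h0] at hd'
    exact ⟨p 0, p 1, hf, hu.eq_deriv _ hd hd'⟩

/-- The geodesic flow on the complement of the zero section of a geodesically convex domain is
proper. -/
theorem MetricTensor.IsGeodesicallyConvex.tendsto_time (h : g.IsGeodesicallyConvex D)
    (hD : IsOpen D) {ι : Type*} {l : Filter ι} [NeBot l] {t : ι → ℝ} {z w : ι → Phase n}
    {z₀ w₀ : Phase n} (hz : Tendsto z l (𝓝 z₀)) (hw : Tendsto w l (𝓝 w₀))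
    (hf : ∀ᶠ k in l, FlowsTo g.field (cotangent D) (t k) (z k) (w k))
    (hz₀ : z₀ ∈ cotangent D) (hw₀ : w₀ ∈ cotangent D) (hp : z₀.2 ≠ 0) :
    ∃ t₀, Tendsto t l (𝓝 t₀) ∧ FlowsTo g.field (cotangent D) t₀ z₀ w₀ := by
  obtain ⟨V, hV, hV1, hV2⟩ := h.exists_velocity
  obtain ⟨x, p⟩ := z₀
  obtain ⟨y, q⟩ := w₀
  rw [mem_cotangent] at hz₀ hw₀
  obtain ⟨i, hi⟩ := g.exists_velocity_ne_zero (x := x) hp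
  have hvel : ∀ j, Tendsto (fun k => partialP g.hamiltonian j (z k)) l
      (𝓝 (partialP g.hamiltonian j (x, p))) := fun j =>
    ((continuous_apply j).comp (continuous_fst.comp g.contDiff_field.continuous)).continuousAt.tendsto.comp
      hz
  have hVt : Tendsto (fun k => V (z k).1 (w k).1) l (𝓝 (V x y)) := by
    have hc : ContinuousAt (fun q : Coord n × Coord n => V q.1 q.2) (x, y) :=
      hV.continuousAt ((hD.prod hD).mem_nhds ⟨hz₀, hw₀⟩)
    exact hc.tendsto.comp ((hz.fst_nhds).prodMk_nhds (hw.fst_nhds))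
  -- The relation `V = t • velocity` is solved for `t` in a component where the limit velocity is
  -- nonzero.
  have ht : Tendsto t l (𝓝 (V x y i / partialP g.hamiltonian i (x, p))) := by
    refine (((tendsto_pi_nhds.1 hVt) i).div (hvel i) hi).congr' ?_
    filter_upwards [hf, (hvel i).eventually_ne hi] with k hk hk'
    simp only [Pi.div_apply]
    rw [hV1 _ _ _ hk, Pi.smul_apply, smul_eq_mul, mul_div_cancel_right₀ _ hk']
  set t₀ := V x y i / partialP g.hamiltonian i (x, p)
  refine ⟨t₀, ht, ?_⟩
  have hVe : V x y = t₀ • fun j => partialP g.hamiltonian j (x, p) := by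
    refine tendsto_nhds_unique hVt (Tendsto.congr' ?_ (ht.smul (tendsto_pi_nhds.2 hvel)))
    filter_upwards [hf] with k hk
    exact (hV1 _ _ _ hk).symm
  -- Convexity supplies a segment from `x` to `y`; its initial momentum is forced to be `t₀ • p`.
  -- Scaling by `t₀⁻¹` yields an orbit segment from `(x, p)` of duration `t₀`, and for `t₀ = 0` the
  -- constant one serves.
  obtain ⟨p₁, p₁', hf1, hp1⟩ := hV2 x hz₀ y hw₀
  have hpe : p₁ = t₀ • p := by
    refine g.velocity_injective (x := x) fun j => ?_
    rw [g.partialP_hamiltonian_smul]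
    have := congrFun (hp1.symm.trans hVe) j
    simpa using this
  obtain ⟨r, hr⟩ : ∃ r, FlowsTo g.field (cotangent D) t₀ (x, p) r := by
    rcases eq_or_ne t₀ 0 with h0 | h0
    · exact ⟨(x, p), h0 ▸ FlowsTo.refl (mem_cotangent.2 hz₀)⟩
    · rw [hpe, ← inv_mul_cancel₀ h0] at hf1
      have := flowsTo_rescale hf1
      rw [smul_smul, inv_mul_cancel₀ h0, one_smul] at this
      exact ⟨_, this⟩
  obtain ⟨φ, hφ, -, -, hev⟩ := hr.exists_contDiff g.contDiff_field (isOpen_cotangent hD)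
  have htz : Tendsto (fun k => (t k, z k)) l (𝓝 (t₀, (x, p))) := ht.prodMk_nhds hz
  have hlim : Tendsto (fun k => φ (t k) (z k)) l (𝓝 (φ t₀ (x, p))) :=
    (hφ.continuous.continuousAt (x := (t₀, (x, p)))).tendsto.comp htz
  have : (y, q) = φ t₀ (x, p) := by
    refine tendsto_nhds_unique hw (hlim.congr' ?_)
    filter_upwards [hf, htz.eventually hev] with k hk hk'
    exact hk'.1.unique g.contDiff_field hk
  rw [this]
  exact hev.self_of_nhds.1

/-- Orbits do not come back near a point off the zero section. -/
theorem MetricTensor.IsGeodesicallyConvex.eventually_abs_time_lt (h : g.IsGeodesicallyConvex D)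
    (hD : IsOpen D) {z₀ : Phase n} (hz₀ : z₀ ∈ cotangent D) (hp : z₀.2 ≠ 0) {ε : ℝ} (hε : 0 < ε) :
    ∀ᶠ q : Phase n × Phase n in 𝓝 (z₀, z₀), ∀ t, FlowsTo g.field (cotangent D) t q.1 q.2 →
      |t| < ε := by
  obtain ⟨V, hV, hV1, hV2⟩ := h.exists_velocity
  have hz₀' := mem_cotangent.1 hz₀
  obtain ⟨i, hi⟩ := g.exists_velocity_ne_zero (x := z₀.1) hp
  have hvel : Continuous fun z : Phase n => partialP g.hamiltonian i z :=
    (continuous_apply i).comp (continuous_fst.comp g.contDiff_field.continuous)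
  have hc : ContinuousAt (fun q : Coord n × Coord n => V q.1 q.2) (z₀.1, z₀.1) :=
    hV.continuousAt ((hD.prod hD).mem_nhds ⟨hz₀', hz₀'⟩)
  have hc1 : ContinuousAt (fun q : Phase n × Phase n => V q.1.1 q.2.1) (z₀, z₀) :=
    ContinuousAt.comp (f := fun q : Phase n × Phase n => (q.1.1, q.2.1))
      (x := (z₀, z₀)) hc (by fun_prop)
  have hc2 : ContinuousAt (fun q : Phase n × Phase n => partialP g.hamiltonian i q.1) (z₀, z₀) :=
    (hvel.comp continuous_fst).continuousAt
  have hc3 : ContinuousAt (fun q : Phase n × Phase n =>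
      |V q.1.1 q.2.1 i / partialP g.hamiltonian i q.1|) (z₀, z₀) :=
    (((continuous_apply i).continuousAt.comp hc1).div hc2 hi).abs
  -- The segment of duration zero shows that `V` vanishes on the diagonal, so nearby end points
  -- force short times.
  have h0 : V z₀.1 z₀.1 = 0 := by
    rw [hV1 0 z₀ z₀ (FlowsTo.refl hz₀), zero_smul]
  have hlt := hc3.eventually_lt (continuousAt_const (y := ε)) (by simpa [h0] using hε)
  filter_upwards [hlt, hc2.eventually_ne hi] with q hq hq' t ht
  rw [hV1 _ _ _ ht, Pi.smul_apply, smul_eq_mul, mul_div_cancel_right₀ _ hq'] at hq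
  exact hq

end GeodesicFlow

/-! ### Poisson brackets and first integrals -/

namespace GeodesicFlow

open SmoothFlow

variable {n : ℕ}

theorem two_le_infty : (2 : WithTop ℕ∞) ≤ ∞ := by
  have : ((2 : ℕ∞) : WithTop ℕ∞) ≤ ((⊤ : ℕ∞) : WithTop ℕ∞) := WithTop.coe_le_coe.2 le_top
  exact this

/-- The canonical Poisson structure on covectors. -/
noncomputable def poissonForm (n : ℕ) :
    (Phase n →L[ℝ] ℝ) →ₗ[ℝ] (Phase n →L[ℝ] ℝ) →ₗ[ℝ] ℝ :=
  LinearMap.mk₂ ℝ (fun L M => ∑ i, (M (Pi.single i 1, 0) * L (0, Pi.single i 1) -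
      L (Pi.single i 1, 0) * M (0, Pi.single i 1)))
    (fun L L' M => by
      rw [← Finset.sum_add_distrib]
      exact Finset.sum_congr rfl fun i _ => by simp only [add_apply]; ring)
    (fun c L M => by
      rw [smul_eq_mul, Finset.mul_sum]
      exact Finset.sum_congr rfl fun i _ => by simp only [smul_apply, smul_eq_mul]; ring)
    (fun L M M' => by
      rw [← Finset.sum_add_distrib]
      exact Finset.sum_congr rfl fun i _ => by simp only [add_apply]; ring)
    (fun c L M => by
      rw [smul_eq_mul, Finset.mul_sum]
      exact Finset.sum_congr rfl fun i _ => by simp only [smul_apply, smul_eq_mul]; ring)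

theorem poissonForm_apply (L M : Phase n →L[ℝ] ℝ) :
    poissonForm n L M = ∑ i, (M (Pi.single i 1, 0) * L (0, Pi.single i 1) -
      L (Pi.single i 1, 0) * M (0, Pi.single i 1)) := rfl

theorem poissonBracket_eq_poissonForm (F G : Phase n → ℝ) (z : Phase n) :
    poissonBracket F G z = poissonForm n (fderiv ℝ F z) (fderiv ℝ G z) := rfl

theorem poissonForm_neg_swap (L M : Phase n →L[ℝ] ℝ) :
    poissonForm n L M = -poissonForm n M L := by
  rw [poissonForm_apply, poissonForm_apply, ← Finset.sum_neg_distrib]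
  exact Finset.sum_congr rfl fun i _ => by ring

theorem poissonForm_self (L : Phase n →L[ℝ] ℝ) : poissonForm n L L = 0 := by
  have := poissonForm_neg_swap L L
  linarith

theorem sum_sum_eq_zero_of_antisymm {ι : Type*} [Fintype ι] {T : ι → ι → ℝ}
    (hT : ∀ i k, T i k = -T k i) : ∑ i, ∑ k, T i k = 0 := by
  have : ∑ i, ∑ k, T i k = -∑ i, ∑ k, T i k := by
    conv_lhs => rw [Finset.sum_comm]
    rw [← Finset.sum_neg_distrib]
    exact Finset.sum_congr rfl fun i _ => by
      rw [← Finset.sum_neg_distrib]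
      exact Finset.sum_congr rfl fun k _ => hT k i
  linarith

variable {g : MetricTensor n}

theorem fderiv_field_apply (z w : Phase n) :
    fderiv ℝ g.field z w =
      (fun k => fderiv ℝ (fderiv ℝ g.hamiltonian) z w (0, Pi.single k 1),
        fun k => -fderiv ℝ (fderiv ℝ g.hamiltonian) z w (Pi.single k 1, 0)) := by
  have hH : ContDiff ℝ ∞ (fderiv ℝ g.hamiltonian) := g.contDiff_hamiltonian.fderiv_right (by simp)
  have hd : HasFDerivAt (fderiv ℝ g.hamiltonian) (fderiv ℝ (fderiv ℝ g.hamiltonian) z) z :=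
    (hH.differentiable (by simp) z).hasFDerivAt
  have hX : HasFDerivAt g.field (fderiv ℝ g.field z) z :=
    (g.contDiff_field.differentiable (by simp) z).hasFDerivAt
  have happ : ∀ a : Phase n, HasFDerivAt (fun z => fderiv ℝ g.hamiltonian z a)
      ((ContinuousLinearMap.apply ℝ ℝ a).comp (fderiv ℝ (fderiv ℝ g.hamiltonian) z)) z :=
    fun a => (ContinuousLinearMap.apply ℝ ℝ a).hasFDerivAt.comp z hd
  refine Prod.ext (funext fun k => ?_) (funext fun k => ?_)
  · have h1 : HasFDerivAt (fun z => (g.field z).1 k) _ z :=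
      ((ContinuousLinearMap.proj (R := ℝ) (φ := fun _ : Fin n => ℝ) k).comp
        (.fst ℝ (Coord n) (Coord n))).hasFDerivAt.comp z hX
    exact congrArg (fun L => L w) (h1.unique (happ (0, Pi.single k 1)))
  · have h1 : HasFDerivAt (fun z => (g.field z).2 k) _ z :=
      ((ContinuousLinearMap.proj (R := ℝ) (φ := fun _ : Fin n => ℝ) k).comp
        (.snd ℝ (Coord n) (Coord n))).hasFDerivAt.comp z hX
    exact congrArg (fun L => L w) (h1.unique (happ (Pi.single k 1, 0)).neg)

/-- Differentiating the equation of first integrals. -/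
theorem fderiv_fderiv_field_apply {F : Phase n → ℝ} {S : Set (Phase n)} (hS : IsOpen S)
    (hF : ContDiffOn ℝ ∞ F S) (hI : ∀ z ∈ S, fderiv ℝ F z (g.field z) = 0) {z : Phase n}
    (hz : z ∈ S) (w : Phase n) :
    fderiv ℝ (fderiv ℝ F) z (g.field z) w = -fderiv ℝ F z (fderiv ℝ g.field z w) := by
  have hFz : ContDiffAt ℝ ∞ F z := hF.contDiffAt (hS.mem_nhds hz)
  have hd : HasFDerivAt (fderiv ℝ F) (fderiv ℝ (fderiv ℝ F) z) z :=
    ((hFz.fderiv_right (m := ∞) (by simp)).differentiableAt (by simp)).hasFDerivAt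
  have hX : HasFDerivAt g.field (fderiv ℝ g.field z) z :=
    (g.contDiff_field.differentiable (by simp) z).hasFDerivAt
  have h1 := hd.clm_apply hX
  have h2 : HasFDerivAt (fun z => fderiv ℝ F z (g.field z)) (0 : Phase n →L[ℝ] ℝ) z := by
    refine (hasFDerivAt_const (0 : ℝ) z).congr_of_eventuallyEq ?_
    filter_upwards [hS.mem_nhds hz] with y hy using hI y hy
  have h3 := congrArg (fun L => L w) (h1.unique h2)
  have hsymm : fderiv ℝ (fderiv ℝ F) z (g.field z) w = fderiv ℝ (fderiv ℝ F) z w (g.field z) :=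
    (hFz.isSymmSndFDerivAt (by simpa using two_le_infty)).eq _ _
  rw [hsymm]
  simp only [add_apply, ContinuousLinearMap.comp_apply, ContinuousLinearMap.flip_apply, zero_apply]
    at h3
  linarith

theorem hasFDerivAt_poissonBracket {F G : Phase n → ℝ} {z : Phase n} (hF : ContDiffAt ℝ ∞ F z)
    (hG : ContDiffAt ℝ ∞ G z) : DifferentiableAt ℝ (poissonBracket F G) z ∧
    ∀ w, fderiv ℝ (poissonBracket F G) z w =
      poissonForm n (fderiv ℝ (fderiv ℝ F) z w) (fderiv ℝ G z) +
      poissonForm n (fderiv ℝ F z) (fderiv ℝ (fderiv ℝ G) z w) := by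
  have hdF : HasFDerivAt (fderiv ℝ F) (fderiv ℝ (fderiv ℝ F) z) z :=
    ((hF.fderiv_right (m := ∞) (by simp)).differentiableAt (by simp)).hasFDerivAt
  have hdG : HasFDerivAt (fderiv ℝ G) (fderiv ℝ (fderiv ℝ G) z) z :=
    ((hG.fderiv_right (m := ∞) (by simp)).differentiableAt (by simp)).hasFDerivAt
  have happ : ∀ {L : Phase n → Phase n →L[ℝ] ℝ} {L' : Phase n →L[ℝ] Phase n →L[ℝ] ℝ}
      (_ : HasFDerivAt L L' z) (a : Phase n), HasFDerivAt (fun z => L z a)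
      ((ContinuousLinearMap.apply ℝ ℝ a).comp L') z :=
    fun hL a => (ContinuousLinearMap.apply ℝ ℝ a).hasFDerivAt.comp z hL
  have h : HasFDerivAt (poissonBracket F G) _ z := HasFDerivAt.fun_sum fun i _ =>
    ((happ hdG (Pi.single i 1, 0)).mul (happ hdF (0, Pi.single i 1))).sub
      ((happ hdF (Pi.single i 1, 0)).mul (happ hdG (0, Pi.single i 1)))
  refine ⟨h.differentiableAt, fun w => ?_⟩
  rw [h.fderiv, poissonForm_apply, poissonForm_apply, ← Finset.sum_add_distrib, sum_apply]
  refine Finset.sum_congr rfl fun i _ => ?_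
  simp only [add_apply, sub_apply, smul_apply, smul_eq_mul, ContinuousLinearMap.comp_apply,
    ContinuousLinearMap.apply_apply, partialP]
  ring

/-- The Poisson bracket of two first integrals is a first integral. -/
theorem fderiv_poissonBracket_field {F G : Phase n → ℝ} {S : Set (Phase n)} (hS : IsOpen S)
    (hF : ContDiffOn ℝ ∞ F S) (hG : ContDiffOn ℝ ∞ G S)
    (hFI : ∀ z ∈ S, fderiv ℝ F z (g.field z) = 0) (hGI : ∀ z ∈ S, fderiv ℝ G z (g.field z) = 0)
    {z : Phase n} (hz : z ∈ S) : fderiv ℝ (poissonBracket F G) z (g.field z) = 0 := by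
  rw [(hasFDerivAt_poissonBracket (hF.contDiffAt (hS.mem_nhds hz))
    (hG.contDiffAt (hS.mem_nhds hz))).2, poissonForm_apply, poissonForm_apply]
  simp only [fderiv_fderiv_field_apply hS hF hFI hz, fderiv_fderiv_field_apply hS hG hGI hz]
  have hsymm : ∀ a b, fderiv ℝ (fderiv ℝ g.hamiltonian) z a b =
      fderiv ℝ (fderiv ℝ g.hamiltonian) z b a := fun a b =>
    (g.contDiff_hamiltonian.contDiffAt.isSymmSndFDerivAt (by simpa using two_le_infty)).eq _ _
  have hap : ∀ (L : Phase n →L[ℝ] ℝ) (w : Phase n), L (fderiv ℝ g.field z w) =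
      ∑ k, (fderiv ℝ (fderiv ℝ g.hamiltonian) z w (0, Pi.single k 1) * L (Pi.single k 1, 0) -
        fderiv ℝ (fderiv ℝ g.hamiltonian) z w (Pi.single k 1, 0) * L (0, Pi.single k 1)) := by
    intro L w
    rw [fderiv_field_apply, clm_phase_apply]
    exact Finset.sum_congr rfl fun k _ => by ring
  simp only [hap]
  rw [← Finset.sum_add_distrib]
  simp only [← Finset.sum_neg_distrib, Finset.mul_sum, Finset.sum_mul, ← Finset.sum_sub_distrib,
    ← Finset.sum_add_distrib]
  -- Second derivatives of `F` and `G` have been traded for the Hessian of the Hamiltonian. What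
  -- remains of the Jacobi identity is that the symmetry of this Hessian makes the double sum
  -- antisymmetric.
  refine sum_sum_eq_zero_of_antisymm fun i k => ?_
  rw [hsymm (0, Pi.single k 1) (0, Pi.single i 1), hsymm (Pi.single k 1, 0) (0, Pi.single i 1),
    hsymm (0, Pi.single k 1) (Pi.single i 1, 0), hsymm (Pi.single k 1, 0) (Pi.single i 1, 0)]
  ring

/-- First integrals are constant along orbit segments. -/
theorem eq_of_flowsTo {E : Type} [NormedAddCommGroup E] [NormedSpace ℝ E] {v : E → E} {S : Set E}
    {f : E → ℝ} (hf : ∀ z ∈ S, DifferentiableAt ℝ f z)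
    (hI : ∀ z ∈ S, fderiv ℝ f z (v z) = 0) {t : ℝ} {z z' : E} (h : FlowsTo v S t z z') :
    f z = f z' := by
  obtain ⟨c, rfl, rfl, hc⟩ := h
  have hd : ∀ s ∈ uIcc 0 t, HasDerivWithinAt (fun s => f (c s)) 0 (uIcc 0 t) s := by
    intro s hs
    have := (hf _ (hc s hs).1).hasFDerivAt.comp_hasDerivWithinAt s (hc s hs).2
    rwa [hI _ (hc s hs).1] at this
  have := (convex_uIcc (𝕜 := ℝ) 0 t).norm_image_sub_le_of_norm_hasDerivWithin_le (C := 0) hd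
    (by simp) left_mem_uIcc right_mem_uIcc
  rw [zero_mul, norm_le_zero_iff, sub_eq_zero] at this
  exact this.symm

/-- Functions which are constant along short orbit segments are first integrals. -/
theorem fderiv_field_eq_zero {E : Type} [NormedAddCommGroup E] [NormedSpace ℝ E]
    [FiniteDimensional ℝ E] {v : E → E} (hv : ContDiff ℝ ∞ v) {Ω S : Set E} (hΩ : IsOpen Ω)
    {X : Type} [NormedAddCommGroup X] [NormedSpace ℝ X] {f : E → X} {z : E} (hz : z ∈ Ω)
    (hS : S ∈ 𝓝 z) (hf : DifferentiableAt ℝ f z)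
    (h : ∀ t, ∀ z' ∈ S, FlowsTo v Ω t z z' → f z = f z') : fderiv ℝ f z (v z) = 0 := by
  obtain ⟨φ, hφ, h0, -, hev⟩ := (FlowsTo.refl (v := v) hz).exists_contDiff hv hΩ
  have hd : HasDerivAt (fun s => φ s z) (v z) 0 := by
    have := hev.self_of_nhds.2
    simpa [h0] using this
  have h1 : HasDerivAt (fun s => f (φ s z)) (fderiv ℝ f z (v z)) 0 := by
    refine HasFDerivAt.comp_hasDerivAt 0 (?_ : HasFDerivAt f _ (φ 0 z)) hd
    rw [h0]
    exact hf.hasFDerivAt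
  have hs : ∀ᶠ s in 𝓝 (0 : ℝ), φ s z ∈ S :=
    hd.continuousAt.eventually_mem (by rwa [h0])
  have hev' : ∀ᶠ s in 𝓝 (0 : ℝ), FlowsTo v Ω s z (φ s z) := by
    have hc : ContinuousAt (fun s : ℝ => (s, z)) 0 := by fun_prop
    filter_upwards [hc.eventually hev] with s hs using hs.1
  refine h1.unique ((hasDerivAt_const (0 : ℝ) (f z)).congr_of_eventuallyEq ?_)
  filter_upwards [hs, hev'] with s hs hs'
  exact (h s _ hs hs').symm

end GeodesicFlow

/-! ### Canonical charts of the orbit space -/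

namespace GeodesicFlow

open SmoothFlow

/-- The inverse function theorem for smooth maps, with a smooth inverse on the whole target. -/
theorem exists_openPartialHomeomorph {X Y : Type} [NormedAddCommGroup X] [NormedSpace ℝ X]
    [FiniteDimensional ℝ X] [NormedAddCommGroup Y] [NormedSpace ℝ Y] [FiniteDimensional ℝ Y]
    {f : X → Y} (hf : ContDiff ℝ ∞ f) (a : X) (hinj : ∀ v, fderiv ℝ f a v = 0 → v = 0)
    (hdim : Module.finrank ℝ X = Module.finrank ℝ Y) :
    ∃ Θ : OpenPartialHomeomorph X Y, a ∈ Θ.source ∧ (∀ x, Θ x = f x) ∧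
      ContDiffOn ℝ ∞ Θ.symm Θ.target := by
  have : CompleteSpace X := FiniteDimensional.complete ℝ X
  let e : X ≃L[ℝ] Y := (LinearMap.linearEquivOfInjective (fderiv ℝ f a).toLinearMap
    ((injective_iff_map_eq_zero _).2 hinj) hdim).toContinuousLinearEquiv
  have hfd : ∀ x, HasFDerivAt f (fderiv ℝ f x) x :=
    fun x => (hf.differentiable (by simp) x).hasFDerivAt
  have he : (e : X →L[ℝ] Y) = fderiv ℝ f a := by ext v; rfl
  have hf' : HasFDerivAt f (e : X →L[ℝ] Y) a := he ▸ hfd a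
  -- Restricting to points with invertible derivative makes the local inverse smooth on its whole
  -- target.
  let S : Set X := fderiv ℝ f ⁻¹' range ((↑) : (X ≃L[ℝ] Y) → X →L[ℝ] Y)
  have hS : IsOpen S := (ContinuousLinearEquiv.isOpen (𝕜 := ℝ) (E := X) (F := Y)).preimage
    (hf.continuous_fderiv (by simp))
  let Θ₀ := hf.contDiffAt.toOpenPartialHomeomorph f hf' (by simp)
  refine ⟨Θ₀.restrOpen S hS, ⟨hf.contDiffAt.mem_toOpenPartialHomeomorph_source hf' (by simp),
    ⟨e, he⟩⟩, fun x => rfl, fun y hy => ContDiffAt.contDiffWithinAt ?_⟩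
  have hs : (Θ₀.restrOpen S hS).symm y ∈ S := ((Θ₀.restrOpen S hS).map_target hy).2
  obtain ⟨e', he'⟩ := hs
  exact (Θ₀.restrOpen S hS).contDiffAt_symm hy (f₀' := e')
    (by rw [he']; exact hfd _) hf.contDiffAt

/-- The model of the orbit space: positions, momenta and the energy. -/
abbrev Transversal (m : ℕ) : Type := (Fin m → ℝ) × (Fin m → ℝ) × ℝ

variable {m : ℕ}

/-- The linear inclusion of the section `xⁱ = const`. -/
noncomputable def sectionLinear (i : Fin (m + 1)) : Transversal m →L[ℝ] Phase (m + 1) :=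
  LinearMap.toContinuousLinearMap
    { toFun := fun y => (i.insertNth (α := fun _ => ℝ) 0 y.1,
        i.insertNth (α := fun _ => ℝ) y.2.2 y.2.1)
      map_add' := fun y y' => by
        ext k <;> rcases Fin.eq_self_or_eq_succAbove i k with rfl | ⟨j, rfl⟩ <;> simp
      map_smul' := fun r y => by
        ext k <;> rcases Fin.eq_self_or_eq_succAbove i k with rfl | ⟨j, rfl⟩ <;> simp }

theorem sectionLinear_apply (i : Fin (m + 1)) (y : Transversal m) :
    sectionLinear i y = (i.insertNth (α := fun _ => ℝ) 0 y.1,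
        i.insertNth (α := fun _ => ℝ) y.2.2 y.2.1) := rfl

theorem sectionLinear_removeNth (i : Fin (m + 1)) {w : Phase (m + 1)} (hw : w.1 i = 0) :
    sectionLinear i (fun j => w.1 (i.succAbove j), fun j => w.2 (i.succAbove j), w.2 i) = w := by
  rw [sectionLinear_apply]
  ext k <;> rcases Fin.eq_self_or_eq_succAbove i k with rfl | ⟨j, rfl⟩ <;> simp [hw]

/-- The section `xⁱ = c`. -/
noncomputable def sectionMap (i : Fin (m + 1)) (c : ℝ) (y : Transversal m) : Phase (m + 1) :=
  sectionLinear i y + (Pi.single i c, 0)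

theorem contDiff_sectionMap (i : Fin (m + 1)) (c : ℝ) : ContDiff ℝ ∞ (sectionMap i c) :=
  (sectionLinear i).contDiff.add contDiff_const

theorem hasFDerivAt_sectionMap (i : Fin (m + 1)) (c : ℝ) (y : Transversal m) :
    HasFDerivAt (sectionMap i c) (sectionLinear i) y :=
  (sectionLinear i).hasFDerivAt.add_const _

theorem sectionMap_removeNth (i : Fin (m + 1)) (z : Phase (m + 1)) :
    sectionMap i (z.1 i)
      (fun j => z.1 (i.succAbove j), fun j => z.2 (i.succAbove j), z.2 i) = z := by
  rw [sectionMap, sectionLinear_apply]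
  ext k <;> rcases Fin.eq_self_or_eq_succAbove i k with rfl | ⟨j, rfl⟩ <;> simp

/-- A chart of the orbit space with canonical coordinates `(q, p)` and the energy: `coord` maps a
point to the coordinates of its orbit, `point` maps coordinates to a point of the orbit. -/
structure OrbitChart (g : MetricTensor (m + 1)) (D : Set (Coord (m + 1))) where
  /-- the domain of the coordinates -/
  domain : Set (Phase (m + 1))
  /-- the range of the coordinates -/
  box : Set (Transversal m)
  /-- the coordinates -/
  coord : Phase (m + 1) → Transversal m
  /-- the points of the section -/
  point : Transversal m → Phase (m + 1)
  isOpen_domain : IsOpen domain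
  isOpen_box : IsOpen box
  domain_subset : domain ⊆ cotangent D
  contDiffOn_coord : ContDiffOn ℝ ∞ coord domain
  contDiffOn_point : ContDiffOn ℝ ∞ point box
  coord_mem : ∀ z ∈ domain, coord z ∈ box
  point_mem : ∀ w ∈ box, point w ∈ domain
  point_ne_zero : ∀ w ∈ box, (point w).2 ≠ 0
  coord_point : ∀ w ∈ box, coord (point w) = w
  exists_flowsTo : ∀ z ∈ domain, ∃ t, FlowsTo g.field (cotangent D) t z (point (coord z))
  point_injective : ∀ w ∈ box, ∀ w' ∈ box, ∀ t,
    FlowsTo g.field (cotangent D) t (point w) (point w') → w = w'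
  hamiltonian_point : ∀ w ∈ box, g.hamiltonian (point w) = w.2.2
  bracket_position : ∀ w ∈ box, ∀ j l, poissonBracket (fun z => (coord z).1 j)
    (fun z => (coord z).1 l) (point w) = 0
  bracket_momentum : ∀ w ∈ box, ∀ j l, poissonBracket (fun z => (coord z).2.1 j)
    (fun z => (coord z).2.1 l) (point w) = 0
  bracket_mixed : ∀ w ∈ box, ∀ j l, j ≠ l → poissonBracket (fun z => (coord z).1 j)
    (fun z => (coord z).2.1 l) (point w) = 0

section Section

variable {i : Fin (m + 1)}

/-- Derivatives of the orbit coordinates are known only along the section `xⁱ = c`, that is, in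
every direction except `∂/∂xⁱ`. In a bracket the unknown derivative is multiplied by a `∂/∂pᵢ`,
which vanishes for these coordinates, so the brackets below are still determined. -/
theorem partialP_of_position {F : Phase (m + 1) → ℝ} {z : Phase (m + 1)} {j : Fin m}
    (hF : ∀ d : Transversal m, fderiv ℝ F z (sectionLinear i d) = d.1 j) (k : Fin (m + 1)) :
    partialP F k z = 0 := by
  rw [partialP, ← sectionLinear_removeNth i (w := (0, Pi.single k 1)) rfl, hF]
  rfl

theorem partialX_of_position {F : Phase (m + 1) → ℝ} {z : Phase (m + 1)} {j : Fin m}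
    (hF : ∀ d : Transversal m, fderiv ℝ F z (sectionLinear i d) = d.1 j) {k : Fin (m + 1)}
    (hk : k ≠ i) : partialX F k z = (Pi.single k 1 : Coord (m + 1)) (i.succAbove j) := by
  rw [partialX, ← sectionLinear_removeNth i (w := (Pi.single k 1, 0))
    (Pi.single_eq_of_ne hk.symm _), hF]

theorem partialP_of_momentum {F : Phase (m + 1) → ℝ} {z : Phase (m + 1)} {j : Fin m}
    (hF : ∀ d : Transversal m, fderiv ℝ F z (sectionLinear i d) = d.2.1 j) (k : Fin (m + 1)) :
    partialP F k z = (Pi.single k 1 : Coord (m + 1)) (i.succAbove j) := by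
  rw [partialP, ← sectionLinear_removeNth i (w := (0, Pi.single k 1)) rfl, hF]

theorem partialX_of_momentum {F : Phase (m + 1) → ℝ} {z : Phase (m + 1)} {j : Fin m}
    (hF : ∀ d : Transversal m, fderiv ℝ F z (sectionLinear i d) = d.2.1 j) {k : Fin (m + 1)}
    (hk : k ≠ i) : partialX F k z = 0 := by
  rw [partialX, ← sectionLinear_removeNth i (w := (Pi.single k 1, 0))
    (Pi.single_eq_of_ne hk.symm _), hF]
  rfl

theorem poissonBracket_positions {F G : Phase (m + 1) → ℝ} {z : Phase (m + 1)} {j l : Fin m}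
    (hF : ∀ d : Transversal m, fderiv ℝ F z (sectionLinear i d) = d.1 j)
    (hG : ∀ d : Transversal m, fderiv ℝ G z (sectionLinear i d) = d.1 l) :
    poissonBracket F G z = 0 :=
  Finset.sum_eq_zero fun k _ => by
    rw [partialP_of_position hF, partialP_of_position hG]
    ring

theorem poissonBracket_momenta {F G : Phase (m + 1) → ℝ} {z : Phase (m + 1)} {j l : Fin m}
    (hF : ∀ d : Transversal m, fderiv ℝ F z (sectionLinear i d) = d.2.1 j)
    (hG : ∀ d : Transversal m, fderiv ℝ G z (sectionLinear i d) = d.2.1 l) :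
    poissonBracket F G z = 0 :=
  Finset.sum_eq_zero fun k _ => by
    rcases eq_or_ne k i with rfl | hk
    · rw [partialP_of_momentum hF, partialP_of_momentum hG]
      simp
    · rw [partialX_of_momentum hF hk, partialX_of_momentum hG hk]
      ring

theorem poissonBracket_position_momentum {F G : Phase (m + 1) → ℝ} {z : Phase (m + 1)}
    {j l : Fin m} (hjl : j ≠ l)
    (hF : ∀ d : Transversal m, fderiv ℝ F z (sectionLinear i d) = d.1 j)
    (hG : ∀ d : Transversal m, fderiv ℝ G z (sectionLinear i d) = d.2.1 l) :
    poissonBracket F G z = 0 :=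
  Finset.sum_eq_zero fun k _ => by
    rw [partialP_of_position hF, partialP_of_momentum hG]
    rcases eq_or_ne k (i.succAbove l) with rfl | hk
    · rw [partialX_of_position hF (Fin.succAbove_ne i l),
        Pi.single_eq_of_ne (fun h => hjl (Fin.succAbove_right_injective h))]
      ring
    · rw [Pi.single_eq_of_ne hk.symm]
      ring

end Section

/-- Every point off the zero section lies in the domain of an orbit chart. -/
theorem exists_orbitChart {g : MetricTensor (m + 1)} {D : Set (Coord (m + 1))} (hD : IsOpen D)
    (hconv : g.IsGeodesicallyConvex D) {z₀ : Phase (m + 1)} (hz₀ : z₀ ∈ cotangent D)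
    (hp : z₀.2 ≠ 0) : ∃ C : OrbitChart g D, z₀ ∈ C.domain := by
  obtain ⟨i, hi⟩ := g.exists_velocity_ne_zero (x := z₀.1) hp
  set c := z₀.1 i with hc
  let y₀ : Transversal m := (fun j => z₀.1 (i.succAbove j), fun j => z₀.2 (i.succAbove j), z₀.2 i)
  have hy₀ : sectionMap i c y₀ = z₀ := sectionMap_removeNth i z₀
  have hsec := contDiff_sectionMap i c
  obtain ⟨φ, hφ, h0, -, hev⟩ :=
    (FlowsTo.refl (v := g.field) hz₀).exists_contDiff g.contDiff_field (isOpen_cotangent hD)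
  -- the flow-out of the section
  let Ψ : ℝ × Transversal m → Phase (m + 1) := fun q => φ q.1 (sectionMap i c q.2)
  have hΨ : ContDiff ℝ ∞ Ψ :=
    hφ.comp (contDiff_fst.prodMk (hsec.comp contDiff_snd))
  -- The section is transverse to the flow: its tangent vectors have zero `xⁱ` component, whereas
  -- the field has a nonzero one by the choice of `i`.
  have hΨinj : ∀ d, fderiv ℝ Ψ (0, y₀) d = 0 → d = 0 := by
    rintro ⟨τ, d⟩ hd
    have hΨd := (hΨ.differentiable (by simp) (0, y₀)).hasFDerivAt
    have h1 : fderiv ℝ Ψ (0, y₀) (τ, 0) = τ • g.field z₀ := by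
      have ha : HasDerivAt (fun s : ℝ => Ψ (s, y₀)) (fderiv ℝ Ψ (0, y₀) (1, 0)) 0 :=
        HasFDerivAt.comp_hasDerivAt (f := fun s : ℝ => (s, y₀)) (0 : ℝ) hΨd
          ((hasDerivAt_id _).prodMk (hasDerivAt_const _ _))
      have hb : HasDerivAt (fun s : ℝ => Ψ (s, y₀)) (g.field z₀) 0 := by
        have := hev.self_of_nhds.2
        simpa [Ψ, hy₀, h0] using this
      rw [← ha.unique hb, ← map_smul]
      simp
    have h2 : fderiv ℝ Ψ (0, y₀) (0, d) = sectionLinear i d := by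
      have ha : HasFDerivAt (fun y => Ψ (0, y))
          ((fderiv ℝ Ψ (0, y₀)).comp (.inr ℝ ℝ (Transversal m))) y₀ :=
        HasFDerivAt.comp (g := Ψ) (f := fun y => ((0 : ℝ), y)) y₀ hΨd
          (hasFDerivAt_prodMk_right _ _)
      have hb : HasFDerivAt (fun y => Ψ (0, y)) (sectionLinear i) y₀ := by
        simpa [Ψ, h0] using hasFDerivAt_sectionMap i c y₀
      rw [← ha.unique hb]
      simp
    have h3 : τ • g.field z₀ + sectionLinear i d = 0 := by
      rw [← h1, ← h2, ← map_add, ← hd]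
      simp
    have hx := congrFun (congrArg Prod.fst h3) i
    have hτ : τ = 0 := by
      simp only [sectionLinear_apply, Prod.fst_add, Prod.smul_fst, Pi.add_apply, Pi.smul_apply,
        Fin.insertNth_apply_same, add_zero, smul_eq_mul, Prod.fst_zero, Pi.zero_apply] at hx
      exact (mul_eq_zero.1 hx).resolve_right hi
    rw [hτ, zero_smul, zero_add, sectionLinear_apply] at h3
    have hd1 : ∀ j, d.1 j = 0 := fun j => by
      simpa using congrFun (congrArg Prod.fst h3) (i.succAbove j)
    have hd2 : ∀ j, d.2.1 j = 0 := fun j => by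
      simpa using congrFun (congrArg Prod.snd h3) (i.succAbove j)
    have hd3 : d.2.2 = 0 := by simpa using congrFun (congrArg Prod.snd h3) i
    exact Prod.ext hτ (Prod.ext (funext hd1) (Prod.ext (funext hd2) hd3))
  obtain ⟨Θ, hΘ0, hΘ, hΘs⟩ := exists_openPartialHomeomorph hΨ (0, y₀) hΨinj (by
    simp only [Module.finrank_prod, Module.finrank_self, Module.finrank_fintype_fun_eq_card,
      Fintype.card_fin]
    ring)
  -- the energy as a coordinate
  let κ : Transversal m → Transversal m :=
    fun y => (y.1, y.2.1, g.hamiltonian (sectionMap i c y))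
  have hκ : ContDiff ℝ ∞ κ :=
    contDiff_fst.prodMk ((contDiff_fst.comp contDiff_snd).prodMk
      (g.contDiff_hamiltonian.comp hsec))
  have hκd : ∀ y d, fderiv ℝ κ y d =
      (d.1, d.2.1, fderiv ℝ g.hamiltonian (sectionMap i c y) (sectionLinear i d)) := by
    intro y d
    have ha : HasFDerivAt κ _ y := hasFDerivAt_fst.prodMk
      ((hasFDerivAt_fst.comp y hasFDerivAt_snd).prodMk
        (((g.contDiff_hamiltonian.differentiable (by simp) _).hasFDerivAt).comp y
          (hasFDerivAt_sectionMap i c y)))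
    rw [ha.fderiv]
    rfl
  -- The energy can replace `pᵢ` because `∂H/∂pᵢ` is the velocity component that was chosen nonzero.
  have hκinj : ∀ d, fderiv ℝ κ y₀ d = 0 → d = 0 := by
    intro d hd
    rw [hκd] at hd
    have hd1 : d.1 = 0 := congrArg Prod.fst hd
    have hd2 : d.2.1 = 0 := congrArg (fun d => d.2.1) hd
    have hd3 : fderiv ℝ g.hamiltonian (sectionMap i c y₀) (sectionLinear i d) = 0 :=
      congrArg (fun d => d.2.2) hd
    have hs : sectionLinear i d = d.2.2 • ((0, Pi.single i 1) : Phase (m + 1)) := by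
      rw [sectionLinear_apply, hd1, hd2]
      ext k <;> rcases Fin.eq_self_or_eq_succAbove i k with rfl | ⟨j, rfl⟩ <;> simp
    rw [hs, hy₀, map_smul, smul_eq_mul] at hd3
    have hd4 : d.2.2 = 0 := (mul_eq_zero.1 hd3).resolve_right hi
    exact Prod.ext hd1 (Prod.ext hd2 hd4)
  obtain ⟨K, hK0, hK, hKs⟩ := exists_openPartialHomeomorph hκ y₀ hκinj rfl
  -- choice of the radii
  have hev1 : ∀ᶠ q : ℝ × Transversal m in 𝓝 (0, y₀), q ∈ Θ.source ∧
      FlowsTo g.field (cotangent D) q.1 (sectionMap i c q.2) (Ψ q) := by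
    refine (Θ.open_source.eventually_mem hΘ0).and ?_
    have hcont : Continuous fun q : ℝ × Transversal m => (q.1, sectionMap i c q.2) :=
      continuous_fst.prodMk (hsec.continuous.comp continuous_snd)
    have ht : Tendsto (fun q : ℝ × Transversal m => (q.1, sectionMap i c q.2)) (𝓝 (0, y₀))
        (𝓝 (0, z₀)) := by
      have := hcont.tendsto (0, y₀)
      simpa only [hy₀] using this
    filter_upwards [ht.eventually hev] with q hq using hq.1
  obtain ⟨ε, hε, hεb⟩ := Metric.eventually_nhds_iff_ball.1 hev1
  have hst : Tendsto (sectionMap i c) (𝓝 y₀) (𝓝 z₀) := by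
    simpa only [hy₀] using hsec.continuous.tendsto y₀
  -- Here convexity enters: an orbit meeting the small section twice does so within time `ε`, hence
  -- inside the flow box.
  have hev2 : ∀ᶠ q : Transversal m × Transversal m in 𝓝 (y₀, y₀), ∀ t,
      FlowsTo g.field (cotangent D) t (sectionMap i c q.1) (sectionMap i c q.2) → |t| < ε := by
    have ht : Tendsto (fun q : Transversal m × Transversal m =>
        (sectionMap i c q.1, sectionMap i c q.2)) (𝓝 (y₀, y₀)) (𝓝 (z₀, z₀)) :=
      (hst.comp (continuous_fst.tendsto (y₀, y₀))).prodMk_nhds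
        (hst.comp (continuous_snd.tendsto (y₀, y₀)))
    exact ht.eventually (hconv.eventually_abs_time_lt hD hz₀ hp hε)
  obtain ⟨δ₁, hδ₁, hδ₁b⟩ := Metric.eventually_nhds_iff_ball.1 hev2
  have hev3 : ∀ᶠ y in 𝓝 y₀, y ∈ K.source ∧ (sectionMap i c y).2 ≠ 0 :=
    (K.open_source.eventually_mem hK0).and
      (((continuous_snd.tendsto z₀).comp hst).eventually_ne hp)
  obtain ⟨δ₂, hδ₂, hδ₂b⟩ := Metric.eventually_nhds_iff_ball.1 hev3
  set δ := min ε (min δ₁ δ₂) with hδ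
  have hδ0 : 0 < δ := lt_min hε (lt_min hδ₁ hδ₂)
  let Y : Set (Transversal m) := Metric.ball y₀ δ
  have hYK : Y ⊆ K.source := fun y hy => (hδ₂b y
    (Metric.ball_subset_ball ((min_le_right _ _).trans (min_le_right _ _)) hy)).1
  have hYne : ∀ y ∈ Y, (sectionMap i c y).2 ≠ 0 := fun y hy => (hδ₂b y
    (Metric.ball_subset_ball ((min_le_right _ _).trans (min_le_right _ _)) hy)).2
  let Q : Set (ℝ × Transversal m) := Metric.ball 0 ε ×ˢ Y
  have hQε : Q ⊆ Metric.ball (0, y₀) ε := by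
    rintro ⟨τ, y⟩ ⟨hτ, hy⟩
    rw [← ball_prod_same]
    exact ⟨hτ, Metric.ball_subset_ball (min_le_left _ _) hy⟩
  have hQΘ : Q ⊆ Θ.source := fun q hq => (hεb q (hQε hq)).1
  have hQf : ∀ q ∈ Q, FlowsTo g.field (cotangent D) q.1 (sectionMap i c q.2) (Ψ q) :=
    fun q hq => (hεb q (hQε hq)).2
  have hret : ∀ y ∈ Y, ∀ y' ∈ Y, ∀ t, FlowsTo g.field (cotangent D) t (sectionMap i c y)
      (sectionMap i c y') → |t| < ε := by
    intro y hy y' hy' t ht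
    refine hδ₁b (y, y') ?_ t ht
    rw [← ball_prod_same]
    have hle : δ ≤ δ₁ := (min_le_right _ _).trans (min_le_left _ _)
    exact ⟨Metric.ball_subset_ball hle hy, Metric.ball_subset_ball hle hy'⟩
  have hΨ0 : ∀ y, Ψ (0, y) = sectionMap i c y := fun y => h0 _
  have h0Q : ∀ y ∈ Y, ((0 : ℝ), y) ∈ Q := fun y hy => ⟨Metric.mem_ball_self hε, hy⟩
  have hΘimg : IsOpen (Θ '' Q) :=
    Θ.isOpen_image_of_subset_source (Metric.isOpen_ball.prod Metric.isOpen_ball) hQΘ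
  have hKimg : IsOpen (K '' Y) := K.isOpen_image_of_subset_source Metric.isOpen_ball hYK
  let coord : Phase (m + 1) → Transversal m := fun z => κ (Θ.symm z).2
  let point : Transversal m → Phase (m + 1) := fun w => sectionMap i c (K.symm w)
  have hcoord : ∀ q ∈ Q, coord (Θ q) = κ q.2 := fun q hq => by
    simp only [coord, Θ.left_inv (hQΘ hq)]
  have hpoint : ∀ y ∈ Y, point (κ y) = sectionMap i c y := fun y hy => by
    simp only [point, ← hK, K.left_inv (hYK hy)]
  have hpmem : ∀ y ∈ Y, sectionMap i c y ∈ Θ '' Q := fun y hy =>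
    ⟨(0, y), h0Q y hy, by rw [hΘ, hΨ0]⟩
  have hcs : ∀ y ∈ Y, coord (sectionMap i c y) = κ y := fun y hy => by
    rw [← hΨ0, ← hΘ]
    exact hcoord _ (h0Q y hy)
  have hcsmooth : ContDiffOn ℝ ∞ coord (Θ '' Q) := by
    refine hκ.comp_contDiffOn (contDiff_snd.comp_contDiffOn (hΘs.mono ?_))
    rintro _ ⟨q, hq, rfl⟩
    exact Θ.map_source (hQΘ hq)
  have hdc : ∀ y ∈ Y, ∀ d, fderiv ℝ coord (sectionMap i c y) (sectionLinear i d) =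
      fderiv ℝ κ y d := by
    intro y hy d
    have ha : HasFDerivAt coord (fderiv ℝ coord (sectionMap i c y)) (sectionMap i c y) :=
      ((hcsmooth.contDiffAt (hΘimg.mem_nhds (hpmem y hy))).differentiableAt
        (by simp)).hasFDerivAt
    have hb := ha.comp y (hasFDerivAt_sectionMap i c y)
    have he : coord ∘ sectionMap i c =ᶠ[𝓝 y] κ := by
      filter_upwards [Metric.isOpen_ball.mem_nhds hy] with y' hy' using hcs y' hy'
    rw [← he.fderiv_eq, hb.fderiv]
    rfl
  have hcomp : ∀ y ∈ Y, ∀ (L : Transversal m →L[ℝ] ℝ) d,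
      fderiv ℝ (fun z => L (coord z)) (sectionMap i c y) (sectionLinear i d) =
        L (fderiv ℝ κ y d) := by
    intro y hy L d
    have ha : HasFDerivAt coord (fderiv ℝ coord (sectionMap i c y)) (sectionMap i c y) :=
      ((hcsmooth.contDiffAt (hΘimg.mem_nhds (hpmem y hy))).differentiableAt
        (by simp)).hasFDerivAt
    have hb : HasFDerivAt (fun z => L (coord z)) _ (sectionMap i c y) := L.hasFDerivAt.comp _ ha
    rw [hb.fderiv, ContinuousLinearMap.comp_apply, hdc y hy]
  have hpos : ∀ y ∈ Y, ∀ j d, fderiv ℝ (fun z => (coord z).1 j) (sectionMap i c y)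
      (sectionLinear i d) = d.1 j := by
    intro y hy j d
    have := hcomp y hy ((ContinuousLinearMap.proj (R := ℝ) (φ := fun _ : Fin m => ℝ) j).comp
      (.fst ℝ _ _)) d
    rw [hκd] at this
    exact this
  have hmom : ∀ y ∈ Y, ∀ j d, fderiv ℝ (fun z => (coord z).2.1 j) (sectionMap i c y)
      (sectionLinear i d) = d.2.1 j := by
    intro y hy j d
    have := hcomp y hy ((ContinuousLinearMap.proj (R := ℝ) (φ := fun _ : Fin m => ℝ) j).comp
      ((ContinuousLinearMap.fst ℝ _ _).comp (.snd ℝ _ _))) d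
    rw [hκd] at this
    exact this
  have hbox : ∀ w ∈ K '' Y, ∃ y ∈ Y, w = κ y := by
    rintro _ ⟨y, hy, rfl⟩
    exact ⟨y, hy, hK y⟩
  refine ⟨⟨Θ '' Q, K '' Y, coord, point, hΘimg, hKimg, ?_, hcsmooth, ?_, ?_, ?_, ?_, ?_, ?_, ?_,
    ?_, ?_, ?_, ?_⟩, ?_⟩
  · rintro _ ⟨q, hq, rfl⟩
    rw [hΘ]
    exact (hQf q hq).right_mem
  · refine hsec.comp_contDiffOn (hKs.mono ?_)
    rintro _ ⟨y, hy, rfl⟩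
    exact K.map_source (hYK hy)
  · rintro _ ⟨q, hq, rfl⟩
    exact ⟨q.2, hq.2, by rw [hcoord q hq, hK]⟩
  · intro w hw
    obtain ⟨y, hy, rfl⟩ := hbox w hw
    rw [hpoint y hy]
    exact hpmem y hy
  · intro w hw
    obtain ⟨y, hy, rfl⟩ := hbox w hw
    rw [hpoint y hy]
    exact hYne y hy
  · intro w hw
    obtain ⟨y, hy, rfl⟩ := hbox w hw
    rw [hpoint y hy]
    exact hcs y hy
  · rintro _ ⟨q, hq, rfl⟩
    refine ⟨-q.1, ?_⟩
    rw [hcoord q hq, hpoint _ hq.2, hΘ]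
    exact (hQf q hq).symm g.contDiff_field
  -- A return within time `ε` gives the same point two addresses `(t, y)` and `(0, y')` in the flow
  -- box, where `Θ` is injective.
  · intro w hw w' hw' t ht
    obtain ⟨y, hy, rfl⟩ := hbox w hw
    obtain ⟨y', hy', rfl⟩ := hbox w' hw'
    rw [hpoint y hy, hpoint y' hy'] at ht
    have htε := hret y hy y' hy' t ht
    have htQ : (t, y) ∈ Q := ⟨by rwa [Metric.mem_ball, dist_zero_right], hy⟩
    have h1 : Θ (t, y) = Θ (0, y') := by
      rw [hΘ, hΘ, hΨ0]
      exact (hQf _ htQ).unique g.contDiff_field ht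
    have h2 : y = y' := congrArg Prod.snd (Θ.injOn (hQΘ htQ) (hQΘ (h0Q y' hy')) h1)
    rw [h2]
  · intro w hw
    obtain ⟨y, hy, rfl⟩ := hbox w hw
    rw [hpoint y hy]
  · intro w hw j l
    obtain ⟨y, hy, rfl⟩ := hbox w hw
    rw [hpoint y hy]
    exact poissonBracket_positions (hpos y hy j) (hpos y hy l)
  · intro w hw j l
    obtain ⟨y, hy, rfl⟩ := hbox w hw
    rw [hpoint y hy]
    exact poissonBracket_momenta (hmom y hy j) (hmom y hy l)
  · intro w hw j l hjl
    obtain ⟨y, hy, rfl⟩ := hbox w hw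
    rw [hpoint y hy]
    exact poissonBracket_position_momentum hjl (hpos y hy j) (hmom y hy l)
  · rw [← hy₀]
    exact hpmem y₀ (Metric.mem_ball_self hδ0)

end GeodesicFlow

/-! ### Saturated sets and invariant functions lifted from a chart -/

namespace GeodesicFlow

open SmoothFlow

variable {m : ℕ} {g : MetricTensor (m + 1)} {D : Set (Coord (m + 1))}

instance instIsAddHaarMeasurePhase {n : ℕ} : (volume : Measure (Phase n)).IsAddHaarMeasure :=
  Measure.prod.instIsAddHaarMeasure _ _

instance instIsAddHaarMeasureTransversal : (volume : Measure (Transversal m)).IsAddHaarMeasure :=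
  have : (volume : Measure ((Fin m → ℝ) × ℝ)).IsAddHaarMeasure :=
    Measure.prod.instIsAddHaarMeasure _ _
  Measure.prod.instIsAddHaarMeasure _ _

theorem poissonForm_hamiltonian {n : ℕ} (g : MetricTensor n) (L : Phase n →L[ℝ] ℝ) (z : Phase n) :
    poissonForm n L (fderiv ℝ g.hamiltonian z) = -L (g.field z) := by
  have h := g.poissonBracket_hamiltonian L z
  rwa [poissonBracket_eq_poissonForm, L.fderiv] at h

theorem fderiv_hamiltonian_field {n : ℕ} (g : MetricTensor n) (z : Phase n) :
    fderiv ℝ g.hamiltonian z (g.field z) = 0 := by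
  have h := poissonForm_hamiltonian g (fderiv ℝ g.hamiltonian z) z
  rw [poissonForm_self] at h
  linarith

theorem hamiltonian_eq_of_flowsTo {n : ℕ} {g : MetricTensor n} {Ω : Set (Phase n)} {t : ℝ}
    {z z' : Phase n} (h : FlowsTo g.field Ω t z z') : g.hamiltonian z = g.hamiltonian z' :=
  eq_of_flowsTo (fun z _ => g.contDiff_hamiltonian.differentiable (by simp) z)
    (fun z _ => fderiv_hamiltonian_field g z) h

namespace OrbitChart

variable (C : OrbitChart g D)

/-- The union of the orbits with coordinates in `S`. -/
def saturation (S : Set (Transversal m)) : Set (Phase (m + 1)) :=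
  {z | ∃ w ∈ S, w ∈ C.box ∧ ∃ t, FlowsTo g.field (cotangent D) t (C.point w) z}

variable {C}

theorem saturation_mono {S S' : Set (Transversal m)} (h : S ⊆ S') :
    C.saturation S ⊆ C.saturation S' := fun _ ⟨w, hw, h'⟩ => ⟨w, h hw, h'⟩

theorem mem_saturation_of_flowsTo {S : Set (Transversal m)} {z z' : Phase (m + 1)} {t : ℝ}
    (h : FlowsTo g.field (cotangent D) t z z') (hz : z ∈ C.saturation S) :
    z' ∈ C.saturation S := by
  obtain ⟨w, hw, hb, s, hs⟩ := hz
  exact ⟨w, hw, hb, s + t, hs.trans g.contDiff_field h⟩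

theorem coordinates_unique {w w' : Transversal m} (hw : w ∈ C.box) (hw' : w' ∈ C.box)
    {t t' : ℝ} {z : Phase (m + 1)} (h : FlowsTo g.field (cotangent D) t (C.point w) z)
    (h' : FlowsTo g.field (cotangent D) t' (C.point w') z) : w = w' :=
  C.point_injective w hw w' hw' _ (h.trans g.contDiff_field (h'.symm g.contDiff_field))

theorem point_mem_cotangent {w : Transversal m} (hw : w ∈ C.box) : C.point w ∈ cotangent D :=
  C.domain_subset (C.point_mem w hw)

theorem flowsTo_point {z : Phase (m + 1)} (hz : z ∈ C.domain) :
    ∃ t, FlowsTo g.field (cotangent D) t (C.point (C.coord z)) z := by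
  obtain ⟨t, ht⟩ := C.exists_flowsTo z hz
  exact ⟨-t, ht.symm g.contDiff_field⟩

/-- Near a point of the saturation the coordinates are pulled back by the flow. -/
theorem exists_local_coordinates (hD : IsOpen D) {w : Transversal m} (hw : w ∈ C.box) {t : ℝ}
    {z : Phase (m + 1)} (h : FlowsTo g.field (cotangent D) t (C.point w) z) :
    ∃ ψ : Phase (m + 1) → Phase (m + 1), ContDiff ℝ ∞ ψ ∧ ψ z = C.point w ∧
      (∀ᶠ z' in 𝓝 z, ψ z' ∈ C.domain ∧
        (∃ s, FlowsTo g.field (cotangent D) s (C.point (C.coord (ψ z'))) z') ∧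
        ∃ s, FlowsTo g.field (cotangent D) s z' (ψ z')) ∧
      ∃ θ : Phase (m + 1) → Phase (m + 1), Differentiable ℝ θ ∧ (∀ y, ψ (θ y) = y) ∧ θ (ψ z) = z := by
  have h' := h.symm g.contDiff_field
  obtain ⟨φ, hφ, h0, hadd, hev⟩ := h'.exists_contDiff g.contDiff_field (isOpen_cotangent hD)
  have hc : Continuous fun z' : Phase (m + 1) => ((-t : ℝ), z') := by fun_prop
  have hψ : ∀ s : ℝ, ContDiff ℝ ∞ fun z' => φ s z' :=
    fun s => hφ.comp (contDiff_const.prodMk contDiff_id)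
  have hz : φ (-t) z = C.point w := hev.self_of_nhds.1.unique g.contDiff_field h'
  refine ⟨fun z' => φ (-t) z', hψ (-t), hz, ?_, fun y => φ t y, (hψ t).differentiable (by simp),
    fun y => ?_, ?_⟩
  rotate_left
  · change φ (-t) (φ t y) = y
    rw [← hadd, neg_add_cancel, h0]
  · change φ t (φ (-t) z) = z
    rw [← hadd, add_neg_cancel, h0]
  have hdom : ∀ᶠ z' in 𝓝 z, φ (-t) z' ∈ C.domain :=
    (hψ (-t)).continuous.continuousAt.eventually_mem (C.isOpen_domain.mem_nhds (by
      rw [hz]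
      exact C.point_mem w hw))
  filter_upwards [hdom, (hc.tendsto z).eventually hev] with z' hz' hz''
  obtain ⟨s, hs⟩ := flowsTo_point hz'
  exact ⟨hz', ⟨_, hs.trans g.contDiff_field (hz''.1.symm g.contDiff_field)⟩, _, hz''.1⟩

theorem isOpen_saturation (hD : IsOpen D) {S : Set (Transversal m)} (hS : IsOpen S) :
    IsOpen (C.saturation S) := by
  rw [isOpen_iff_mem_nhds]
  rintro z ⟨w, hw, hb, t, h⟩
  obtain ⟨ψ, hψ, hz, hev, -⟩ := exists_local_coordinates hD hb h
  have hc : ContinuousAt (fun z' => C.coord (ψ z')) z := by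
    have h1 : ContinuousAt C.coord (ψ z) := by
      rw [hz]
      exact C.contDiffOn_coord.continuousOn.continuousAt
        (C.isOpen_domain.mem_nhds (C.point_mem w hb))
    exact h1.comp hψ.continuous.continuousAt
  have hmem : ∀ᶠ z' in 𝓝 z, C.coord (ψ z') ∈ S :=
    hc.eventually_mem (hS.mem_nhds (by rwa [hz, C.coord_point w hb]))
  filter_upwards [hev, hmem] with z' h1 h2
  exact ⟨_, h2, C.coord_mem _ h1.1, h1.2.1⟩

/-- Along an ultrafilter tending to `z` the coordinates converge in `K`, and then so do the times by
`tendsto_time`. Only the section point must have nonzero momentum; `z` may a priori lie on the zero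
section, which is how lifted functions become smooth there too. -/
theorem mem_saturation_of_mem_closure (hD : IsOpen D) (hconv : g.IsGeodesicallyConvex D)
    {K : Set (Transversal m)} (hK : IsCompact K) (hKb : K ⊆ C.box) {z : Phase (m + 1)}
    (hz : z ∈ cotangent D) (hcl : z ∈ closure (C.saturation K)) : z ∈ C.saturation K := by
  obtain ⟨U, hUS, hUz⟩ := mem_closure_iff_ultrafilter.1 hcl
  have hex : ∀ y, ∃ q : Transversal m × ℝ, y ∈ C.saturation K →
      q.1 ∈ K ∧ FlowsTo g.field (cotangent D) q.2 (C.point q.1) y := by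
    intro y
    by_cases hy : y ∈ C.saturation K
    · obtain ⟨w, hw, -, t, ht⟩ := hy
      exact ⟨(w, t), fun _ => ⟨hw, ht⟩⟩
    · exact ⟨(0, 0), fun h => absurd h hy⟩
  choose q hq using hex
  have hwK : ∀ᶠ y in (U : Filter (Phase (m + 1))), (q y).1 ∈ K :=
    Filter.mem_of_superset hUS fun y hy => (hq y hy).1
  obtain ⟨w₀, hw₀, hlim⟩ := hK.ultrafilter_le_nhds (U.map fun y => (q y).1)
    (le_principal_iff.2 hwK)
  have hpt : Tendsto (fun y => C.point (q y).1) U (𝓝 (C.point w₀)) := by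
    have hc : ContinuousAt C.point w₀ :=
      C.contDiffOn_point.continuousOn.continuousAt (C.isOpen_box.mem_nhds (hKb hw₀))
    exact hc.tendsto.comp hlim
  obtain ⟨t₀, -, ht₀⟩ := hconv.tendsto_time hD (l := (U : Filter (Phase (m + 1))))
    (t := fun y => (q y).2) hpt (w := fun y => y) hUz
    (Filter.mem_of_superset hUS fun y hy => (hq y hy).2)
    (point_mem_cotangent (hKb hw₀)) hz (C.point_ne_zero w₀ (hKb hw₀))
  exact ⟨w₀, hw₀, hKb hw₀, t₀, ht₀⟩

variable (C) in
open Classical in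
/-- The invariant extension of a function on the orbit space, by zero off the chart. -/
noncomputable def lift (β : Transversal m → ℝ) (z : Phase (m + 1)) : ℝ :=
  if h : ∃ w, w ∈ C.box ∧ ∃ t, FlowsTo g.field (cotangent D) t (C.point w) z
  then β h.choose else 0

theorem lift_of_flowsTo {β : Transversal m → ℝ} {w : Transversal m} (hw : w ∈ C.box) {t : ℝ}
    {z : Phase (m + 1)} (h : FlowsTo g.field (cotangent D) t (C.point w) z) :
    C.lift β z = β w := by
  have hex : ∃ w, w ∈ C.box ∧ ∃ t, FlowsTo g.field (cotangent D) t (C.point w) z := ⟨w, hw, t, h⟩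
  obtain ⟨hb, t', h'⟩ := hex.choose_spec
  rw [lift, dif_pos hex, coordinates_unique hb hw h' h]

theorem lift_of_mem_domain {β : Transversal m → ℝ} {z : Phase (m + 1)} (hz : z ∈ C.domain) :
    C.lift β z = β (C.coord z) := by
  obtain ⟨t, ht⟩ := flowsTo_point hz
  exact lift_of_flowsTo (C.coord_mem z hz) ht

theorem lift_eq_zero_of_not_mem {β : Transversal m → ℝ} {K : Set (Transversal m)}
    (hβ : ∀ w ∉ K, β w = 0) {z : Phase (m + 1)} (hz : z ∉ C.saturation K) : C.lift β z = 0 := by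
  by_cases h : ∃ w, w ∈ C.box ∧ ∃ t, FlowsTo g.field (cotangent D) t (C.point w) z
  · obtain ⟨w, hw, t, ht⟩ := h
    rw [lift_of_flowsTo hw ht]
    exact hβ w fun hK => hz ⟨w, hK, hw, t, ht⟩
  · rw [lift, dif_neg h]

theorem lift_nonneg {β : Transversal m → ℝ} (hβ : ∀ w, 0 ≤ β w) (z : Phase (m + 1)) :
    0 ≤ C.lift β z := by
  unfold lift
  split_ifs
  · exact hβ _
  · exact le_rfl

theorem lift_eq_of_flowsTo {β : Transversal m → ℝ} {t : ℝ} {z z' : Phase (m + 1)}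
    (h : FlowsTo g.field (cotangent D) t z z') : C.lift β z = C.lift β z' := by
  by_cases hz : z ∈ C.saturation univ
  · obtain ⟨w, -, hw, s, hs⟩ := hz
    rw [lift_of_flowsTo hw hs, lift_of_flowsTo hw (hs.trans g.contDiff_field h)]
  · have hz' : z' ∉ C.saturation univ := fun hz' =>
      hz (mem_saturation_of_flowsTo (h.symm g.contDiff_field) hz')
    rw [lift_eq_zero_of_not_mem (K := univ) (by simp) hz,
      lift_eq_zero_of_not_mem (K := univ) (by simp) hz']

/-- On the orbits over `K` the lift is locally `β` composed with coordinates transported by the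
flow. The other points of `T*D` have a neighbourhood free of such orbits, and there the lift is
zero. -/
theorem contDiffOn_lift (hD : IsOpen D) (hconv : g.IsGeodesicallyConvex D)
    {β : Transversal m → ℝ} (hβ : ContDiff ℝ ∞ β) {K : Set (Transversal m)} (hK : IsCompact K)
    (hKb : K ⊆ C.box) (hβK : ∀ w ∉ K, β w = 0) : ContDiffOn ℝ ∞ (C.lift β) (cotangent D) := by
  intro z hz
  refine ContDiffAt.contDiffWithinAt ?_
  by_cases h : z ∈ C.saturation K
  · obtain ⟨w, -, hw, t, ht⟩ := h
    obtain ⟨ψ, hψ, hψz, hev, -⟩ := exists_local_coordinates hD hw ht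
    have hc : ContDiffAt ℝ ∞ C.coord (ψ z) := by
      rw [hψz]
      exact C.contDiffOn_coord.contDiffAt (C.isOpen_domain.mem_nhds (C.point_mem w hw))
    refine (hβ.contDiffAt.comp z (hc.comp z hψ.contDiffAt)).congr_of_eventuallyEq ?_
    filter_upwards [hev] with z' hz'
    obtain ⟨h1, ⟨s, hs⟩, -⟩ := hz'
    exact lift_of_flowsTo (C.coord_mem _ h1) hs
  · have hcl : z ∉ closure (C.saturation K) :=
      fun hcl => h (mem_saturation_of_mem_closure hD hconv hK hKb hz hcl)
    refine (contDiffAt_const (c := (0 : ℝ))).congr_of_eventuallyEq ?_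
    filter_upwards [isClosed_closure.isOpen_compl.mem_nhds hcl] with z' hz'
    exact lift_eq_zero_of_not_mem hβK fun hz'' => hz' (subset_closure hz'')

theorem fderiv_coord_field (hD : IsOpen D) {z : Phase (m + 1)} (hz : z ∈ C.domain) :
    fderiv ℝ C.coord z (g.field z) = 0 := by
  refine fderiv_field_eq_zero g.contDiff_field (isOpen_cotangent hD) (C.domain_subset hz)
    (C.isOpen_domain.mem_nhds hz) ((C.contDiffOn_coord.contDiffAt
      (C.isOpen_domain.mem_nhds hz)).differentiableAt (by simp)) fun t z' hz' ht => ?_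
  obtain ⟨s, hs⟩ := flowsTo_point hz
  obtain ⟨s', hs'⟩ := flowsTo_point hz'
  exact coordinates_unique (C.coord_mem z hz) (C.coord_mem z' hz')
    (hs.trans g.contDiff_field ht) hs'

theorem hamiltonian_eq_coord {z : Phase (m + 1)} (hz : z ∈ C.domain) :
    g.hamiltonian z = (C.coord z).2.2 := by
  obtain ⟨t, ht⟩ := flowsTo_point hz
  rw [← hamiltonian_eq_of_flowsTo ht, C.hamiltonian_point _ (C.coord_mem z hz)]

theorem hasFDerivAt_coord {w : Transversal m} (hw : w ∈ C.box) :
    HasFDerivAt C.coord (fderiv ℝ C.coord (C.point w)) (C.point w) :=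
  ((C.contDiffOn_coord.contDiffAt (C.isOpen_domain.mem_nhds (C.point_mem w hw))).differentiableAt
    (by simp)).hasFDerivAt

theorem fderiv_lift_point {β : Transversal m → ℝ} {w : Transversal m} (hw : w ∈ C.box)
    (hβ : DifferentiableAt ℝ β w) :
    fderiv ℝ (C.lift β) (C.point w) = (fderiv ℝ β w).comp (fderiv ℝ C.coord (C.point w)) := by
  have he : C.lift β =ᶠ[𝓝 (C.point w)] β ∘ C.coord := by
    filter_upwards [C.isOpen_domain.mem_nhds (C.point_mem w hw)] with z hz
      using lift_of_mem_domain hz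
  rw [he.fderiv_eq]
  have hβ' : HasFDerivAt β (fderiv ℝ β w) (C.coord (C.point w)) := by
    rw [C.coord_point w hw]
    exact hβ.hasFDerivAt
  exact (hβ'.comp _ (hasFDerivAt_coord hw)).fderiv

theorem fderiv_hamiltonian_point {w : Transversal m} (hw : w ∈ C.box) :
    fderiv ℝ g.hamiltonian (C.point w) =
      ((ContinuousLinearMap.snd ℝ (Fin m → ℝ) ℝ).comp (.snd ℝ (Fin m → ℝ) _)).comp
        (fderiv ℝ C.coord (C.point w)) := by
  have he : g.hamiltonian =ᶠ[𝓝 (C.point w)] fun z => (C.coord z).2.2 := by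
    filter_upwards [C.isOpen_domain.mem_nhds (C.point_mem w hw)] with z hz
      using hamiltonian_eq_coord hz
  rw [he.fderiv_eq]
  exact (((ContinuousLinearMap.snd ℝ (Fin m → ℝ) ℝ).comp (.snd ℝ (Fin m → ℝ) _)).hasFDerivAt.comp _
    (hasFDerivAt_coord hw)).fderiv

/-- `point` is a smooth right inverse of `coord`. -/
theorem surjective_fderiv_coord {w : Transversal m} (hw : w ∈ C.box) :
    Function.Surjective (fderiv ℝ C.coord (C.point w)) := by
  have hp : HasFDerivAt C.point (fderiv ℝ C.point w) w :=
    ((C.contDiffOn_point.contDiffAt (C.isOpen_box.mem_nhds hw)).differentiableAt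
      (by simp)).hasFDerivAt
  have h1 := (hasFDerivAt_coord hw).comp w hp
  have h2 : HasFDerivAt (C.coord ∘ C.point) (ContinuousLinearMap.id ℝ (Transversal m)) w := by
    refine (hasFDerivAt_id w).congr_of_eventuallyEq ?_
    filter_upwards [C.isOpen_box.mem_nhds hw] with w' hw' using C.coord_point w' hw'
  intro d
  exact ⟨fderiv ℝ C.point w d, congrArg (fun L => L d) (h1.unique h2)⟩

/-- Functions of the products `x_k dq_k + y_k dp_k` and of the energy are in involution. -/
theorem poissonForm_coord_eq_zero (hD : IsOpen D) {w : Transversal m} (hw : w ∈ C.box)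
    {M M' : Transversal m →L[ℝ] ℝ} {x y a a' : Fin m → ℝ} {e e' : ℝ}
    (hM : ∀ d, M d = e * d.2.2 + ∑ k, a k * (x k * d.1 k + y k * d.2.1 k))
    (hM' : ∀ d, M' d = e' * d.2.2 + ∑ k, a' k * (x k * d.1 k + y k * d.2.1 k)) :
    poissonForm (m + 1) (M.comp (fderiv ℝ C.coord (C.point w)))
      (M'.comp (fderiv ℝ C.coord (C.point w))) = 0 := by
  set T := fderiv ℝ C.coord (C.point w) with hT
  let pq : Fin m → Transversal m →L[ℝ] ℝ := fun j =>
    (ContinuousLinearMap.proj (R := ℝ) (φ := fun _ : Fin m => ℝ) j).comp (.fst ℝ _ _)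
  let pp : Fin m → Transversal m →L[ℝ] ℝ := fun j =>
    (ContinuousLinearMap.proj (R := ℝ) (φ := fun _ : Fin m => ℝ) j).comp
      ((ContinuousLinearMap.fst ℝ _ _).comp (.snd ℝ _ _))
  have hq : ∀ j, fderiv ℝ (fun z => (C.coord z).1 j) (C.point w) = (pq j).comp T := fun j =>
    ((pq j).hasFDerivAt.comp _ (hasFDerivAt_coord hw)).fderiv
  have hp : ∀ j, fderiv ℝ (fun z => (C.coord z).2.1 j) (C.point w) = (pp j).comp T := fun j =>
    ((pp j).hasFDerivAt.comp _ (hasFDerivAt_coord hw)).fderiv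
  have hqq : ∀ j l, poissonForm (m + 1) ((pq j).comp T) ((pq l).comp T) = 0 := fun j l => by
    rw [← hq, ← hq]
    exact C.bracket_position w hw j l
  have hpp : ∀ j l, poissonForm (m + 1) ((pp j).comp T) ((pp l).comp T) = 0 := fun j l => by
    rw [← hp, ← hp]
    exact C.bracket_momentum w hw j l
  have hqp : ∀ j l, j ≠ l → poissonForm (m + 1) ((pq j).comp T) ((pp l).comp T) = 0 :=
    fun j l hjl => by
      rw [← hq, ← hp]
      exact C.bracket_mixed w hw j l hjl
  let θ : Fin m → Phase (m + 1) →L[ℝ] ℝ := fun k => x k • (pq k).comp T + y k • (pp k).comp T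
  -- For `k ≠ l` all brackets between coordinates of different index vanish; for `k = l`
  -- antisymmetry suffices. The bracket of the conjugate pair `qₖ, pₖ` is never needed.
  have hθ : ∀ k l, poissonForm (m + 1) (θ k) (θ l) = 0 := by
    intro k l
    rcases eq_or_ne k l with rfl | hkl
    · exact poissonForm_self _
    · simp only [θ, map_add, map_smul, LinearMap.add_apply, LinearMap.smul_apply, hqq, hpp,
        hqp k l hkl, poissonForm_neg_swap ((pp k).comp T), hqp l k hkl.symm]
      simp
  -- The energy coordinate has differential `dH`, and bracketing with `dH` differentiates along the
  -- flow, where `coord` is constant.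
  have hH : ∀ L : Transversal m →L[ℝ] ℝ,
      poissonForm (m + 1) (L.comp T) (fderiv ℝ g.hamiltonian (C.point w)) = 0 := by
    intro L
    rw [poissonForm_hamiltonian, ContinuousLinearMap.comp_apply, hT,
      fderiv_coord_field hD (C.point_mem w hw), map_zero, neg_zero]
  have hdec : ∀ {M : Transversal m →L[ℝ] ℝ} {a : Fin m → ℝ} {e : ℝ},
      (∀ d, M d = e * d.2.2 + ∑ k, a k * (x k * d.1 k + y k * d.2.1 k)) →
      M.comp T = e • fderiv ℝ g.hamiltonian (C.point w) + ∑ k, a k • θ k := by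
    intro M a e hM
    refine ContinuousLinearMap.ext fun d => ?_
    rw [fderiv_hamiltonian_point hw, ContinuousLinearMap.comp_apply, hM]
    simp only [add_apply, smul_apply, sum_apply, smul_eq_mul, θ, pq, pp]
    rfl
  have hθH : ∀ k, poissonForm (m + 1) (θ k) (fderiv ℝ g.hamiltonian (C.point w)) = 0 := by
    intro k
    simp only [θ, map_add, map_smul, LinearMap.add_apply, LinearMap.smul_apply, hH]
    simp
  rw [hdec hM']
  simp only [map_add, map_smul, map_sum, hH]
  rw [hdec hM]
  simp only [map_add, map_smul, map_sum, LinearMap.add_apply, LinearMap.smul_apply,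
    LinearMap.sum_apply, hθ, poissonForm_neg_swap (fderiv ℝ g.hamiltonian (C.point w)), hθH]
  simp

/-- The saturation of a null set is a null set. -/
theorem volume_saturation_eq_zero (hD : IsOpen D) {S : Set (Transversal m)}
    (hS : volume S = 0) : volume (C.saturation S) = 0 := by
  classical
  -- The flow-out of the section, with junk value `0` where the flow is undefined. It is
  -- differentiable at each point of `A` and maps `A` onto the saturation.
  let f : ℝ × Transversal m → Phase (m + 1) := fun q =>
    if h : ∃ z, FlowsTo g.field (cotangent D) q.1 (C.point q.2) z then h.choose else 0
  have hf : ∀ {t w z}, FlowsTo g.field (cotangent D) t (C.point w) z → f (t, w) = z := by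
    intro t w z h
    have hex : ∃ z, FlowsTo g.field (cotangent D) t (C.point w) z := ⟨z, h⟩
    simp only [f]
    rw [dif_pos hex]
    exact hex.choose_spec.unique g.contDiff_field h
  let A : Set (ℝ × Transversal m) := {q | q.2 ∈ S ∧ q.2 ∈ C.box ∧
    ∃ z, FlowsTo g.field (cotangent D) q.1 (C.point q.2) z}
  have hfd : ∀ q ∈ A, DifferentiableAt ℝ f q := by
    rintro ⟨t, w⟩ ⟨-, hw, z, hz⟩
    obtain ⟨φ, hφ, -, -, hev⟩ := hz.exists_contDiff g.contDiff_field (isOpen_cotangent hD)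
    have hp : ContDiffAt ℝ ∞ C.point w := C.contDiffOn_point.contDiffAt (C.isOpen_box.mem_nhds hw)
    have hc : ContDiffAt ℝ ∞ (fun q : ℝ × Transversal m => (q.1, C.point q.2)) (t, w) :=
      contDiffAt_fst.prodMk (ContDiffAt.comp (t, w) hp contDiffAt_snd)
    have hd : DifferentiableAt ℝ (fun q : ℝ × Transversal m => φ q.1 (C.point q.2)) (t, w) :=
      (ContDiffAt.comp (t, w) hφ.contDiffAt hc).differentiableAt (by simp)
    refine hd.congr_of_eventuallyEq ?_
    filter_upwards [hc.continuousAt.eventually hev] with q hq using hf hq.1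
  have hdim : Module.finrank ℝ (Phase (m + 1)) = Module.finrank ℝ (ℝ × Transversal m) := by
    simp only [Module.finrank_prod, Module.finrank_self, Module.finrank_fintype_fun_eq_card,
      Fintype.card_fin]
    ring
  -- Both spaces have dimension `2m + 2`. Identifying them turns the flow-out into a self-map, and
  -- differentiable self-maps send null sets to null sets.
  let ℓ : Phase (m + 1) ≃L[ℝ] ℝ × Transversal m := ContinuousLinearEquiv.ofFinrankEq hdim
  have hnull : volume (ℓ ⁻¹' A) = 0 := by
    obtain ⟨S', hSS', hS'm, hS'0⟩ := exists_measurable_superset_of_null hS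
    let L : Phase (m + 1) →ₗ[ℝ] Transversal m :=
      (LinearMap.snd ℝ ℝ (Transversal m)).comp ℓ.toLinearEquiv.toLinearMap
    have hL : Function.Surjective L := Prod.snd_surjective.comp ℓ.surjective
    have hae := (ae_comp_linearMap_mem_iff L (volume : Measure (Phase (m + 1)))
      (volume : Measure (Transversal m)) hL hS'm.compl).2 (by
        rw [ae_iff]
        simpa using hS'0)
    refine measure_mono_null (fun z hz => ?_) (ae_iff.1 hae)
    simp only [mem_compl_iff, not_not, mem_ofPred_eq]
    exact hSS' hz.1
  have himg := addHaar_image_eq_zero_of_differentiableOn_of_addHaar_eq_zero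
    (volume : Measure (Phase (m + 1))) (f := f ∘ ℓ) (s := ℓ ⁻¹' A)
    (fun z hz => ((hfd _ hz).comp z ℓ.differentiableAt).differentiableWithinAt) hnull
  refine measure_mono_null ?_ himg
  rintro z ⟨w, hw, hb, t, ht⟩
  refine ⟨ℓ.symm (t, w), ?_, ?_⟩
  · rw [mem_preimage, ℓ.apply_symm_apply]
    exact ⟨hw, hb, z, ht⟩
  · rw [Function.comp_apply, ℓ.apply_symm_apply]
    exact hf ht

end OrbitChart

end GeodesicFlow

/-! ### Independent bump functions on a cube -/

namespace GeodesicFlow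

open SmoothFlow

variable {m : ℕ}

/-- A smooth bump supported in `[-1, 1]`. -/
noncomputable def unitBump (v : ℝ) : ℝ := expNegInvGlue (1 - v ^ 2)

/-- The logarithmic derivative of `unitBump`. -/
noncomputable def unitBumpSlope (v : ℝ) : ℝ := -2 * v / (1 - v ^ 2) ^ 2

theorem contDiff_unitBump : ContDiff ℝ ∞ unitBump :=
  expNegInvGlue.contDiff.comp (contDiff_const.sub (contDiff_id.pow 2))

theorem unitBump_nonneg (v : ℝ) : 0 ≤ unitBump v := expNegInvGlue.nonneg _

theorem unitBump_eq_zero {v : ℝ} (hv : 1 ≤ |v|) : unitBump v = 0 :=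
  expNegInvGlue.zero_of_nonpos (by have := (one_le_sq_iff_one_le_abs v).2 hv; linarith)

theorem one_sub_sq_pos {v : ℝ} (hv : |v| < 1) : 0 < 1 - v ^ 2 := by
  have := (sq_lt_one_iff_abs_lt_one v).2 hv
  linarith

theorem unitBump_eq_exp {v : ℝ} (hv : |v| < 1) : unitBump v = Real.exp (-(1 - v ^ 2)⁻¹) := by
  rw [unitBump, expNegInvGlue, if_neg (not_le.2 (one_sub_sq_pos hv))]

theorem unitBump_pos {v : ℝ} (hv : |v| < 1) : 0 < unitBump v :=
  expNegInvGlue.pos_of_pos (one_sub_sq_pos hv)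

/-- The only critical point inside the support is the centre; hence independence fails at worst on
the hyperplanes through the centre of a cube. -/
theorem unitBumpSlope_ne_zero {v : ℝ} (hv : |v| < 1) (h0 : v ≠ 0) : unitBumpSlope v ≠ 0 :=
  div_ne_zero (mul_ne_zero (by norm_num) h0) (pow_ne_zero _ (one_sub_sq_pos hv).ne')

theorem hasDerivAt_unitBump {v : ℝ} (hv : |v| < 1) :
    HasDerivAt unitBump (unitBump v * unitBumpSlope v) v := by
  have h1 : HasDerivAt (fun v : ℝ => 1 - v ^ 2) (-(2 * v)) v := by
    simpa using (hasDerivAt_pow 2 v).const_sub 1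
  have h2 := (h1.fun_inv (one_sub_sq_pos hv).ne').neg.exp
  have he : unitBump =ᶠ[𝓝 v] fun v => Real.exp (-(1 - v ^ 2)⁻¹) := by
    filter_upwards [(isOpen_lt continuous_abs continuous_const).mem_nhds hv] with u hu
      using unitBump_eq_exp hu
  refine (h2.congr_of_eventuallyEq he).congr_deriv ?_
  rw [unitBump_eq_exp hv, unitBumpSlope]
  simp only [Pi.neg_apply]
  ring

/-- The rescaled coordinate displacements from the centre `a`. -/
noncomputable def rescale (a : Transversal m) (r : ℝ) (w : Transversal m) : Transversal m :=
  r⁻¹ • (w - a)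

theorem contDiff_rescale (a : Transversal m) (r : ℝ) : ContDiff ℝ ∞ (rescale a r) :=
  (contDiff_id.sub contDiff_const).const_smul r⁻¹

/-- The norm is the sup norm, so balls are cubes and are compatible with products of one-variable
bumps. -/
theorem mem_ball_iff_rescale {a w : Transversal m} {r : ℝ} (hr : 0 < r) :
    w ∈ Metric.ball a r ↔ (∀ k, |(rescale a r w).1 k| < 1) ∧ (∀ k, |(rescale a r w).2.1 k| < 1) ∧
      |(rescale a r w).2.2| < 1 := by
  have h : w ∈ Metric.ball a r ↔ ‖rescale a r w‖ < 1 := by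
    rw [mem_ball_iff_norm, rescale, norm_smul, norm_inv, Real.norm_of_nonneg hr.le,
      inv_mul_lt_iff₀ hr, mul_one]
  rw [h, Prod.norm_def, Prod.norm_def, max_lt_iff, max_lt_iff, pi_norm_lt_iff one_pos,
    pi_norm_lt_iff one_pos]
  simp only [Real.norm_eq_abs]

/-- A bump function on a cube, with prescribed multiplicities of the coordinate factors. -/
noncomputable def cubeBump (a : Transversal m) (r : ℝ) (μ ν : Fin m → ℕ) (w : Transversal m) : ℝ :=
  unitBump (rescale a r w).2.2 * ∏ k, (unitBump ((rescale a r w).1 k) ^ μ k *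
    unitBump ((rescale a r w).2.1 k) ^ ν k)

section CubeBump

variable {a w : Transversal m} {r : ℝ} {μ ν : Fin m → ℕ}

theorem contDiff_cubeBump : ContDiff ℝ ∞ (cubeBump a r μ ν) := by
  have h := contDiff_rescale a r
  have h1 : ∀ k, ContDiff ℝ ∞ fun w => (rescale a r w).1 k := fun k =>
    (contDiff_apply ℝ ℝ k).comp h.fst
  have h2 : ∀ k, ContDiff ℝ ∞ fun w => (rescale a r w).2.1 k := fun k =>
    (contDiff_apply ℝ ℝ k).comp h.snd.fst
  exact (contDiff_unitBump.comp h.snd.snd).mul (contDiff_prod fun k _ =>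
    ((contDiff_unitBump.comp (h1 k)).pow _).mul ((contDiff_unitBump.comp (h2 k)).pow _))

theorem cubeBump_nonneg : 0 ≤ cubeBump a r μ ν w :=
  mul_nonneg (unitBump_nonneg _) (Finset.prod_nonneg fun _ _ =>
    mul_nonneg (pow_nonneg (unitBump_nonneg _) _) (pow_nonneg (unitBump_nonneg _) _))

theorem cubeBump_pos (hr : 0 < r) (hw : w ∈ Metric.ball a r) : 0 < cubeBump a r μ ν w := by
  obtain ⟨h1, h2, h3⟩ := (mem_ball_iff_rescale hr).1 hw
  exact mul_pos (unitBump_pos h3) (Finset.prod_pos fun k _ =>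
    mul_pos (pow_pos (unitBump_pos (h1 k)) _) (pow_pos (unitBump_pos (h2 k)) _))

theorem cubeBump_eq_zero (hr : 0 < r) (hμ : ∀ k, μ k ≠ 0) (hν : ∀ k, ν k ≠ 0)
    (hw : w ∉ Metric.ball a r) : cubeBump a r μ ν w = 0 := by
  rw [mem_ball_iff_rescale hr] at hw
  by_cases h3 : |(rescale a r w).2.2| < 1
  · by_cases h1 : ∀ k, |(rescale a r w).1 k| < 1
    · have h2 : ¬∀ k, |(rescale a r w).2.1 k| < 1 := fun h2 => hw ⟨h1, h2, h3⟩
      push Not at h2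
      obtain ⟨k, hk⟩ := h2
      rw [cubeBump, Finset.prod_eq_zero (Finset.mem_univ k), mul_zero]
      rw [unitBump_eq_zero hk, zero_pow (hν k), mul_zero]
    · push Not at h1
      obtain ⟨k, hk⟩ := h1
      rw [cubeBump, Finset.prod_eq_zero (Finset.mem_univ k), mul_zero]
      rw [unitBump_eq_zero hk, zero_pow (hμ k), zero_mul]
  · rw [cubeBump, unitBump_eq_zero (not_lt.1 h3), zero_mul]

theorem hasDerivAt_unitBump_line {x d : ℝ} (hx : |x| < 1) (n : ℕ) :
    HasDerivAt (fun t => unitBump (x + t * d) ^ n)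
      (unitBump x ^ n * (n * (unitBumpSlope x * d))) 0 := by
  have h0 : HasDerivAt (fun t : ℝ => x + t * d) d 0 := by
    simpa using ((hasDerivAt_id (0 : ℝ)).mul_const d).const_add x
  have h1 : HasDerivAt unitBump (unitBump x * unitBumpSlope x) (x + 0 * d) := by
    simpa using hasDerivAt_unitBump hx
  have h2 := (h1.comp 0 h0).fun_pow n
  refine h2.congr_deriv ?_
  rcases n with _ | n
  · simp
  · simp only [Function.comp_apply, zero_mul, add_zero, Nat.add_sub_cancel, pow_succ]
    ring

/-- Logarithmic differentiation: the exponents enter the bracketed sum linearly, which reduces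
independence to linear algebra with the matrix of exponents. -/
theorem fderiv_cubeBump (hr : 0 < r) (hw : w ∈ Metric.ball a r) (d : Transversal m) :
    fderiv ℝ (cubeBump a r μ ν) w d = cubeBump a r μ ν w * r⁻¹ *
      (unitBumpSlope (rescale a r w).2.2 * d.2.2 +
        ∑ k, (μ k * (unitBumpSlope ((rescale a r w).1 k) * d.1 k) +
          ν k * (unitBumpSlope ((rescale a r w).2.1 k) * d.2.1 k))) := by
  obtain ⟨h1, h2, h3⟩ := (mem_ball_iff_rescale hr).1 hw
  have hl : HasDerivAt (fun t : ℝ => w + t • d) d 0 := by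
    simpa using ((hasDerivAt_id (0 : ℝ)).smul_const d).const_add w
  have hf : HasFDerivAt (cubeBump a r μ ν) (fderiv ℝ (cubeBump a r μ ν) w) (w + (0 : ℝ) • d) := by
    rw [zero_smul, add_zero]
    exact (contDiff_cubeBump.differentiable (by simp) w).hasFDerivAt
  have hc := hf.comp_hasDerivAt 0 hl
  have hu := hasDerivAt_unitBump_line h3 (d := r⁻¹ * d.2.2) 1
  have hp := HasDerivAt.fun_finsetProd (u := Finset.univ) fun k (_ : k ∈ Finset.univ) =>
    (hasDerivAt_unitBump_line (h1 k) (d := r⁻¹ * d.1 k) (μ k)).fun_mul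
      (hasDerivAt_unitBump_line (h2 k) (d := r⁻¹ * d.2.1 k) (ν k))
  have hm := hu.fun_mul hp
  have he : (cubeBump a r μ ν ∘ fun t : ℝ => w + t • d) = fun t : ℝ =>
      unitBump ((rescale a r w).2.2 + t * (r⁻¹ * d.2.2)) ^ 1 *
      ∏ k, (unitBump ((rescale a r w).1 k + t * (r⁻¹ * d.1 k)) ^ μ k *
        unitBump ((rescale a r w).2.1 k + t * (r⁻¹ * d.2.1 k)) ^ ν k) := by
    funext t
    have hrs : rescale a r (w + t • d) = rescale a r w + (t * r⁻¹) • d := by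
      rw [rescale, rescale, add_sub_right_comm, smul_add, smul_smul, mul_comm t]
    simp only [Function.comp_apply, cubeBump, hrs, Prod.fst_add, Prod.snd_add, Prod.smul_fst,
      Prod.smul_snd, Pi.add_apply, Pi.smul_apply, smul_eq_mul, pow_one, mul_assoc]
  rw [he] at hc
  rw [hc.unique hm]
  have hsum : ∀ k ∈ Finset.univ, (∏ j ∈ Finset.univ.erase k,
      (unitBump ((rescale a r w).1 j + 0 * (r⁻¹ * d.1 j)) ^ μ j *
        unitBump ((rescale a r w).2.1 j + 0 * (r⁻¹ * d.2.1 j)) ^ ν j)) •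
      (unitBump ((rescale a r w).1 k) ^ μ k *
          (μ k * (unitBumpSlope ((rescale a r w).1 k) * (r⁻¹ * d.1 k))) *
        unitBump ((rescale a r w).2.1 k + 0 * (r⁻¹ * d.2.1 k)) ^ ν k +
      unitBump ((rescale a r w).1 k + 0 * (r⁻¹ * d.1 k)) ^ μ k *
        (unitBump ((rescale a r w).2.1 k) ^ ν k *
          (ν k * (unitBumpSlope ((rescale a r w).2.1 k) * (r⁻¹ * d.2.1 k))))) =
      (∏ j, (unitBump ((rescale a r w).1 j) ^ μ j * unitBump ((rescale a r w).2.1 j) ^ ν j)) *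
      (r⁻¹ * (μ k * (unitBumpSlope ((rescale a r w).1 k) * d.1 k) +
          ν k * (unitBumpSlope ((rescale a r w).2.1 k) * d.2.1 k))) := by
    intro k hk
    rw [← Finset.prod_erase_mul _ _ hk]
    simp only [zero_mul, add_zero, smul_eq_mul]
    ring
  rw [Finset.sum_congr rfl hsum, ← Finset.mul_sum, ← Finset.mul_sum]
  simp only [zero_mul, add_zero, cubeBump, pow_one, Nat.cast_one]
  ring

end CubeBump

/-- The multiplicities `1`, except for `2` at `j`. -/
def doubleAt (j k : Fin m) : ℕ := if j = k then 2 else 1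

/-- The coordinate integrals on a cube: the first half is in involution. -/
noncomputable def cubeFamily (a : Transversal m) (r : ℝ) : Fin m ⊕ Fin m → Transversal m → ℝ :=
  Sum.elim (fun j => cubeBump a r (doubleAt j) (doubleAt j))
    (fun j => cubeBump a r (doubleAt j) fun _ => 1)

section CubeFamily

variable {a w : Transversal m} {r : ℝ}

theorem doubleAt_ne_zero (j k : Fin m) : doubleAt j k ≠ 0 := by
  unfold doubleAt
  split_ifs <;> norm_num

theorem contDiff_cubeFamily (l : Fin m ⊕ Fin m) : ContDiff ℝ ∞ (cubeFamily a r l) := by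
  rcases l with j | j <;> exact contDiff_cubeBump

theorem cubeFamily_nonneg (l : Fin m ⊕ Fin m) (w : Transversal m) : 0 ≤ cubeFamily a r l w := by
  rcases l with j | j <;> exact cubeBump_nonneg

theorem cubeFamily_eq_zero (hr : 0 < r) (l : Fin m ⊕ Fin m) (hw : w ∉ Metric.ball a r) :
    cubeFamily a r l w = 0 := by
  rcases l with j | j
  · exact cubeBump_eq_zero hr (doubleAt_ne_zero j) (doubleAt_ne_zero j) hw
  · exact cubeBump_eq_zero hr (doubleAt_ne_zero j) (fun _ => one_ne_zero) hw

/-- In a relation, after dividing by nonzero slopes, the `dqⱼ` and `dpⱼ` coefficients differ exactly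
by the coefficient of the `j`-th function of the second half. So the second half drops out, and the
matrix `1 + δ` of exponents disposes of the first. -/
theorem linearIndependent_cubeFamily (hr : 0 < r) (hw : w ∈ Metric.ball a r)
    (h1 : ∀ k, w.1 k ≠ a.1 k) (h2 : ∀ k, w.2.1 k ≠ a.2.1 k) :
    LinearIndependent ℝ (Sum.elim
      (fun _ : Unit => (ContinuousLinearMap.snd ℝ (Fin m → ℝ) ℝ).comp (.snd ℝ (Fin m → ℝ) _))
      (fun l : Fin m ⊕ Fin m => fderiv ℝ (cubeFamily a r l) w)) := by
  obtain ⟨b1, b2, -⟩ := (mem_ball_iff_rescale hr).1 hw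
  have hr' : r⁻¹ ≠ 0 := inv_ne_zero hr.ne'
  have hx : ∀ k, unitBumpSlope ((rescale a r w).1 k) ≠ 0 := fun k =>
    unitBumpSlope_ne_zero (b1 k) (mul_ne_zero hr' (sub_ne_zero.2 (h1 k)))
  have hy : ∀ k, unitBumpSlope ((rescale a r w).2.1 k) ≠ 0 := fun k =>
    unitBumpSlope_ne_zero (b2 k) (mul_ne_zero hr' (sub_ne_zero.2 (h2 k)))
  rw [Fintype.linearIndependent_iff]
  intro c hc
  let cF : Fin m → ℝ := fun j => c (.inr (.inl j)) *
    (cubeBump a r (doubleAt j) (doubleAt j) w * r⁻¹)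
  let cG : Fin m → ℝ := fun j => c (.inr (.inr j)) *
    (cubeBump a r (doubleAt j) (fun _ => 1) w * r⁻¹)
  have hc' : ∀ d : Transversal m, c (.inl ()) * d.2.2 +
      (∑ j, cF j * (unitBumpSlope (rescale a r w).2.2 * d.2.2 +
        ∑ k, (doubleAt j k * (unitBumpSlope ((rescale a r w).1 k) * d.1 k) +
          doubleAt j k * (unitBumpSlope ((rescale a r w).2.1 k) * d.2.1 k))) +
      ∑ j, cG j * (unitBumpSlope (rescale a r w).2.2 * d.2.2 +
        ∑ k, (doubleAt j k * (unitBumpSlope ((rescale a r w).1 k) * d.1 k) +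
          (1 : ℕ) * (unitBumpSlope ((rescale a r w).2.1 k) * d.2.1 k)))) = 0 := by
    intro d
    have h := congrArg (fun L : Transversal m →L[ℝ] ℝ => L d) hc
    simp only [Fintype.sum_sum_type, Sum.elim_inl, Sum.elim_inr, cubeFamily, Finset.univ_unique,
      Finset.sum_singleton, add_apply, smul_apply, sum_apply, smul_eq_mul,
      fderiv_cubeBump hr hw, zero_apply] at h
    simp only [cF, cG, mul_assoc] at h ⊢
    exact h
  have hp : ∀ j, ∑ i, cF i + ∑ i, cG i + cF j = 0 := by
    intro j
    have h := hc' (0, Pi.single j 1, 0)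
    simp only [mul_zero, Pi.zero_apply, zero_add, Pi.single_apply, mul_ite, mul_one,
      Finset.sum_ite_eq', Finset.mem_univ, if_true, Nat.cast_one, one_mul] at h
    refine (mul_eq_zero.1 ?_).resolve_right (hy j)
    rw [← h, add_mul, add_mul, Finset.sum_mul, Finset.sum_mul, add_right_comm]
    congr 1
    rw [← Finset.add_sum_erase _ _ (Finset.mem_univ j),
      ← Finset.add_sum_erase (a := j) _ _ (Finset.mem_univ j), add_right_comm]
    have he : ∀ i ∈ Finset.univ.erase j, cF i * (doubleAt i j *
        unitBumpSlope ((rescale a r w).2.1 j)) = cF i * unitBumpSlope ((rescale a r w).2.1 j) := by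
      intro i hi
      rw [doubleAt, if_neg (Finset.ne_of_mem_erase hi)]
      simp
    rw [Finset.sum_congr rfl he, doubleAt, if_pos rfl]
    push_cast
    ring
  have hq : ∀ j, ∑ i, cF i + ∑ i, cG i + cF j + cG j = 0 := by
    intro j
    have h := hc' (Pi.single j 1, 0, 0)
    simp only [mul_zero, Pi.zero_apply, zero_add, add_zero, Pi.single_apply, mul_ite, mul_one,
      Finset.sum_ite_eq', Finset.mem_univ, if_true] at h
    refine (mul_eq_zero.1 ?_).resolve_right (hx j)
    have he : ∀ c : Fin m → ℝ, ∑ i, c i * (doubleAt i j *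
        unitBumpSlope ((rescale a r w).1 j)) = (∑ i, c i + c j) *
          unitBumpSlope ((rescale a r w).1 j) := by
      intro c
      rw [← Finset.add_sum_erase _ _ (Finset.mem_univ j),
        ← Finset.add_sum_erase (a := j) _ _ (Finset.mem_univ j)]
      have he : ∀ i ∈ Finset.univ.erase j, c i * (doubleAt i j *
          unitBumpSlope ((rescale a r w).1 j)) = c i * unitBumpSlope ((rescale a r w).1 j) := by
        intro i hi
        rw [doubleAt, if_neg (Finset.ne_of_mem_erase hi)]
        simp
      rw [Finset.sum_congr rfl he, doubleAt, if_pos rfl, ← Finset.sum_mul]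
      push_cast
      ring
    rw [he, he] at h
    rw [← h]
    ring
  have hG : ∀ j, cG j = 0 := fun j => by linarith [hp j, hq j]
  -- Summing `hp` over `j` gives `(m + 1) ∑ cF = 0`.
  have hT : ∑ i, cF i + ∑ i, cG i = 0 := by
    have h := Finset.sum_eq_zero fun j (_ : j ∈ Finset.univ) => hp j
    rw [Finset.sum_add_distrib, Finset.sum_const, Finset.card_univ, Fintype.card_fin,
      nsmul_eq_mul] at h
    have hG' : ∑ i, cG i = 0 := Finset.sum_eq_zero fun j _ => hG j
    rw [hG', add_zero] at h ⊢
    have h' : ((m : ℝ) + 1) * ∑ i, cF i = 0 := by linarith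
    exact (mul_eq_zero.1 h').resolve_left (by positivity)
  have hF : ∀ j, cF j = 0 := fun j => by linarith [hp j]
  -- The energy comes last: its slope may vanish, so the energy direction can only be tested once
  -- the other coefficients are gone.
  have h0 : c (.inl ()) = 0 := by
    have h := hc' (0, 0, 1)
    simpa [hF, hG] using h
  rintro (_ | j | j)
  · exact h0
  · exact (mul_eq_zero.1 (hF j)).resolve_right (mul_ne_zero (cubeBump_pos hr hw).ne' hr')
  · exact (mul_eq_zero.1 (hG j)).resolve_right (mul_ne_zero (cubeBump_pos hr hw).ne' hr')

/-- The combinations of `dqₖ` and `dpₖ` do not depend on `j`, because both exponents agree. This is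
the shape required by `poissonForm_coord_eq_zero`. -/
theorem fderiv_cubeFamily_inl (hr : 0 < r) (hw : w ∈ Metric.ball a r) (j : Fin m)
    (d : Transversal m) : fderiv ℝ (cubeFamily a r (.inl j)) w d =
      cubeBump a r (doubleAt j) (doubleAt j) w * r⁻¹ * unitBumpSlope (rescale a r w).2.2 * d.2.2 +
        ∑ k, cubeBump a r (doubleAt j) (doubleAt j) w * r⁻¹ * doubleAt j k *
          (unitBumpSlope ((rescale a r w).1 k) * d.1 k +
            unitBumpSlope ((rescale a r w).2.1 k) * d.2.1 k) := by
  rw [cubeFamily, Sum.elim_inl, fderiv_cubeBump hr hw, mul_add, Finset.mul_sum]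
  congr 1
  · ring
  · exact Finset.sum_congr rfl fun k _ => by ring

end CubeFamily

end GeodesicFlow

/-! ### Smooth weighted sums of countably many functions -/

namespace SmoothFlow

theorem contDiff_mul_of_tsupport_subset {E : Type*} [NormedAddCommGroup E] [NormedSpace ℝ E]
    {Ω : Set E} (hΩ : IsOpen Ω) {χ f : E → ℝ} (hχ : ContDiff ℝ ∞ χ) (hχΩ : tsupport χ ⊆ Ω)
    (hf : ContDiffOn ℝ ∞ f Ω) : ContDiff ℝ ∞ fun x => χ x * f x := by
  rw [contDiff_iff_contDiffAt]
  intro z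
  by_cases hz : z ∈ tsupport χ
  · exact hχ.contDiffAt.mul (hf.contDiffAt (hΩ.mem_nhds (hχΩ hz)))
  · refine (contDiffAt_const (c := (0 : ℝ))).congr_of_eventuallyEq ?_
    filter_upwards [(isClosed_tsupport χ).isOpen_compl.mem_nhds hz] with y hy
    rw [image_eq_zero_of_notMem_tsupport hy, zero_mul]

/-- Countably many smooth functions on an open set can be rescaled so that their sum is smooth. -/
theorem exists_pos_contDiffOn_tsum {E : Type*} [NormedAddCommGroup E] [NormedSpace ℝ E]
    [FiniteDimensional ℝ E] {Ω : Set E} (hΩ : IsOpen Ω) {κ ι : Type*} [Countable κ] [Fintype ι]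
    {f : κ → ι → E → ℝ} (hf : ∀ c l, ContDiffOn ℝ ∞ (f c l) Ω) :
    ∃ ε : κ → ℝ, (∀ c, 0 < ε c) ∧ ∀ l, ContDiffOn ℝ ∞ (fun z => ∑' c, ε c * f c l z) Ω := by
  have := Encodable.ofCountable κ
  -- Derivatives of the `f c l` need not be bounded on `Ω`. Multiplying by a cut-off bounds each of
  -- them, and countably many cut-offs suffice by Lindelöf.
  have hbump : ∀ z : Ω, ∃ χ : E → ℝ, tsupport χ ⊆ Ω ∧ HasCompactSupport χ ∧ ContDiff ℝ ∞ χ ∧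
      χ z = 1 := fun z => by
    obtain ⟨χ, h1, h2, h3, -, h4⟩ := exists_contDiff_tsupport_subset (n := ⊤) (hΩ.mem_nhds z.2)
    exact ⟨χ, h1, h2, h3, h4⟩
  choose χ hχΩ hχc hχ hχ1 using hbump
  obtain ⟨T, hTc, hT⟩ := TopologicalSpace.isOpen_iUnion_countable
    (fun z : Ω => {y | χ z y ≠ 0}) fun z => isOpen_ne_fun (hχ z).continuous continuous_const
  have := hTc.to_subtype
  have := Encodable.ofCountable T
  have hsm : ∀ (z : Ω) c l, ContDiff ℝ ∞ fun x => χ z x * f c l x := fun z c l =>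
    contDiff_mul_of_tsupport_subset hΩ (hχ z) (hχΩ z) (hf c l)
  have hbd : ∀ c l z (k : ℕ), ∃ A, 0 ≤ A ∧
      ∀ x, ‖iteratedFDeriv ℝ k (fun x => χ z x * f c l x) x‖ ≤ A := by
    intro c l z k
    have hcs : HasCompactSupport fun x => χ z x * f c l x := (hχc z).mul_right
    obtain ⟨A, hA⟩ := ((hsm z c l).continuous_iteratedFDeriv
      (m := k) (by exact_mod_cast le_top)).bounded_above_of_compact_support
        (hcs.iteratedFDeriv (𝕜 := ℝ) k)
    exact ⟨A, (norm_nonneg _).trans (hA 0), hA⟩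
  choose A hA0 hA using hbd
  let B : κ → ℕ → ℕ → ℝ := fun c i k => match Encodable.decode (α := T) i with
    | none => 0
    | some z => ∑ l, A c l z k
  have hB0 : ∀ c i k, 0 ≤ B c i k := by
    intro c i k
    simp only [B]
    split
    · exact le_rfl
    · exact Finset.sum_nonneg fun l _ => hA0 _ _ _ _
  -- A diagonal choice: `M c` controls the derivatives of order at most `encode c` for the cut-offs
  -- of index at most `encode c`. For a fixed order and cut-off this covers all but finitely many
  -- `c`, which is all that smooth summation needs.
  let M : κ → ℝ := fun c => 1 + ∑ i ∈ Finset.range (Encodable.encode c + 1),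
    ∑ k ∈ Finset.range (Encodable.encode c + 1), B c i k
  have hM : ∀ c, 0 < M c := fun c => add_pos_of_pos_of_nonneg one_pos
    (Finset.sum_nonneg fun i _ => Finset.sum_nonneg fun k _ => hB0 c i k)
  have hAM : ∀ c l (z : T) k, Encodable.encode z ≤ Encodable.encode c → k ≤ Encodable.encode c →
      A c l z k ≤ M c := by
    intro c l z k hz hk
    calc A c l z k ≤ ∑ l, A c l z k :=
          Finset.single_le_sum (f := fun l => A c l z k) (fun l _ => hA0 _ _ _ _)
            (Finset.mem_univ l)
      _ = B c (Encodable.encode z) k := by simp only [B, Encodable.encodek]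
      _ ≤ ∑ k ∈ Finset.range (Encodable.encode c + 1), B c (Encodable.encode z) k :=
          Finset.single_le_sum (f := fun k => B c (Encodable.encode z) k) (fun k _ => hB0 _ _ _)
            (Finset.mem_range_succ_iff.2 hk)
      _ ≤ ∑ i ∈ Finset.range (Encodable.encode c + 1),
            ∑ k ∈ Finset.range (Encodable.encode c + 1), B c i k :=
          Finset.single_le_sum (f := fun i => ∑ k ∈ Finset.range (Encodable.encode c + 1), B c i k)
            (fun i _ => Finset.sum_nonneg fun k _ => hB0 _ _ _) (Finset.mem_range_succ_iff.2 hz)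
      _ ≤ M c := le_add_of_nonneg_left one_pos.le
  refine ⟨fun c => (1 / 2) ^ Encodable.encode c / M c,
    fun c => div_pos (by positivity) (hM c), fun l z hz => ?_⟩
  have hzT : z ∈ ⋃ y ∈ T, {x | χ y x ≠ 0} := by
    rw [hT]
    exact mem_iUnion.2 ⟨⟨z, hz⟩, by simp [hχ1 ⟨z, hz⟩]⟩
  obtain ⟨y, hy, hyz⟩ := mem_iUnion₂.1 hzT
  have hsum : ContDiff ℝ ∞ fun x => ∑' c,
      ((1 / 2) ^ Encodable.encode c / M c) • (χ y x * f c l x) := by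
    refine contDiff_tsum_of_eventually (v := fun _ c => (1 / 2 : ℝ) ^ Encodable.encode c)
      (fun c => (hsm y c l).const_smul _) (fun k _ => summable_geometric_two_encode) fun k _ => ?_
    have hfin : {c : κ | Encodable.encode c < max k (Encodable.encode (⟨y, hy⟩ : T))}.Finite :=
      (finite_Iio _).preimage Encodable.encode_injective.injOn
    filter_upwards [hfin.compl_mem_cofinite] with c hc x
    have hc' : max k (Encodable.encode (⟨y, hy⟩ : T)) ≤ Encodable.encode c := not_lt.1 hc
    rw [iteratedFDeriv_const_smul_apply' ((hsm y c l).contDiffAt.of_le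
      (by exact_mod_cast le_top)), norm_smul, Real.norm_of_nonneg
      (div_nonneg (by positivity) (hM c).le), div_mul_eq_mul_div, div_le_iff₀ (hM c)]
    exact mul_le_mul_of_nonneg_left ((hA c l y k x).trans (hAM c l ⟨y, hy⟩ k
      ((le_max_right _ _).trans hc') ((le_max_left _ _).trans hc'))) (by positivity)
  -- Near `z` the cut-off is nonzero and can be divided out.
  refine ContDiffAt.contDiffWithinAt ?_
  refine (hsum.contDiffAt.div (hχ y).contDiffAt hyz).congr_of_eventuallyEq ?_
  filter_upwards [(isOpen_ne_fun (hχ y).continuous continuous_const).mem_nhds hyz] with x hx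
  rw [Pi.div_apply, eq_div_iff hx, ← tsum_mul_right]
  exact tsum_congr fun c => by rw [smul_eq_mul]; ring

end SmoothFlow

/-! ### Disjoint cells filling the orbit space almost everywhere -/

namespace GeodesicFlow

open SmoothFlow

variable {m : ℕ} {g : MetricTensor (m + 1)} {D : Set (Coord (m + 1))}

/-- A closed cube in the range of a chart of the orbit space. -/
structure OrbitCell (g : MetricTensor (m + 1)) (D : Set (Coord (m + 1))) where
  /-- the chart -/
  chart : OrbitChart g D
  /-- the centre of the cube -/
  center : Transversal m
  /-- half of the side of the cube -/
  radius : ℝ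
  radius_pos : 0 < radius
  closedBall_subset : Metric.closedBall center radius ⊆ chart.box

namespace OrbitCell

/-- The union of the orbits with coordinates in the interior of the cube. -/
def region (c : OrbitCell g D) : Set (Phase (m + 1)) :=
  c.chart.saturation (Metric.ball c.center c.radius)

/-- The union of the orbits with coordinates in the closed cube. -/
def closedRegion (c : OrbitCell g D) : Set (Phase (m + 1)) :=
  c.chart.saturation (Metric.closedBall c.center c.radius)

/-- The interior of the cube without the coordinate hyperplanes through its centre. -/
def regularBall (a : Transversal m) (r : ℝ) : Set (Transversal m) :=
  {w | w ∈ Metric.ball a r ∧ (∀ k, w.1 k ≠ a.1 k) ∧ ∀ k, w.2.1 k ≠ a.2.1 k}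

/-- The union of the orbits with coordinates in `regularBall`. -/
def regularRegion (c : OrbitCell g D) : Set (Phase (m + 1)) :=
  c.chart.saturation (regularBall c.center c.radius)

variable {c : OrbitCell g D}

theorem region_subset_closedRegion : c.region ⊆ c.closedRegion :=
  OrbitChart.saturation_mono Metric.ball_subset_closedBall

theorem notMem_closure_closedRegion (hD : IsOpen D) (hconv : g.IsGeodesicallyConvex D)
    {z : Phase (m + 1)} (hz : z ∈ cotangent D) (h : z ∉ c.closedRegion) :
    z ∉ closure c.closedRegion := fun h' =>
  h (OrbitChart.mem_saturation_of_mem_closure hD hconv (isCompact_closedBall _ _)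
    c.closedBall_subset hz h')

theorem volume_fiber_eq_zero {E : Type*} [NormedAddCommGroup E] [NormedSpace ℝ E]
    [FiniteDimensional ℝ E] [MeasurableSpace E] [BorelSpace E] (μ : Measure E)
    [μ.IsAddHaarMeasure] {L : E →ₗ[ℝ] ℝ} (hL : Function.Surjective L) (s : ℝ) :
    μ {z | L z = s} = 0 := by
  have h := (ae_comp_linearMap_mem_iff L μ (volume : Measure ℝ) hL
    (measurableSet_singleton s).compl).2 (by
      rw [ae_iff]
      simp)
  rw [ae_iff] at h
  simpa using h

theorem volume_ball_diff_regularBall {a : Transversal m} {r : ℝ} (hr : 0 < r) :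
    volume (Metric.closedBall a r \ regularBall a r) = 0 := by
  have hq : ∀ k, volume {w : Transversal m | w.1 k = a.1 k} = 0 := fun k =>
    volume_fiber_eq_zero (volume : Measure (Transversal m))
      (L := (LinearMap.proj k).comp (.fst ℝ (Fin m → ℝ) ((Fin m → ℝ) × ℝ)))
      (fun s => ⟨(fun _ => s, 0), rfl⟩) _
  have hp : ∀ k, volume {w : Transversal m | w.2.1 k = a.2.1 k} = 0 := fun k =>
    volume_fiber_eq_zero (volume : Measure (Transversal m))
      (L := (LinearMap.proj k).comp ((LinearMap.fst ℝ (Fin m → ℝ) ℝ).comp (.snd ℝ (Fin m → ℝ) ((Fin m → ℝ) × ℝ))))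
      (fun s => ⟨(0, fun _ => s, 0), rfl⟩) _
  refine measure_mono_null (t := Metric.sphere a r ∪ ((⋃ k, {w : Transversal m | w.1 k = a.1 k}) ∪
    ⋃ k, {w : Transversal m | w.2.1 k = a.2.1 k})) ?_ ?_
  · rintro w ⟨hw, hw'⟩
    by_contra hn
    simp only [mem_union, mem_iUnion, mem_ofPred_eq, not_or, not_exists] at hn
    exact hw' ⟨lt_of_le_of_ne hw hn.1, hn.2.1, hn.2.2⟩
  · rw [measure_union_null_iff, measure_union_null_iff, measure_iUnion_null_iff,
      measure_iUnion_null_iff]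
    exact ⟨Measure.addHaar_sphere_of_ne_zero _ _ hr.ne', hq, hp⟩

theorem exists_mem_region (hD : IsOpen D) (hconv : g.IsGeodesicallyConvex D) {z : Phase (m + 1)}
    (hz : z ∈ cotangent D) (hp : z.2 ≠ 0) : ∃ c : OrbitCell g D, z ∈ c.region := by
  obtain ⟨C, hC⟩ := exists_orbitChart hD hconv hz hp
  obtain ⟨r, hr, hrC⟩ := Metric.nhds_basis_closedBall.mem_iff.1
    (C.isOpen_box.mem_nhds (C.coord_mem z hC))
  refine ⟨⟨C, C.coord z, r, hr, hrC⟩, ?_⟩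
  obtain ⟨t, ht⟩ := OrbitChart.flowsTo_point hC
  exact ⟨_, Metric.mem_ball_self hr, C.coord_mem z hC, t, ht⟩

theorem exists_seq_region (hD : IsOpen D) (hconv : g.IsGeodesicallyConvex D)
    [Nonempty (OrbitCell g D)] :
    ∃ c : ℕ → OrbitCell g D, ∀ z ∈ cotangent D, z.2 ≠ 0 → ∃ k, z ∈ (c k).region := by
  obtain ⟨T, hTc, hT⟩ := TopologicalSpace.isOpen_iUnion_countable
    (fun c : OrbitCell g D => c.region) fun c =>
      OrbitChart.isOpen_saturation hD Metric.isOpen_ball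
  obtain ⟨c₀⟩ := ‹Nonempty (OrbitCell g D)›
  obtain ⟨c, hc⟩ := (hTc.insert c₀).exists_eq_range (insert_nonempty _ _)
  refine ⟨c, fun z hz hp => ?_⟩
  have hzT : z ∈ ⋃ c ∈ T, region c := by
    rw [hT]
    exact mem_iUnion.2 (exists_mem_region hD hconv hz hp)
  obtain ⟨d, hd, hzd⟩ := mem_iUnion₂.1 hzT
  have : d ∈ range c := hc ▸ mem_insert_of_mem _ hd
  obtain ⟨k, rfl⟩ := this
  exact ⟨k, hzd⟩

/-- Almost every orbit lies in one of countably many disjoint cells. -/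
theorem exists_disjoint_cells (hD : IsOpen D) (hconv : g.IsGeodesicallyConvex D) :
    ∃ 𝒞 : Set (OrbitCell g D), 𝒞.Countable ∧ 𝒞.PairwiseDisjoint region ∧
      ∀ᵐ z : Phase (m + 1), z ∈ cotangent D → ∃ c ∈ 𝒞, z ∈ c.regularRegion := by
  have hzero : volume {z : Phase (m + 1) | z.2 = 0} = 0 :=
    measure_mono_null (fun z (hz : z.2 = 0) => congrFun hz 0)
      (volume_fiber_eq_zero (volume : Measure (Phase (m + 1)))
        (L := (LinearMap.proj 0).comp (.snd ℝ (Coord (m + 1)) (Coord (m + 1))))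
        (fun s => ⟨(0, fun _ => s), rfl⟩) 0)
  -- Without cells, all of `T*D` would lie in the zero section, which is null.
  rcases isEmpty_or_nonempty (OrbitCell g D) with hem | hne
  · refine ⟨∅, countable_empty, pairwiseDisjoint_empty, ?_⟩
    filter_upwards [measure_eq_zero_iff_ae_notMem.1 hzero] with z hz hzD
    obtain ⟨c, -⟩ := exists_mem_region hD hconv hzD hz
    exact hem.elim c
  obtain ⟨c, hc⟩ := exists_seq_region hD hconv
  -- The part of the `k`-th cube whose section points avoid the closures of all earlier closed
  -- regions. It is open, and cells cut from different `W k` have no common orbit.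
  let W : ℕ → Set (Transversal m) := fun k => Metric.ball (c k).center (c k).radius ∩
    (c k).chart.point ⁻¹' ⋂ j ∈ Iio k, (closure (c j).closedRegion)ᶜ
  have hball : ∀ k, Metric.ball (c k).center (c k).radius ⊆ (c k).chart.box := fun k =>
    Metric.ball_subset_closedBall.trans (c k).closedBall_subset
  have hWo : ∀ k, IsOpen (W k) := fun k =>
    ((c k).chart.contDiffOn_point.continuousOn.mono (hball k)).isOpen_inter_preimage
      Metric.isOpen_ball ((finite_Iio k).isOpen_biInter fun j _ => isClosed_closure.isOpen_compl)
  -- Besicovitch's theorem packs `W k` with disjoint closed cubes up to a null set.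
  have hcov : ∀ k, ∃ (t : Set (Transversal m)) (ρ : Transversal m → ℝ), t.Countable ∧
      (∀ x ∈ t, 0 < ρ x ∧ Metric.closedBall x (ρ x) ⊆ W k) ∧
      volume (W k \ ⋃ x ∈ t, Metric.closedBall x (ρ x)) = 0 ∧
      t.PairwiseDisjoint fun x => Metric.closedBall x (ρ x) := by
    intro k
    obtain ⟨t, ρ, htc, -, hρ, hnull, hdis⟩ := Besicovitch.exists_disjoint_closedBall_covering_ae
      (volume : Measure (Transversal m)) (fun x => {r | Metric.closedBall x r ⊆ W k}) (W k)
      (fun x hx δ hδ => by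
        obtain ⟨r, hr, hrW⟩ := Metric.nhds_basis_closedBall.mem_iff.1 ((hWo k).mem_nhds hx)
        exact ⟨min r (δ / 2), (Metric.closedBall_subset_closedBall (min_le_left _ _)).trans hrW,
          lt_min hr (half_pos hδ), (min_le_right _ _).trans_lt (half_lt_self hδ)⟩)
      (fun _ => 1) (fun _ _ => one_pos)
    exact ⟨t, ρ, htc, fun x hx => ⟨(hρ x hx).2.1, (hρ x hx).1⟩, hnull, hdis⟩
  choose t ρ htc hρ hnull hdis using hcov
  have hWbox : ∀ k, W k ⊆ (c k).chart.box := fun k => inter_subset_left.trans (hball k)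
  let cell : (k : ℕ) → t k → OrbitCell g D := fun k x =>
    ⟨(c k).chart, x, ρ k x, (hρ k x x.2).1, (hρ k x x.2).2.trans (hWbox k)⟩
  have hlt : ∀ {k k'} (x : t k) (x' : t k') {z}, z ∈ (cell k x).region → z ∈ (cell k' x').region →
      ¬k < k' := by
    rintro k k' x x' z ⟨w, hw, hb, s, hs⟩ ⟨w', hw', hb', s', hs'⟩ hkk
    have h1 : z ∈ (c k).closedRegion := ⟨w, Metric.ball_subset_closedBall
      ((hρ k x x.2).2 (Metric.ball_subset_closedBall hw)).1, hb, s, hs⟩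
    have h2 : (c k').chart.point w' ∈ (c k).closedRegion :=
      OrbitChart.mem_saturation_of_flowsTo (hs'.symm g.contDiff_field) h1
    exact mem_iInter₂.1 ((hρ k' x' x'.2).2 (Metric.ball_subset_closedBall hw')).2 k hkk
      (subset_closure h2)
  refine ⟨⋃ k, range (cell k), countable_iUnion fun k => ?_, ?_, ?_⟩
  · have := (htc k).to_subtype
    exact countable_range _
  · rintro _ hd _ hd' hne
    obtain ⟨k, x, rfl⟩ := mem_iUnion.1 hd
    obtain ⟨k', x', rfl⟩ := mem_iUnion.1 hd'
    rw [Function.onFun, Set.disjoint_left]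
    intro z hz hz'
    obtain rfl : k = k' := le_antisymm (not_lt.1 (hlt x' x hz' hz)) (not_lt.1 (hlt x x' hz hz'))
    have hxx : (x : Transversal m) ≠ x' := fun h => hne (by rw [Subtype.ext h])
    obtain ⟨w, hw, hb, s, hs⟩ := hz
    obtain ⟨w', hw', hb', s', hs'⟩ := hz'
    obtain rfl := OrbitChart.coordinates_unique hb hb' hs hs'
    exact Set.disjoint_left.1 (hdis k x.2 x'.2 hxx) (Metric.ball_subset_closedBall hw)
      (Metric.ball_subset_closedBall hw')
  -- The coordinates lost in the `k`-th cube: its boundary, the part of `W k` missed by the packing,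
  -- and the boundaries and central hyperplanes of the packed cubes. The orbits over this null set
  -- are null.
  · let B : ℕ → Set (Transversal m) := fun k =>
      Metric.sphere (c k).center (c k).radius ∪ ((W k \ ⋃ x ∈ t k, Metric.closedBall x (ρ k x)) ∪
        ⋃ x ∈ t k, (Metric.closedBall x (ρ k x) \ regularBall x (ρ k x)))
    have hB : ∀ k, volume ((c k).chart.saturation (B k)) = 0 := by
      intro k
      refine OrbitChart.volume_saturation_eq_zero hD ?_
      rw [measure_union_null_iff, measure_union_null_iff, measure_biUnion_null_iff (htc k)]
      exact ⟨Measure.addHaar_sphere_of_ne_zero _ _ (c k).radius_pos.ne', hnull k,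
        fun x hx => volume_ball_diff_regularBall (hρ k x hx).1⟩
    filter_upwards [measure_eq_zero_iff_ae_notMem.1 hzero,
      ae_all_iff.2 fun k => measure_eq_zero_iff_ae_notMem.1 (hB k)] with z hz hzB hzD
    classical
    -- For the first closed region that contains `z`, the coordinates of `z` lie in `W k` or on the
    -- boundary sphere, and the sphere belongs to `B k`.
    have hex : ∃ k, z ∈ (c k).closedRegion := by
      obtain ⟨k, hk⟩ := hc z hzD hz
      exact ⟨k, region_subset_closedRegion hk⟩
    obtain ⟨w, hw, hb, s, hs⟩ := Nat.find_spec hex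
    have hmin : ∀ j < Nat.find hex, z ∉ (c j).closedRegion := fun j hj => Nat.find_min hex hj
    set k := Nat.find hex
    have hwB : w ∉ B k := fun h => hzB k ⟨w, h, hb, s, hs⟩
    simp only [B, mem_union, Set.mem_sdiff, mem_iUnion, not_or, not_and, not_exists, not_not,
      exists_prop] at hwB
    have hwW : w ∈ W k := by
      refine ⟨lt_of_le_of_ne hw hwB.1, mem_iInter₂.2 fun j hj => ?_⟩
      refine notMem_closure_closedRegion hD hconv (OrbitChart.point_mem_cotangent hb) fun h => ?_
      exact hmin j hj (OrbitChart.mem_saturation_of_flowsTo hs h)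
    obtain ⟨x, hx, hwx⟩ : ∃ x ∈ t k, w ∈ Metric.closedBall x (ρ k x) := by
      by_contra! hn
      exact hwB.2.1 hwW hn
    exact ⟨cell k ⟨x, hx⟩, mem_iUnion.2 ⟨k, mem_range_self _⟩, w, hwB.2.2 x hx hwx, hb, s, hs⟩

end OrbitCell

end GeodesicFlow

/-! ### Global integrals: involution and independence -/

namespace GeodesicFlow

open SmoothFlow

/-- Pulling covectors back along a surjection is injective. This transfers independence from the
cube to the section, and from there along the orbits. -/
theorem linearIndependent_comp_of_surjective {ι X Y : Type*} [NormedAddCommGroup X]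
    [NormedSpace ℝ X] [NormedAddCommGroup Y] [NormedSpace ℝ Y] {v : ι → Y →L[ℝ] ℝ}
    (hv : LinearIndependent ℝ v) {T : X →L[ℝ] Y} (hT : Function.Surjective T)
    {u : ι → X →L[ℝ] ℝ} (hu : ∀ i, u i = (v i).comp T) : LinearIndependent ℝ u := by
  rw [funext hu]
  let P : (Y →L[ℝ] ℝ) →ₗ[ℝ] X →L[ℝ] ℝ :=
    { toFun := fun L => L.comp T
      map_add' := fun L L' => ContinuousLinearMap.add_comp L L' T
      map_smul' := fun r L => ContinuousLinearMap.smul_comp r L T }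
  refine hv.map' P (LinearMap.ker_eq_bot.2 fun L L' h => ?_)
  refine ContinuousLinearMap.ext fun y => ?_
  obtain ⟨x, rfl⟩ := hT y
  exact congrArg (fun L : X →L[ℝ] ℝ => L x) h

variable {m : ℕ} {g : MetricTensor (m + 1)} {D : Set (Coord (m + 1))}

namespace OrbitCell

variable (c : OrbitCell g D)

/-- The invariant functions of a cell. -/
noncomputable def integral (l : Fin m ⊕ Fin m) : Phase (m + 1) → ℝ :=
  c.chart.lift (cubeFamily c.center c.radius l)

variable {c}

theorem integral_nonneg (l : Fin m ⊕ Fin m) (z : Phase (m + 1)) : 0 ≤ c.integral l z :=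
  OrbitChart.lift_nonneg (cubeFamily_nonneg l) z

theorem integral_eq_zero (l : Fin m ⊕ Fin m) {z : Phase (m + 1)} (hz : z ∉ c.region) :
    c.integral l z = 0 :=
  OrbitChart.lift_eq_zero_of_not_mem (fun _ hw => cubeFamily_eq_zero c.radius_pos l hw) hz

theorem contDiffOn_integral (hD : IsOpen D) (hconv : g.IsGeodesicallyConvex D)
    (l : Fin m ⊕ Fin m) : ContDiffOn ℝ ∞ (c.integral l) (cotangent D) :=
  OrbitChart.contDiffOn_lift hD hconv (contDiff_cubeFamily l) (isCompact_closedBall _ _)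
    c.closedBall_subset fun _ hw => cubeFamily_eq_zero c.radius_pos l fun h =>
      hw (Metric.ball_subset_closedBall h)

theorem mem_box {w : Transversal m} (hw : w ∈ Metric.ball c.center c.radius) : w ∈ c.chart.box :=
  c.closedBall_subset (Metric.ball_subset_closedBall hw)

theorem point_mem_region {w : Transversal m} (hw : w ∈ Metric.ball c.center c.radius) :
    c.chart.point w ∈ c.region :=
  ⟨w, hw, mem_box hw, 0, FlowsTo.refl (OrbitChart.point_mem_cotangent (mem_box hw))⟩

theorem fderiv_integral_point (l : Fin m ⊕ Fin m) {w : Transversal m}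
    (hw : w ∈ Metric.ball c.center c.radius) : fderiv ℝ (c.integral l) (c.chart.point w) =
      (fderiv ℝ (cubeFamily c.center c.radius l) w).comp
        (fderiv ℝ c.chart.coord (c.chart.point w)) :=
  OrbitChart.fderiv_lift_point (mem_box hw) ((contDiff_cubeFamily l).differentiable (by simp) w)

end OrbitCell

section Global

variable (𝒞 : Set (OrbitCell g D)) (ε : 𝒞 → ℝ)

/-- The energy and the weighted sums of the invariant functions of the cells. -/
noncomputable def globalIntegral : Unit ⊕ (Fin m ⊕ Fin m) → Phase (m + 1) → ℝ :=
  Sum.elim (fun _ => g.hamiltonian) fun l z => ∑' c : 𝒞, ε c * c.1.integral l z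

variable {𝒞 ε}

theorem globalIntegral_eq_of_mem (hdis : 𝒞.PairwiseDisjoint OrbitCell.region) {c : 𝒞}
    {z : Phase (m + 1)} (hz : z ∈ c.1.region) (l : Fin m ⊕ Fin m) :
    globalIntegral 𝒞 ε (.inr l) z = ε c * c.1.integral l z := by
  refine tsum_eq_single c fun c' hc' => ?_
  rw [OrbitCell.integral_eq_zero l fun hz' => Set.disjoint_left.1
    (hdis c'.2 c.2 fun h => hc' (Subtype.ext h)) hz' hz, mul_zero]

theorem globalIntegral_eq_of_flowsTo (i : Unit ⊕ (Fin m ⊕ Fin m)) {t : ℝ} {z z' : Phase (m + 1)}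
    (h : FlowsTo g.field (cotangent D) t z z') :
    globalIntegral 𝒞 ε i z = globalIntegral 𝒞 ε i z' := by
  rcases i with _ | l
  · exact hamiltonian_eq_of_flowsTo h
  · exact tsum_congr fun c => by
      rw [OrbitCell.integral, OrbitChart.lift_eq_of_flowsTo h]

theorem contDiffOn_globalIntegral
    (hε : ∀ l, ContDiffOn ℝ ∞ (fun z => ∑' c : 𝒞, ε c * c.1.integral l z) (cotangent D))
    (i : Unit ⊕ (Fin m ⊕ Fin m)) : ContDiffOn ℝ ∞ (globalIntegral 𝒞 ε i) (cotangent D) := by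
  rcases i with _ | l
  · exact g.contDiff_hamiltonian.contDiffOn
  · exact hε l

theorem fderiv_globalIntegral_field (hD : IsOpen D)
    (hε : ∀ l, ContDiffOn ℝ ∞ (fun z => ∑' c : 𝒞, ε c * c.1.integral l z) (cotangent D))
    (i : Unit ⊕ (Fin m ⊕ Fin m)) {z : Phase (m + 1)} (hz : z ∈ cotangent D) :
    fderiv ℝ (globalIntegral 𝒞 ε i) z (g.field z) = 0 :=
  fderiv_field_eq_zero g.contDiff_field (isOpen_cotangent hD) hz
    ((isOpen_cotangent hD).mem_nhds hz) (((contDiffOn_globalIntegral hε i).contDiffAt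
      ((isOpen_cotangent hD).mem_nhds hz)).differentiableAt (by simp))
    fun _ _ _ h => globalIntegral_eq_of_flowsTo i h

theorem isSmoothIntegral_globalIntegral (hD : IsOpen D)
    (hε : ∀ l, ContDiffOn ℝ ∞ (fun z => ∑' c : 𝒞, ε c * c.1.integral l z) (cotangent D))
    (i : Unit ⊕ (Fin m ⊕ Fin m)) : g.IsSmoothIntegral D (globalIntegral 𝒞 ε i) :=
  ⟨contDiffOn_globalIntegral hε i, fun z hz => by
    rw [g.poissonBracket_hamiltonian, fderiv_globalIntegral_field hD hε i hz, neg_zero]⟩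

theorem fderiv_globalIntegral_point (hD : IsOpen D) (hdis : 𝒞.PairwiseDisjoint OrbitCell.region)
    {c : 𝒞} {w : Transversal m} (hw : w ∈ Metric.ball c.1.center c.1.radius)
    (l : Fin m ⊕ Fin m) : fderiv ℝ (globalIntegral 𝒞 ε (.inr l)) (c.1.chart.point w) =
      (ε c • fderiv ℝ (cubeFamily c.1.center c.1.radius l) w).comp
        (fderiv ℝ c.1.chart.coord (c.1.chart.point w)) := by
  have he : globalIntegral 𝒞 ε (.inr l) =ᶠ[𝓝 (c.1.chart.point w)] ε c • c.1.integral l := by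
    filter_upwards [(OrbitChart.isOpen_saturation hD Metric.isOpen_ball).mem_nhds
      (OrbitCell.point_mem_region hw)] with z hz using globalIntegral_eq_of_mem hdis hz l
  rw [he.fderiv_eq, fderiv_const_smul_field, Pi.smul_apply,
    OrbitCell.fderiv_integral_point l hw, ContinuousLinearMap.smul_comp]

/-- The function is nonnegative and vanishes at `z`, so `z` is a minimum. No control over how cells
accumulate at `z` is needed. -/
theorem fderiv_globalIntegral_eq_zero (hε₀ : ∀ c, 0 < ε c) {z : Phase (m + 1)}
    (hz : ∀ c : 𝒞, z ∉ c.1.region) (l : Fin m ⊕ Fin m) :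
    fderiv ℝ (globalIntegral 𝒞 ε (.inr l)) z = 0 := by
  have h0 : globalIntegral 𝒞 ε (.inr l) z = 0 := by
    refine (tsum_congr fun c => ?_).trans tsum_zero
    rw [OrbitCell.integral_eq_zero l (hz c), mul_zero]
  refine IsLocalMin.fderiv_eq_zero (Eventually.of_forall fun z' => ?_)
  rw [h0]
  exact tsum_nonneg fun c => mul_nonneg (hε₀ c).le (OrbitCell.integral_nonneg l z')

theorem poissonBracket_globalIntegral_point (hD : IsOpen D)
    (hdis : 𝒞.PairwiseDisjoint OrbitCell.region) {c : 𝒞} {w : Transversal m}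
    (hw : w ∈ Metric.ball c.1.center c.1.radius) (j k : Fin m) :
    poissonBracket (globalIntegral 𝒞 ε (.inr (.inl j))) (globalIntegral 𝒞 ε (.inr (.inl k)))
      (c.1.chart.point w) = 0 := by
  rw [poissonBracket_eq_poissonForm, fderiv_globalIntegral_point hD hdis hw,
    fderiv_globalIntegral_point hD hdis hw, ContinuousLinearMap.smul_comp,
    ContinuousLinearMap.smul_comp, map_smul, map_smul, LinearMap.smul_apply,
    OrbitChart.poissonForm_coord_eq_zero hD (OrbitCell.mem_box hw)
      (fderiv_cubeFamily_inl c.1.radius_pos hw j) (fderiv_cubeFamily_inl c.1.radius_pos hw k)]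
  simp

/-- Inside a cell the bracket is constant along orbits, so it equals its value at the section point,
which is zero. Outside all cells the differentials themselves vanish. -/
theorem poissonBracket_globalIntegral (hD : IsOpen D) (hε₀ : ∀ c, 0 < ε c)
    (hε : ∀ l, ContDiffOn ℝ ∞ (fun z => ∑' c : 𝒞, ε c * c.1.integral l z) (cotangent D))
    (hdis : 𝒞.PairwiseDisjoint OrbitCell.region) (i i' : Unit ⊕ Fin m) {z : Phase (m + 1)}
    (hz : z ∈ cotangent D) : poissonBracket (globalIntegral 𝒞 ε (i.map id .inl))
      (globalIntegral 𝒞 ε (i'.map id .inl)) z = 0 := by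
  rcases i' with _ | k
  · exact (isSmoothIntegral_globalIntegral hD hε _).2 z hz
  rcases i with _ | j
  · rw [poissonBracket_eq_poissonForm, poissonForm_neg_swap, neg_eq_zero]
    exact (isSmoothIntegral_globalIntegral hD hε (.inr (.inl k))).2 z hz
  simp only [Sum.map_inr]
  by_cases hex : ∃ c : 𝒞, z ∈ c.1.region
  · obtain ⟨c, w, hw, hb, t, ht⟩ := hex
    have hS := isOpen_cotangent hD
    have hF := fun i => contDiffOn_globalIntegral (i := i) hε
    rw [← eq_of_flowsTo (f := poissonBracket (globalIntegral 𝒞 ε (.inr (.inl j)))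
      (globalIntegral 𝒞 ε (.inr (.inl k))))
      (fun y hy => (hasFDerivAt_poissonBracket ((hF _).contDiffAt (hS.mem_nhds hy))
        ((hF _).contDiffAt (hS.mem_nhds hy))).1)
      (fun y hy => fderiv_poissonBracket_field hS (hF _) (hF _)
        (fun y hy => fderiv_globalIntegral_field hD hε _ hy)
        (fun y hy => fderiv_globalIntegral_field hD hε _ hy) hy) ht]
    exact poissonBracket_globalIntegral_point hD hdis hw j k
  · push Not at hex
    rw [poissonBracket_eq_poissonForm, fderiv_globalIntegral_eq_zero hε₀ hex, map_zero]
    rfl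

theorem linearIndependent_fderiv_globalIntegral (hD : IsOpen D) (hε₀ : ∀ c, 0 < ε c)
    (hε : ∀ l, ContDiffOn ℝ ∞ (fun z => ∑' c : 𝒞, ε c * c.1.integral l z) (cotangent D))
    (hdis : 𝒞.PairwiseDisjoint OrbitCell.region) {c : 𝒞} {z : Phase (m + 1)}
    (hz : z ∈ c.1.regularRegion) :
    LinearIndependent ℝ fun i => fderiv ℝ (globalIntegral 𝒞 ε i) z := by
  obtain ⟨w, ⟨hw, hq, hp⟩, hb, t, ht⟩ := hz
  have hcell := (linearIndependent_cubeFamily c.1.radius_pos hw hq hp).units_smul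
    (Sum.elim (fun _ => (1 : ℝˣ)) fun _ => Units.mk0 (ε c) (hε₀ c).ne')
  have hpoint : LinearIndependent ℝ fun i => fderiv ℝ (globalIntegral 𝒞 ε i)
      (c.1.chart.point w) := by
    refine linearIndependent_comp_of_surjective hcell (OrbitChart.surjective_fderiv_coord hb)
      fun i => ?_
    rcases i with _ | l
    · simp only [Pi.smul_apply', Sum.elim_inl, one_smul]
      exact OrbitChart.fderiv_hamiltonian_point hb
    · exact fderiv_globalIntegral_point hD hdis hw l
  -- The flow map `ψ` carries `z` to the section point and preserves every integral near `z`. Its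
  -- inverse `θ` shows that its derivative is onto, so independence passes from the section point to
  -- `z`.
  obtain ⟨ψ, hψ, hψz, hev, θ, hθ, hψθ, hθψ⟩ := OrbitChart.exists_local_coordinates hD hb ht
  have hψd : HasFDerivAt ψ (fderiv ℝ ψ z) z := (hψ.differentiable (by simp) z).hasFDerivAt
  have hsurj : Function.Surjective (fderiv ℝ ψ z) := by
    have h1 : HasFDerivAt ψ (fderiv ℝ ψ z) (θ (ψ z)) := by rwa [hθψ]
    have h2 := h1.comp (ψ z) (hθ (ψ z)).hasFDerivAt
    have h3 : ψ ∘ θ = id := funext hψθ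
    rw [h3] at h2
    exact fun d => ⟨_, congrArg (fun L => L d) (h2.unique (hasFDerivAt_id _))⟩
  refine linearIndependent_comp_of_surjective hpoint hsurj fun i => ?_
  have he : globalIntegral 𝒞 ε i =ᶠ[𝓝 z] globalIntegral 𝒞 ε i ∘ ψ := by
    filter_upwards [hev] with z' hz'
    obtain ⟨-, -, s, hs⟩ := hz'
    exact globalIntegral_eq_of_flowsTo i hs
  have hd : DifferentiableAt ℝ (globalIntegral 𝒞 ε i) (ψ z) :=
    ((contDiffOn_globalIntegral hε i).contDiffAt ((isOpen_cotangent hD).mem_nhds (by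
      rw [hψz]
      exact OrbitChart.point_mem_cotangent hb))).differentiableAt (by simp)
  rw [he.fderiv_eq, fderiv_comp z hd hψd.differentiableAt, hψz]

end Global

end GeodesicFlow

/-! ### Assembly of the theorem -/

namespace GeodesicFlow

open SmoothFlow

theorem exists_independent_integrals {m : ℕ} {g : MetricTensor (m + 1)} {D : Set (Coord (m + 1))}
    (hD : IsOpen D) (hconv : g.IsGeodesicallyConvex D) :
    ∃ F : Unit ⊕ (Fin m ⊕ Fin m) → Phase (m + 1) → ℝ, (∀ i, g.IsSmoothIntegral D (F i)) ∧
      FunctionallyIndependent D F ∧ ∀ i i' : Unit ⊕ Fin m, ∀ z ∈ cotangent D,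
        poissonBracket (F (i.map id .inl)) (F (i'.map id .inl)) z = 0 := by
  obtain ⟨𝒞, hc, hdis, hae⟩ := OrbitCell.exists_disjoint_cells hD hconv
  have := hc.to_subtype
  obtain ⟨ε, hε₀, hε⟩ := exists_pos_contDiffOn_tsum (isOpen_cotangent hD)
    (f := fun (c : 𝒞) l => c.1.integral l)
    fun c l => OrbitCell.contDiffOn_integral hD hconv l
  refine ⟨globalIntegral 𝒞 ε, isSmoothIntegral_globalIntegral hD hε, ?_,
    fun i i' z hz => poissonBracket_globalIntegral hD hε₀ hε hdis i i' hz⟩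
  filter_upwards [hae] with z hz hzD
  obtain ⟨c, hc, hzc⟩ := hz hzD
  exact linearIndependent_fderiv_globalIntegral hD hε₀ hε hdis (c := ⟨c, hc⟩) hzc

end GeodesicFlow

theorem proposition4p1 (n : ℕ) (hn : 2 ≤ n) (g : GeodesicFlow.MetricTensor n)
    (D : Set (GeodesicFlow.Coord n)) (hD : GeodesicFlow.IsOpenDisc D)
    (hconv : g.IsGeodesicallyConvex D) :
    g.IsLiouvilleIntegrable D ∧ g.IsSuperintegrable D := by
  obtain ⟨m, rfl⟩ : ∃ m, n = m + 1 := ⟨n - 1, by omega⟩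
  obtain ⟨F, hF, hind, hcomm⟩ := GeodesicFlow.exists_independent_integrals hD.1 hconv
  have hinj : Function.Injective (Sum.map id .inl : Unit ⊕ Fin m → Unit ⊕ (Fin m ⊕ Fin m)) :=
    Function.injective_id.sumMap Sum.inl_injective
  constructor
  -- With `n = m + 1`, the energy and the `m` commuting functions make `n`; adding the other `m`
  -- gives `2m + 1 = 2n - 1`.
  · let e : Fin (m + 1) ≃ Unit ⊕ Fin m := Fintype.equivOfCardEq (by simp; omega)
    refine ⟨fun k => F ((e k).map id .inl), fun k => hF _, ?_, fun k l => hcomm _ _⟩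
    filter_upwards [hind] with z hz hzD
    exact (hz hzD).comp _ (hinj.comp e.injective)
  · let e : Fin (2 * (m + 1) - 1) ≃ Unit ⊕ (Fin m ⊕ Fin m) :=
      Fintype.equivOfCardEq (by simp; omega)
    refine ⟨fun k => F (e k), fun k => hF _, ?_,
      Finset.univ.map ⟨fun i : Unit ⊕ Fin m => e.symm (i.map id .inl), e.symm.injective.comp hinj⟩, ?_, ?_⟩
    · filter_upwards [hind] with z hz hzD
      exact (hz hzD).comp _ e.injective
    · rw [Finset.card_map, Finset.card_univ, Fintype.card_sum, Fintype.card_unit, Fintype.card_fin,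
        add_comm]
    · intro k hk l hl
      obtain ⟨i, -, rfl⟩ := Finset.mem_map.1 hk
      obtain ⟨j, -, rfl⟩ := Finset.mem_map.1 hl
      simp only [Function.Embedding.coeFn_mk, Equiv.apply_symm_apply]
      exact hcomm i j
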